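/- Let $0<r<1$, $\alpha\ge \tfrac12$, $\theta=\pi/\alpha$, and let $\Omega=\{z\in\mathbb C: r<|z|<1,\ 0<\arg z<\theta\}$ (with $\arg z\in[0,2\pi)$). Let $\Gamma_1$ be the arc $\tau\mapsto e^{i\tau}$, $\tau$ from $0$ to $\theta$, let $\Gamma_2$ be the arc $\tau\mapsto re^{i\tau}$, $\tau$ from $\theta$ to $0$, and put $\varpi=e^{i\theta}$, $\omega=re^{i\theta}$. All powers use the branch $(\rho e^{i\varphi})^{s}=\rho^{s}e^{is\varphi}$, $0\le\varphi\le\theta$ (on the segment $[\varpi,\omega]$ one takes $\varphi=\theta$). Put $$H_1(z,\zeta)=\frac{\zeta+z}{\zeta-z}-\frac{\overline\zeta+z}{\overline\zeta-z}+2\sum_{m=1}^\infty r^{2\alpha m}\left[\frac{\zeta}{r^{2\alpha m}\zeta-z}-\frac{z}{r^{2\alpha m}z-\zeta}-\frac{\overline\zeta}{r^{2\alpha m}\overline\zeta-z}+\frac{z}{r^{2\alpha m}z-\overline\zeta}\right],$$ $$H_2(z,\zeta)=\frac1{\zeta-z}-\frac{z}{1-z\zeta}+\sum_{m=1}^\infty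 r^{2\alpha m}\left[\frac1{r^{2\alpha m}\zeta-z}-\frac{z}{\zeta(r^{2\alpha m}z-\zeta)}-\frac1{\zeta(r^{2\alpha m}-z\zeta)}+\frac{z}{r^{2\alpha m}z\zeta-1}\right].$$ Let $n\ge1$, $p>2$, $f\in L_p(\Omega,\mathbb C)$ and $\gamma_0,\dots,\gamma_{n-1}\in C(\partial\Omega,\mathbb R)$. For $z\in\Omega$ define the poly-Schwarz operator $$S_n[\gamma_0,\dots,\gamma_{n-1}](z)=\sum_{k=0}^{n-1}\frac{(-1)^k}{k!}\left\{\frac{\alpha}{2\pi i}\int_{\Gamma_1\cup\Gamma_2}\gamma_k(\zeta)\left(\zeta-z+\overline{\zeta-z}\right)^kH_1(z^\alpha,\zeta^\alpha)\frac{d\zeta}{\zeta}+\frac{\alpha}{\pi i}\int_{[\varpi,\omega]\cup[r,1]}\gamma_k(\zeta)\left(\zeta-z+\overline{\zeta-z}\right)^kH_2(z^\alpha,\zeta^\alpha)\zeta^{\alpha-1}\,d\zeta\right\}$$ and the poly-Pompeiu operator $$T_n[f](z)=\frac{(-1)^n\alpha}{\pi(n-1)!}\iint_\Omega\left(\zeta-z+\overline{\zeta-z}\right)^{n-1}\left[\zeta^{\alpha-1}H_2(z^\alpha,\zeta^\alpha)f(\zeta)-\overline{\zeta^{\alpha-1}}H_2(z^\alpha,\overline{\zeta^\alpha})\overline{f(\zeta)}\right]d\xi\,d\eta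 ,\qquad \zeta=\xi+i\eta .$$ Consider the Schwarz problem $$\partial_{\overline z}^n w=f\ \text{ in }\Omega,\qquad \lim_{z\to t,\ z\in\Omega}\operatorname{Re}\partial_{\overline z}^k w(z)=\gamma_k(t)\quad (t\in\partial\Omega,\ k=0,\dots,n-1).$$ Here a solution is a function $w$ on $\Omega$ whose iterated derivatives $\partial_{\overline z}^kw$, $k\le n-1$, exist classically (each of $w,\dots,\partial_{\overline z}^{n-2}w$ is real differentiable in $\Omega$), with $\partial_{\overline z}^{n-1}w$ continuous in $\Omega$, and for which $\partial_{\overline z}(\partial_{\overline z}^{n-1}w)=f$ holds in the weak sense, that is, when tested with smooth functions compactly supported in $\Omega$. Then a function $w$ is a solution of the Schwarz problem if and only if there are real constants $c_0,\dots,c_{n-1}$ such that $$w(z)=S_n[\gamma_0,\dots,\gamma_{n-1}](z)+T_n[f](z)+i\sum_{k=0}^{n-1}c_k(z+\overline z)^k,\qquad z\in\Omega .$$ In particular, this formula gives a solution for every choice of $c_0,\dots,c_{n-1}\in\mathbb R$. -/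

import Mathlib

open scoped ContDiff

noncomputable section

namespace SectorRing

/-- The branch of the argument with values in `[0, 2π)`. -/
def argPos (z : ℂ) : ℝ := if 0 ≤ z.arg then z.arg else z.arg + 2 * Real.pi

/-- The value `ρ ^ s * exp (i s φ)` of the power `ζ ^ s` at `ζ = ρ exp (i φ)`, for the branch of
the logarithm that takes the value `log ρ + i φ` there. -/
def polarPow (s ρ φ : ℝ) : ℂ := ((ρ ^ s : ℝ) : ℂ) * Complex.exp (Complex.I * ((s * φ : ℝ) : ℂ))

/-- The power `z ^ s` with real exponent, for the branch with argument in `[0, 2π)`. -/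
def cpowPos (s : ℝ) (z : ℂ) : ℂ := polarPow s ‖z‖ (argPos z)

/-- The point `ρ exp (i φ)`. -/
def polarPt (ρ φ : ℝ) : ℂ := (ρ : ℂ) * Complex.exp (Complex.I * (φ : ℂ))

/-- The sector ring `0 < r < |z| < 1`, `0 < arg z < π / α`. For `α = 1 / 2` it is the annulus slit
along the segment `[r, 1]`. -/
def sectorRing (r α : ℝ) : Set ℂ :=
  {z | r < ‖z‖ ∧ ‖z‖ < 1 ∧ 0 < argPos z ∧ argPos z < Real.pi / α}

/-- The kernel `H₁(z, ζ)`; the summation index is `m + 1 = 1, 2, …`. -/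
def kernelH1 (r α : ℝ) (z ζ : ℂ) : ℂ :=
  let cζ := (starRingEnd ℂ) ζ
  (ζ + z) / (ζ - z) - (cζ + z) / (cζ - z)
    + 2 * ∑' m : ℕ,
        let q : ℂ := ((r ^ (2 * α * ((m : ℝ) + 1)) : ℝ) : ℂ)
        q * (ζ / (q * ζ - z) - z / (q * z - ζ) - cζ / (q * cζ - z) + z / (q * z - cζ))

/-- The kernel `H₂(z, ζ)`; the summation index is `m + 1 = 1, 2, …`. -/
def kernelH2 (r α : ℝ) (z ζ : ℂ) : ℂ :=
  1 / (ζ - z) - z / (1 - z * ζ)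
    + ∑' m : ℕ,
        let q : ℂ := ((r ^ (2 * α * ((m : ℝ) + 1)) : ℝ) : ℂ)
        q * (1 / (q * ζ - z) - z / (ζ * (q * z - ζ)) - 1 / (ζ * (q - z * ζ))
          + z / (q * z * ζ - 1))

/-- `ζ - z + conj (ζ - z)`. -/
def twoRe (z ζ : ℂ) : ℂ := (ζ - z) + (starRingEnd ℂ) (ζ - z)

/-- The integrand `γ(ζ) (ζ - z + conj (ζ - z)) ^ k H₁(z ^ α, ζ ^ α) (dζ/dτ) / ζ` along an arc
`ζ = ρ exp (i τ)`, for which `dζ/dτ = i ζ`. -/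
def arcIntegrand (r α : ℝ) (γ : ℂ → ℝ) (k : ℕ) (z : ℂ) (ρ τ : ℝ) : ℂ :=
  (γ (polarPt ρ τ) : ℂ) * twoRe z (polarPt ρ τ) ^ k
    * kernelH1 r α (cpowPos α z) (polarPow α ρ τ)
    * (Complex.I * polarPt ρ τ) / polarPt ρ τ

/-- The integrand `γ(ζ) (ζ - z + conj (ζ - z)) ^ k H₂(z ^ α, ζ ^ α) ζ ^ (α - 1) (dζ/dρ)` along a
ray `ζ = ρ exp (i φ)`, for which `dζ/dρ = exp (i φ)`. -/
def rayIntegrand (r α : ℝ) (γ : ℂ → ℝ) (k : ℕ) (z : ℂ) (φ ρ : ℝ) : ℂ :=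
  (γ (polarPt ρ φ) : ℂ) * twoRe z (polarPt ρ φ) ^ k
    * kernelH2 r α (cpowPos α z) (polarPow α ρ φ)
    * polarPow (α - 1) ρ φ * Complex.exp (Complex.I * (φ : ℂ))

/-- The poly-Schwarz operator. The outer arc is run through from `1` to `exp (i π / α)`, the inner
arc from `r exp (i π / α)` to `r`, the two segments from `exp (i π / α)` to `r exp (i π / α)` and
from `r` to `1`. -/
def polySchwarz (r α : ℝ) (n : ℕ) (γ : Fin n → ℂ → ℝ) (z : ℂ) : ℂ :=
  ∑ k : Fin n, ((-1 : ℂ) ^ (k : ℕ) / ((k : ℕ).factorial : ℂ)) *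
    ((α : ℂ) / (2 * (Real.pi : ℂ) * Complex.I) *
        ((∫ τ in (0 : ℝ)..(Real.pi / α), arcIntegrand r α (γ k) k z 1 τ)
          + ∫ τ in (Real.pi / α)..(0 : ℝ), arcIntegrand r α (γ k) k z r τ)
      + (α : ℂ) / ((Real.pi : ℂ) * Complex.I) *
        ((∫ ρ in (1 : ℝ)..r, rayIntegrand r α (γ k) k z (Real.pi / α) ρ)
          + ∫ ρ in r..(1 : ℝ), rayIntegrand r α (γ k) k z 0 ρ))

/-- The poly-Pompeiu operator, of order `n ≥ 1`. -/
def polyPompeiu (r α : ℝ) (n : ℕ) (f : ℂ → ℂ) (z : ℂ) : ℂ :=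
  ((-1 : ℂ) ^ n * (α : ℂ) / ((Real.pi : ℂ) * ((n - 1).factorial : ℂ))) *
    ∫ ζ in sectorRing r α, twoRe z ζ ^ (n - 1) *
      (cpowPos (α - 1) ζ * kernelH2 r α (cpowPos α z) (cpowPos α ζ) * f ζ
        - (starRingEnd ℂ) (cpowPos (α - 1) ζ)
          * kernelH2 r α (cpowPos α z) ((starRingEnd ℂ) (cpowPos α ζ)) * (starRingEnd ℂ) (f ζ))

/-- The Wirtinger derivative `∂w/∂z̄ = (∂w/∂x + i ∂w/∂y) / 2`. -/
def dbar (w : ℂ → ℂ) (z : ℂ) : ℂ :=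
  (1 / 2 : ℂ) * (fderiv ℝ w z 1 + Complex.I * fderiv ℝ w z Complex.I)

/-- `∂u/∂z̄ = g` in `Ω` in the weak sense, tested with smooth functions compactly supported
in `Ω`. -/
def HasWeakDbar (Ω : Set ℂ) (u g : ℂ → ℂ) : Prop :=
  ∀ φ : ℂ → ℂ, ContDiff ℝ ∞ φ → HasCompactSupport φ → tsupport φ ⊆ Ω →
    ∫ z in Ω, u z * dbar φ z = - ∫ z in Ω, g z * φ z

/-- `w` solves the Schwarz problem `∂ⁿw/∂z̄ⁿ = f` in `Ω`, `Re ∂ᵏw/∂z̄ᵏ = γₖ` on `∂Ω`, `k < n`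
(for `n ≥ 1`). The derivatives of order `k ≤ n - 1` are classical and continuous; the derivative
of order `n` is the weak `z̄`-derivative of the one of order `n - 1`. -/
structure IsSchwarzSolution (Ω : Set ℂ) (n : ℕ) (f : ℂ → ℂ) (γ : Fin n → ℂ → ℝ)
    (w : ℂ → ℂ) : Prop where
  differentiableOn : ∀ k : ℕ, k + 1 < n → DifferentiableOn ℝ (dbar^[k] w) Ω
  continuousOn : ContinuousOn (dbar^[n - 1] w) Ω
  equation : HasWeakDbar Ω (dbar^[n - 1] w) f
  boundary : ∀ k : Fin n, ∀ t ∈ frontier Ω,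
    Filter.Tendsto (fun z => (dbar^[(k : ℕ)] w z).re) (nhdsWithin t Ω) (nhds (γ k t))

end SectorRing

end

/-! The substitution z = exp u turns the sector ring into the rectangle (log r, 0) × (0, π/α). For α
= 1/2 the two edges of the slit become two different sides of the rectangle. Put q = r^(2α). Both
kernels are built from one function V = `villat q` with V(1/w) = 1 - V(w) and V(qw) = V(w) + 1: by
`mul_kernelH2`, ζ H₂(z, ζ) = 1 + V(z/ζ) - V(zζ), and by `kernelH1_eq_ringKernel` H₁ is a difference
of two such expressions when ζ lies on an arc. So Schwarz and Pompeiu operators integrate the same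
object `pairKernel`, K(u, v) a - K(u, v̄) ā. In u it has a simple pole at v, and the two functional
equations, read as reflections in the circles |z| = 1 and |z|² = q, make its real part vanish for u
on the boundary (`re_logKernel_pair`).

Boundary integrals. With the coefficient a of a side, the real part of the pair is a Poisson kernel:
its mass is 1 by the residue theorem, and it is nonnegative by the minimum principle. Hence
`tendsto_re_poisson`. The weight (ζ - z + conj (ζ - z))^k is the real number (2 Re ζ - 2 Re z)^k.
Its binomial expansion writes the k-th integral as a polynomial in z + z̄ with holomorphic
coefficients (`schwarzTerm_eq_sum_poisson`). At the boundary the expansion collapses to γ · 0^k, and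
∂/∂z̄ lowers k to k - 1 with the factor -k.

Area integral. With a = α f(ζ)/ζ the pair becomes a Cauchy type kernel with residue -f(ζ). Since p >
2, the conjugate exponent is below 2 and 1/|ζ - z| is integrable to that power uniformly in z, so
the potentials are continuous and their real parts tend to zero at the boundary. Again ∂/∂z̄ lowers
the exponent of the weight (`hasFDerivAt_potential`), and at exponent zero it yields f weakly, up to
a constant (`hasWeakDbar_potential`).

Thus ∂/∂z̄ carries the formula of order n + 1 to the formula of order n with shifted data, and the
real part of the formula has the boundary values γ₀. The equivalence follows by induction on n. A
solution minus the formula has zero z̄-derivative, so it is holomorphic (for order one by Weyl's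
lemma, `differentiableOn_of_weakDbar_eq_zero`); its real part tends to zero at the boundary, so it
is an imaginary constant (`eq_imaginary_const_of_tendsto_re`). These constants accumulate to the
polynomial in z + z̄. -/

noncomputable section

open scoped ContDiff ComplexConjugate
open Filter Topology Set MeasureTheory

namespace SectorRing

section

/-! ### The one-variable kernel -/

/-- The sum `∑ q ^ m / (q ^ m - w)` over `m ≥ 1`. -/
def geomSum (q : ℝ) (w : ℂ) : ℂ := ∑' m : ℕ, (q : ℂ) ^ (m + 1) / ((q : ℂ) ^ (m + 1) - w)

/-- The kernel `1 / (1 - w)`, made quasi-invariant under `w ↦ q w`. -/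
def villat (q : ℝ) (w : ℂ) : ℂ := 1 / (1 - w) + geomSum q w - geomSum q w⁻¹

variable {q : ℝ}

lemma norm_geomTerm_le (h0 : 0 < q) (h1 : q < 1) {ρ : ℝ} (hρ : q < ρ) {w : ℂ} (hw : ρ ≤ ‖w‖)
    (m : ℕ) : ‖(q : ℂ) ^ (m + 1) / ((q : ℂ) ^ (m + 1) - w)‖ ≤ q ^ m * (q / (ρ - q)) := by
  have hq : ‖(q : ℂ) ^ (m + 1)‖ = q ^ (m + 1) := by
    rw [norm_pow, Complex.norm_real, Real.norm_of_nonneg h0.le]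
  have h2 : q ^ (m + 1) ≤ q := by
    simpa using pow_le_pow_of_le_one h0.le h1.le (show 1 ≤ m + 1 by omega)
  have h3 : ρ - q ≤ ‖(q : ℂ) ^ (m + 1) - w‖ := by
    have := norm_sub_norm_le w ((q : ℂ) ^ (m + 1))
    rw [norm_sub_rev] at this
    linarith
  rw [norm_div, hq, pow_succ, mul_div_assoc]
  have : 0 < ρ - q := by linarith
  gcongr

/-- Only the tail with q ^ N < ‖w‖ / 2 needs an estimate. A vanishing denominator, where division by
zero gives the value 0, can occur only among the finitely many earlier terms, so poles need not be
excluded. -/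
lemma summable_geomTerm (h0 : 0 < q) (h1 : q < 1) {w : ℂ} (hw : w ≠ 0) :
    Summable fun m : ℕ => (q : ℂ) ^ (m + 1) / ((q : ℂ) ^ (m + 1) - w) := by
  have hw' : 0 < ‖w‖ := norm_pos_iff.2 hw
  have ht : Tendsto (fun m : ℕ => q ^ m) atTop (𝓝 0) :=
    tendsto_pow_atTop_nhds_zero_of_lt_one h0.le h1
  obtain ⟨N, hN⟩ := (ht.eventually (gt_mem_nhds (half_pos hw'))).exists
  rw [← summable_nat_add_iff N]
  refine Summable.of_norm_bounded (g := fun m => q ^ m * (2 / ‖w‖))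
    ((summable_geometric_of_lt_one h0.le h1).mul_right _) fun m => ?_
  have hq : ‖(q : ℂ) ^ (m + N + 1)‖ = q ^ (m + N + 1) := by
    rw [norm_pow, Complex.norm_real, Real.norm_of_nonneg h0.le]
  have h2 : q ^ (m + N + 1) ≤ q ^ N := pow_le_pow_of_le_one h0.le h1.le (by omega)
  have h2' : q ^ (m + N + 1) ≤ q ^ m := pow_le_pow_of_le_one h0.le h1.le (by omega)
  have h3 : ‖w‖ / 2 ≤ ‖(q : ℂ) ^ (m + N + 1) - w‖ := by
    have := norm_sub_norm_le w ((q : ℂ) ^ (m + N + 1))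
    rw [norm_sub_rev] at this
    linarith
  rw [norm_div, hq, div_eq_mul_inv]
  refine mul_le_mul h2' ?_ (by positivity) (by positivity)
  rw [show 2 / ‖w‖ = (‖w‖ / 2)⁻¹ by rw [inv_div]]
  gcongr

/-- Cancelling q lowers every exponent by one, so the series for q w is the series for w preceded by
its term of index zero. -/
lemma geomSum_mul (h0 : 0 < q) (h1 : q < 1) {w : ℂ} (hw : w ≠ 0) :
    geomSum q (q * w) = 1 / (1 - w) + geomSum q w := by
  have hq : (q : ℂ) ≠ 0 := by exact_mod_cast h0.ne'
  have hs := summable_geomTerm h0 h1 (mul_ne_zero hq hw)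
  have key : ∀ m : ℕ, (q : ℂ) ^ (m + 1) / ((q : ℂ) ^ (m + 1) - q * w)
      = (q : ℂ) ^ m / ((q : ℂ) ^ m - w) := fun m => by
    rw [pow_succ', ← mul_sub, mul_div_mul_left _ _ hq]
  unfold geomSum
  rw [hs.tsum_eq_zero_add]
  simp only [key, zero_add, pow_zero]

lemma differentiableOn_geomSum (h0 : 0 < q) (h1 : q < 1) :
    DifferentiableOn ℂ (geomSum q) {w | q < ‖w‖} := by
  intro w hw
  obtain ⟨ρ, hqρ, hρ⟩ := exists_between (show q < ‖w‖ from hw)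
  have hU : IsOpen {w : ℂ | ρ < ‖w‖} := isOpen_lt continuous_const continuous_norm
  refine DifferentiableAt.differentiableWithinAt ?_
  refine DifferentiableOn.differentiableAt (s := {w : ℂ | ρ < ‖w‖}) ?_ (hU.mem_nhds hρ)
  refine Complex.differentiableOn_tsum_of_summable_norm
    (u := fun m => q ^ m * (q / (ρ - q)))
    ((summable_geometric_of_lt_one h0.le h1).mul_right _) (fun m => ?_) hU
    fun m w hw => norm_geomTerm_le h0 h1 hqρ (le_of_lt hw) m
  refine (differentiableOn_const _).div ((differentiableOn_const _).sub differentiableOn_id) ?_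
  intro w hw h
  have h2 : q ^ (m + 1) ≤ q := by
    simpa using pow_le_pow_of_le_one h0.le h1.le (show 1 ≤ m + 1 by omega)
  have : ‖w‖ = q ^ (m + 1) := by
    rw [← sub_eq_zero.1 h, norm_pow, Complex.norm_real, Real.norm_of_nonneg h0.le]
  have hw' : ρ < ‖w‖ := hw
  linarith

lemma norm_geomSum_le (h0 : 0 < q) (h1 : q < 1) {ρ : ℝ} (hρ : q < ρ) {w : ℂ} (hw : ρ ≤ ‖w‖) :
    ‖geomSum q w‖ ≤ (1 - q)⁻¹ * (q / (ρ - q)) := by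
  refine tsum_of_norm_bounded (g := fun m => q ^ m * (q / (ρ - q))) ?_
    fun m => norm_geomTerm_le h0 h1 hρ hw m
  exact (hasSum_geometric_of_lt_one h0.le h1).mul_right _

lemma measurable_geomSum (h0 : 0 < q) (h1 : q < 1) : Measurable (geomSum q) := by
  classical
  -- At w = 0 every term equals 1 and the partial sums diverge, so they are overwritten there by the
  -- value of `geomSum`.
  refine measurable_of_tendsto_metrizable (f := fun (N : ℕ) (w : ℂ) =>
    if w ∈ ({0} : Set ℂ) then geomSum q 0 else
      ∑ m ∈ Finset.range N, (q : ℂ) ^ (m + 1) / ((q : ℂ) ^ (m + 1) - w)) (fun N => ?_) ?_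
  · refine Measurable.ite (measurableSet_singleton 0) measurable_const ?_
    refine Finset.measurable_fun_sum _ fun m _ => ?_
    fun_prop
  · rw [tendsto_pi_nhds]
    intro w
    by_cases hw : w = 0
    · subst hw
      simp
    · simpa [hw, geomSum] using (summable_geomTerm h0 h1 hw).hasSum.tendsto_sum_nat

lemma conj_geomSum (w : ℂ) :
    (starRingEnd ℂ) (geomSum q w) = geomSum q ((starRingEnd ℂ) w) := by
  unfold geomSum
  rw [Complex.conj_tsum]
  simp

lemma conj_villat (w : ℂ) : (starRingEnd ℂ) (villat q w) = villat q ((starRingEnd ℂ) w) := by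
  simp [villat, conj_geomSum]

lemma measurable_villat (h0 : 0 < q) (h1 : q < 1) : Measurable (villat q) := by
  have := measurable_geomSum h0 h1
  unfold villat
  fun_prop

lemma villat_inv {w : ℂ} (hw : w ≠ 0) (hw1 : w ≠ 1) : villat q w⁻¹ = 1 - villat q w := by
  have h : 1 / (1 - w⁻¹) = 1 - 1 / (1 - w) := by
    have h1 : 1 - w ≠ 0 := sub_ne_zero.2 hw1.symm
    have h2 : w - 1 ≠ 0 := sub_ne_zero.2 hw1
    field_simp
    ring
  rw [villat, villat, h, inv_inv]
  ring

/-- Passing from w to q w, one series gains 1 / (1 - w) and the other loses 1 / (1 - (q w)⁻¹) = 1 -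
1 / (1 - q w). The rational terms recombine and the constant 1 is left over. -/
lemma villat_mul (h0 : 0 < q) (h1 : q < 1) {w : ℂ} (hw : w ≠ 0) (hw1 : q * w ≠ 1) :
    villat q (q * w) = villat q w + 1 := by
  have hq : (q : ℂ) ≠ 0 := by exact_mod_cast h0.ne'
  have h2 : geomSum q w⁻¹ = 1 / (1 - (q * w)⁻¹) + geomSum q (q * w)⁻¹ := by
    rw [← geomSum_mul h0 h1 (inv_ne_zero (mul_ne_zero hq hw))]
    congr 1
    field_simp
  have h3 : 1 / (1 - (q * w)⁻¹) = 1 - 1 / (1 - q * w) := by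
    have h1 : 1 - q * w ≠ 0 := sub_ne_zero.2 hw1.symm
    have h2 : q * w - 1 ≠ 0 := sub_ne_zero.2 hw1
    field_simp
    ring
  rw [villat, villat, geomSum_mul h0 h1 hw, h2, h3]
  ring

/-- Isolates the poles at 1 and q. For q² < |w| < 1/q both remaining series have arguments of
modulus greater than q, where `geomSum` is holomorphic. -/
lemma villat_eq (h0 : 0 < q) (h1 : q < 1) {w : ℂ} (hw : w ≠ 0) :
    villat q w = 1 / (1 - w) + q / (q - w) + (geomSum q (w / q) - geomSum q w⁻¹) := by
  have hq : (q : ℂ) ≠ 0 := by exact_mod_cast h0.ne'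
  have h2 := geomSum_mul h0 h1 (div_ne_zero hw hq)
  rw [mul_div_cancel₀ _ hq] at h2
  have h3 : 1 / (1 - w / q) = q / (q - w) := by
    rw [← mul_div_mul_left 1 (1 - w / q) hq]
    congr 1
    · ring
    · field_simp
  rw [villat, h2, h3]
  ring

lemma differentiableAt_villat (h0 : 0 < q) (h1 : q < 1) {w : ℂ} (hw : q ^ 2 < ‖w‖)
    (hw' : ‖w‖ < q⁻¹) (hw1 : w ≠ 1) (hwq : w ≠ q) : DifferentiableAt ℂ (villat q) w := by
  have hn : 0 < ‖w‖ := (by positivity : 0 < q ^ 2).trans hw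
  have hw0 : w ≠ 0 := norm_pos_iff.1 hn
  have hq : (q : ℂ) ≠ 0 := by exact_mod_cast h0.ne'
  have hU : IsOpen {w : ℂ | q < ‖w‖} := isOpen_lt continuous_const continuous_norm
  have hA : ∀ w : ℂ, q < ‖w‖ → DifferentiableAt ℂ (geomSum q) w := fun w hw =>
    (differentiableOn_geomSum h0 h1).differentiableAt (hU.mem_nhds hw)
  have e : villat q =ᶠ[𝓝 w] fun w =>
      1 / (1 - w) + q / (q - w) + (geomSum q (w / q) - geomSum q w⁻¹) := by
    filter_upwards [isOpen_ne.mem_nhds hw0] with w hw using villat_eq h0 h1 hw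
  refine DifferentiableAt.congr_of_eventuallyEq ?_ e
  have d1 : DifferentiableAt ℂ (fun w : ℂ => geomSum q (w / q)) w := by
    refine DifferentiableAt.comp w (hA _ ?_) (by fun_prop)
    rw [norm_div, Complex.norm_real, Real.norm_of_nonneg h0.le, lt_div_iff₀ h0]
    nlinarith
  have d2 : DifferentiableAt ℂ (fun w : ℂ => geomSum q w⁻¹) w := by
    refine DifferentiableAt.comp w (hA _ ?_) (differentiableAt_inv hw0)
    rw [norm_inv]
    exact (lt_inv_comm₀ hn h0).1 hw'
  have s1 : (1 : ℂ) - w ≠ 0 := sub_ne_zero.2 hw1.symm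
  have s2 : (q : ℂ) - w ≠ 0 := sub_ne_zero.2 hwq.symm
  fun_prop (disch := assumption)

lemma exists_norm_villat_le (h0 : 0 < q) (h1 : q < 1) {ρ : ℝ} (hρ0 : 0 < ρ) (hρ : ρ < q⁻¹) :
    ∃ C : ℝ, 0 < C ∧ ∀ w : ℂ, q ≤ ‖w‖ → ‖w‖ ≤ ρ →
      ‖villat q w‖ ≤ C * (1 + 1 / ‖1 - w‖ + 1 / ‖q - w‖) := by
  set C₁ := (1 - q)⁻¹ * (q / (1 - q))
  set C₂ := (1 - q)⁻¹ * (q / (ρ⁻¹ - q))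
  have hρ' : q < ρ⁻¹ := (lt_inv_comm₀ hρ0 h0).1 hρ
  have p1 : 0 < 1 - q := by linarith
  have p2 : 0 < ρ⁻¹ - q := by linarith
  have c1 : 0 ≤ C₁ := by positivity
  have c2 : 0 ≤ C₂ := by positivity
  refine ⟨1 + C₁ + C₂, by positivity, fun w hw hw' => ?_⟩
  have hn : 0 < ‖w‖ := h0.trans_le hw
  have hw0 : w ≠ 0 := norm_pos_iff.1 hn
  have b1 : ‖geomSum q (w / q)‖ ≤ C₁ := norm_geomSum_le h0 h1 h1 <| by
    rw [norm_div, Complex.norm_real, Real.norm_of_nonneg h0.le, le_div_iff₀ h0]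
    linarith
  have b2 : ‖geomSum q w⁻¹‖ ≤ C₂ := norm_geomSum_le h0 h1 hρ' <| by
    rw [norm_inv]
    exact inv_anti₀ hn hw'
  have b3 : ‖(1 : ℂ) / (1 - w)‖ = 1 / ‖1 - w‖ := by simp
  have b4 : ‖(q : ℂ) / (q - w)‖ ≤ 1 / ‖q - w‖ := by
    rw [norm_div, Complex.norm_real, Real.norm_of_nonneg h0.le]
    gcongr
  rw [villat_eq h0 h1 hw0]
  have n1 : 0 ≤ 1 / ‖1 - w‖ := by positivity
  have n2 : 0 ≤ 1 / ‖q - w‖ := by positivity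
  calc _ ≤ 1 / ‖1 - w‖ + 1 / ‖q - w‖ + (C₁ + C₂) := by
        refine (norm_add_le _ _).trans (add_le_add ((norm_add_le _ _).trans ?_)
          ((norm_sub_le _ _).trans (add_le_add b1 b2)))
        rw [b3]
        gcongr
    _ ≤ _ := by nlinarith [mul_nonneg c1 n1, mul_nonneg c1 n2, mul_nonneg c2 n1, mul_nonneg c2 n2]

/-! ### The kernels in terms of the one-variable kernel -/

/-- The multiplier `r ^ (2 α)`. -/
def qpar (r α : ℝ) : ℝ := r ^ (2 * α)

lemma qpar_pos {r : ℝ} (h0 : 0 < r) (α : ℝ) : 0 < qpar r α := Real.rpow_pos_of_pos h0 _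

lemma qpar_lt_one {r α : ℝ} (h0 : 0 < r) (h1 : r < 1) (hα : 0 < α) : qpar r α < 1 :=
  Real.rpow_lt_one h0.le h1 (by positivity)

lemma ofReal_rpow_eq_qpar_pow {r : ℝ} (h0 : 0 < r) (α : ℝ) (m : ℕ) :
    ((r ^ (2 * α * ((m : ℝ) + 1)) : ℝ) : ℂ) = (qpar r α : ℂ) ^ (m + 1) := by
  rw [qpar, ← Complex.ofReal_pow, Real.rpow_mul h0.le]
  norm_cast

lemma geomSum_inv_term {p w : ℂ} (hw : w ≠ 0) : p / (p - w⁻¹) = p * w / (p * w - 1) := by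
  rw [← mul_div_mul_right p (p - w⁻¹) hw, sub_mul, inv_mul_cancel₀ hw]

/-- Each bracket of the series splits into the four terms of `geomSum` at z / ζ, z ζ and their
inverses. The summand 1 comes from z ζ / (1 - z ζ) = 1 / (1 - z ζ) - 1, the only place where a
denominator has to be nonzero besides z and ζ themselves. -/
lemma mul_kernelH2 {r α : ℝ} (h0 : 0 < r) (h1 : r < 1) (hα : 0 < α) {z ζ : ℂ} (hz : z ≠ 0)
    (hζ : ζ ≠ 0) (h : z * ζ ≠ 1) :
    ζ * kernelH2 r α z ζ = 1 + villat (qpar r α) (z / ζ) - villat (qpar r α) (z * ζ) := by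
  have q0 := qpar_pos h0 α
  have q1 := qpar_lt_one h0 h1 hα
  set q := qpar r α with hq
  have hzζ : z / ζ ≠ 0 := div_ne_zero hz hζ
  have hzζ' : z * ζ ≠ 0 := mul_ne_zero hz hζ
  have S1 := (summable_geomTerm q0 q1 hzζ).hasSum
  have S2 := (summable_geomTerm q0 q1 (inv_ne_zero hzζ)).hasSum
  have S3 := (summable_geomTerm q0 q1 hzζ').hasSum
  have S4 := (summable_geomTerm q0 q1 (inv_ne_zero hzζ')).hasSum
  have S := ((S1.sub S2).sub S3).add S4
  simp only [kernelH2, ofReal_rpow_eq_qpar_pow h0, ← hq]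
  rw [mul_add ζ, ← tsum_mul_left]
  have key : ∀ m : ℕ, ζ * ((q : ℂ) ^ (m + 1) * (1 / ((q : ℂ) ^ (m + 1) * ζ - z)
        - z / (ζ * ((q : ℂ) ^ (m + 1) * z - ζ)) - 1 / (ζ * ((q : ℂ) ^ (m + 1) - z * ζ))
        + z / ((q : ℂ) ^ (m + 1) * z * ζ - 1)))
      = (q : ℂ) ^ (m + 1) / ((q : ℂ) ^ (m + 1) - z / ζ)
        - (q : ℂ) ^ (m + 1) / ((q : ℂ) ^ (m + 1) - (z / ζ)⁻¹)
        - (q : ℂ) ^ (m + 1) / ((q : ℂ) ^ (m + 1) - z * ζ)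
        + (q : ℂ) ^ (m + 1) / ((q : ℂ) ^ (m + 1) - (z * ζ)⁻¹) := fun m => by
    generalize (q : ℂ) ^ (m + 1) = p
    have e1 : p / (p - z / ζ) = p * ζ / (p * ζ - z) := by
      rw [← mul_div_mul_right p (p - z / ζ) hζ, sub_mul, div_mul_cancel₀ _ hζ]
    have e2 : p / (p - (z / ζ)⁻¹) = p * z / (p * z - ζ) := by
      rw [geomSum_inv_term hzζ, ← mul_div_mul_right _ (p * (z / ζ) - 1) hζ, sub_mul, one_mul,
        mul_assoc, div_mul_cancel₀ _ hζ]
    have e3 := geomSum_inv_term (p := p) hzζ'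
    have e4 : z / (ζ * (p * z - ζ)) = ζ⁻¹ * (z / (p * z - ζ)) := by
      rw [mul_comm ζ, ← div_div, div_eq_inv_mul]
    have e5 : 1 / (ζ * (p - z * ζ)) = ζ⁻¹ * (1 / (p - z * ζ)) := by
      rw [one_div, mul_inv, one_div]
    rw [e1, e2, e3, e4, e5]
    have hc : ζ * ζ⁻¹ = 1 := mul_inv_cancel₀ hζ
    rw [← mul_assoc p z ζ]
    simp only [div_eq_mul_inv, one_mul]
    linear_combination (-p * z * (p * z - ζ)⁻¹ - p * (p - z * ζ)⁻¹) * hc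
  simp only [key, S.tsum_eq]
  have e6 : ζ * (1 / (ζ - z)) = 1 / (1 - z / ζ) := by
    rw [← mul_div_mul_right 1 (1 - z / ζ) hζ, sub_mul, div_mul_cancel₀ _ hζ]
    ring
  have e7 : ζ * (z / (1 - z * ζ)) = 1 / (1 - z * ζ) - 1 := by
    have : 1 - z * ζ ≠ 0 := sub_ne_zero.2 h.symm
    rw [eq_sub_iff_add_eq, ← mul_div_assoc, eq_div_iff this, add_mul, div_mul_cancel₀ _ this]
    ring
  rw [mul_sub, e6, e7]
  simp only [villat, geomSum]
  ring

/-- By (ζ + z) / (ζ - z) = 2 / (1 - z / ζ) - 1 and the same identity for the conjugate, the two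
constants -1 cancel. -/
lemma kernelH1_eq {r α : ℝ} (h0 : 0 < r) (h1 : r < 1) (hα : 0 < α) {z ζ : ℂ} (hz : z ≠ 0)
    (hζ : ζ ≠ 0) (h : z ≠ ζ) (h' : z ≠ (starRingEnd ℂ) ζ) :
    kernelH1 r α z ζ =
      2 * (villat (qpar r α) (z / ζ) - villat (qpar r α) (z / (starRingEnd ℂ) ζ)) := by
  have q0 := qpar_pos h0 α
  have q1 := qpar_lt_one h0 h1 hα
  have hc : (starRingEnd ℂ) ζ ≠ 0 := by simpa using hζ
  simp only [kernelH1, ofReal_rpow_eq_qpar_pow h0]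
  set q := qpar r α with hq
  generalize (starRingEnd ℂ) ζ = ξ at *
  have hzζ : z / ζ ≠ 0 := div_ne_zero hz hζ
  have hzξ : z / ξ ≠ 0 := div_ne_zero hz hc
  have S1 := (summable_geomTerm q0 q1 hzζ).hasSum
  have S2 := (summable_geomTerm q0 q1 (inv_ne_zero hzζ)).hasSum
  have S3 := (summable_geomTerm q0 q1 hzξ).hasSum
  have S4 := (summable_geomTerm q0 q1 (inv_ne_zero hzξ)).hasSum
  have S := ((S1.sub S2).sub S3).add S4
  have E1 : ∀ p ξ : ℂ, ξ ≠ 0 → p / (p - z / ξ) = p * ξ / (p * ξ - z) := fun p ξ hξ => by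
    rw [← mul_div_mul_right p (p - z / ξ) hξ, sub_mul, div_mul_cancel₀ _ hξ]
  have E2 : ∀ p ξ : ℂ, ξ ≠ 0 → p / (p - (z / ξ)⁻¹) = p * z / (p * z - ξ) := fun p ξ hξ => by
    rw [geomSum_inv_term (div_ne_zero hz hξ), ← mul_div_mul_right _ (p * (z / ξ) - 1) hξ, sub_mul,
      one_mul, mul_assoc, div_mul_cancel₀ _ hξ]
  have key : ∀ m : ℕ, (q : ℂ) ^ (m + 1) * (ζ / ((q : ℂ) ^ (m + 1) * ζ - z)
        - z / ((q : ℂ) ^ (m + 1) * z - ζ) - ξ / ((q : ℂ) ^ (m + 1) * ξ - z)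
        + z / ((q : ℂ) ^ (m + 1) * z - ξ))
      = (q : ℂ) ^ (m + 1) / ((q : ℂ) ^ (m + 1) - z / ζ)
        - (q : ℂ) ^ (m + 1) / ((q : ℂ) ^ (m + 1) - (z / ζ)⁻¹)
        - (q : ℂ) ^ (m + 1) / ((q : ℂ) ^ (m + 1) - z / ξ)
        + (q : ℂ) ^ (m + 1) / ((q : ℂ) ^ (m + 1) - (z / ξ)⁻¹) := fun m => by
    rw [E1 _ _ hζ, E1 _ _ hc, E2 _ _ hζ, E2 _ _ hc]
    ring
  simp only [key, S.tsum_eq]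
  have E3 : ∀ ξ : ℂ, ξ ≠ 0 → z ≠ ξ → (ξ + z) / (ξ - z) = 2 * (1 / (1 - z / ξ)) - 1 :=
    fun ξ hξ hne => by
      have : ξ - z ≠ 0 := sub_ne_zero.2 hne.symm
      have h2 : 1 - z / ξ ≠ 0 := by
        intro h
        apply this
        rw [sub_eq_zero, eq_div_iff hξ, one_mul] at h
        rw [h, sub_self]
      field_simp
      ring
  rw [E3 _ hζ h, E3 _ hc h']
  simp only [villat, geomSum]
  ring

end

section

/-! ### Simple poles -/

/-- Riemann's theorem on removable singularities applied to (z - p) g(z) with value c at p. The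
regular part is the divided difference of this extension at p. -/
lemma exists_differentiableOn_of_simplePole {U : Set ℂ} (hU : IsOpen U) {p c : ℂ} (hp : p ∈ U)
    {g : ℂ → ℂ} (hg : DifferentiableOn ℂ g (U \ {p}))
    (hc : Tendsto (fun z => (z - p) * g z) (𝓝[≠] p) (𝓝 c)) :
    ∃ h : ℂ → ℂ, DifferentiableOn ℂ h U ∧ ∀ z, z ≠ p → g z = c / (z - p) + h z := by
  classical
  set G := Function.update (fun z => (z - p) * g z) p c with hG
  have hGc : ContinuousAt G p := continuousAt_update_same.2 hc
  have hGd : DifferentiableOn ℂ G (U \ {p}) := by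
    refine DifferentiableOn.congr (f := fun z => (z - p) * g z) ?_ fun z hz => by
      rw [hG, Function.update_of_ne hz.2]
    exact ((differentiableOn_id.sub_const p).mul hg)
  have hG' : DifferentiableOn ℂ G U :=
    (Complex.differentiableOn_compl_singleton_and_continuousAt_iff (hU.mem_nhds hp)).1 ⟨hGd, hGc⟩
  refine ⟨dslope G p, (Complex.differentiableOn_dslope (hU.mem_nhds hp)).2 hG', fun z hzp => ?_⟩
  have h0 : z - p ≠ 0 := sub_ne_zero.2 hzp
  rw [dslope_of_ne _ hzp, slope_def_field, hG, Function.update_of_ne hzp, Function.update_self,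
    ← add_div, eq_div_iff h0]
  ring

/-! ### The two-variable kernel on the annulus `q ≤ |z| ^ 2`, `|z| ≤ 1` -/

/-- The kernel `ζ H₂(z, ζ)` of the half ring. -/
def ringKernel (q : ℝ) (z ζ : ℂ) : ℂ := 1 + villat q (z / ζ) - villat q (z * ζ)

/-- The closed annulus `√q ≤ |z| ≤ 1`. -/
def ann (q : ℝ) : Set ℂ := {z | q ≤ ‖z‖ ^ 2 ∧ ‖z‖ ≤ 1}

variable {q : ℝ} {z ζ : ℂ}

lemma conj_mem_ann : (starRingEnd ℂ) z ∈ ann q ↔ z ∈ ann q := by simp [ann]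

lemma norm_pos_of_mem_ann (h0 : 0 < q) (hz : z ∈ ann q) : 0 < ‖z‖ := by
  have h := h0.trans_le hz.1
  rcases (norm_nonneg z).eq_or_lt with h' | h'
  · rw [← h'] at h
    norm_num at h
  · exact h'

lemma ne_zero_of_mem_ann (h0 : 0 < q) (hz : z ∈ ann q) : z ≠ 0 :=
  norm_pos_iff.1 (norm_pos_of_mem_ann h0 hz)

/-- Because |1 - zζ|² - |z - ζ̄|² = (1 - |z|²)(1 - |ζ|²). -/
lemma norm_sub_le_norm_one_sub_mul (h : 0 ≤ (1 - ‖z‖ ^ 2) * (1 - ‖ζ‖ ^ 2)) :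
    ‖z - (starRingEnd ℂ) ζ‖ ≤ ‖1 - z * ζ‖ := by
  refine (abs_le_of_sq_le_sq' ?_ (norm_nonneg _)).2
  rw [Complex.sq_norm, Complex.sq_norm, Complex.normSq_apply, Complex.normSq_apply] at h
  rw [Complex.sq_norm, Complex.sq_norm, Complex.normSq_apply, Complex.normSq_apply]
  simp
  nlinarith

lemma norm_sub_le_norm_one_sub_mul_of_mem_ann (hz : z ∈ ann q) (hζ : ζ ∈ ann q) :
    ‖z - (starRingEnd ℂ) ζ‖ ≤ ‖1 - z * ζ‖ := by
  apply norm_sub_le_norm_one_sub_mul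
  have h1 := hz.2
  have h2 := hζ.2
  have := norm_nonneg z
  have := norm_nonneg ζ
  exact mul_nonneg (by nlinarith) (by nlinarith)

/-- The preceding inequality for z / √q and ζ / √q. Both have modulus at least 1, so the product of
the two factors is again nonnegative. -/
lemma norm_sub_le_norm_qpar_sub_mul (h0 : 0 < q) (hz : z ∈ ann q) (hζ : ζ ∈ ann q) :
    √q * ‖z - (starRingEnd ℂ) ζ‖ ≤ ‖q - z * ζ‖ := by
  have hs : 0 < √q := Real.sqrt_pos.2 h0
  have hsq : √q ^ 2 = q := Real.sq_sqrt h0.le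
  have hs' : (√q : ℂ) ≠ 0 := by exact_mod_cast hs.ne'
  have hsq' : (√q : ℂ) ^ 2 = q := by exact_mod_cast hsq
  have hn : ∀ w ∈ ann q, 1 ≤ ‖w / (√q : ℂ)‖ ^ 2 := fun w hw => by
    rw [norm_div, Complex.norm_real, Real.norm_of_nonneg hs.le, div_pow, hsq, le_div_iff₀ h0]
    linarith [hw.1]
  have h1 := hn z hz
  have h2 := hn ζ hζ
  have := norm_sub_le_norm_one_sub_mul (z := z / (√q : ℂ)) (ζ := ζ / (√q : ℂ)) (by nlinarith)
  have e1 : z / (√q : ℂ) - (starRingEnd ℂ) (ζ / (√q : ℂ))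
      = (z - (starRingEnd ℂ) ζ) / (√q : ℂ) := by
    rw [map_div₀, Complex.conj_ofReal, sub_div]
  have e2 : 1 - z / (√q : ℂ) * (ζ / (√q : ℂ)) = (q - z * ζ) / (q : ℂ) := by
    rw [div_mul_div_comm, ← pow_two, hsq', sub_div, div_self]
    exact_mod_cast h0.ne'
  rw [e1, e2, norm_div, norm_div, Complex.norm_real, Complex.norm_real,
    Real.norm_of_nonneg hs.le, Real.norm_of_nonneg h0.le, div_le_div_iff₀ hs h0] at this
  have h3 : √q * (√q * ‖z - (starRingEnd ℂ) ζ‖) ≤ √q * ‖q - z * ζ‖ := by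
    calc _ = ‖z - (starRingEnd ℂ) ζ‖ * q := by rw [← mul_assoc, ← pow_two, hsq, mul_comm]
      _ ≤ _ := by linarith
  exact le_of_mul_le_mul_left h3 hs

lemma sqrt_le_norm (hz : z ∈ ann q) : √q ≤ ‖z‖ :=
  Real.sqrt_le_iff.2 ⟨norm_nonneg _, hz.1⟩

lemma norm_div_bounds (h0 : 0 < q) (hz : z ∈ ann q) (hζ : ζ ∈ ann q) :
    √q ≤ ‖z / ζ‖ ∧ ‖z / ζ‖ ≤ (√q)⁻¹ := by
  have hs : 0 < √q := Real.sqrt_pos.2 h0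
  have hζ0 := norm_pos_of_mem_ann h0 hζ
  have a1 := sqrt_le_norm hz
  have a2 := sqrt_le_norm hζ
  rw [norm_div, le_div_iff₀ hζ0, div_le_iff₀ hζ0]
  constructor
  · nlinarith [hζ.2]
  · calc ‖z‖ ≤ 1 := hz.2
      _ = (√q)⁻¹ * √q := by rw [inv_mul_cancel₀ hs.ne']
      _ ≤ _ := by gcongr

lemma norm_mul_bounds (h0 : 0 < q) (hz : z ∈ ann q) (hζ : ζ ∈ ann q) :
    q ≤ ‖z * ζ‖ ∧ ‖z * ζ‖ ≤ 1 := by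
  rw [norm_mul]
  have a1 := sqrt_le_norm hz
  have a2 := sqrt_le_norm hζ
  constructor
  · calc q = √q * √q := (Real.mul_self_sqrt h0.le).symm
      _ ≤ _ := by gcongr
  · exact mul_le_one₀ hz.2 (norm_nonneg _) hζ.2

lemma lt_sqrt_self (h0 : 0 < q) (h1 : q < 1) : q < √q := by
  rw [Real.lt_sqrt h0.le]
  nlinarith

/-- The poles in question are z/ζ = 1, kept away by |z - ζ|, and zζ = 1, zζ = q, both kept away by
|z - ζ̄|. The pole z/ζ = q is never approached, since |z/ζ| ≥ √q > q. Bounded contributions are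
absorbed into C / δ because δ ≤ 2. -/
lemma exists_norm_ringKernel_le (h0 : 0 < q) (h1 : q < 1) :
    ∃ C : ℝ, 0 < C ∧ ∀ z ∈ ann q, ∀ ζ ∈ ann q, ∀ δ : ℝ, 0 < δ → δ ≤ ‖z - ζ‖ →
      δ ≤ ‖z - (starRingEnd ℂ) ζ‖ → ‖ringKernel q z ζ‖ ≤ C / δ := by
  have hs : 0 < √q := Real.sqrt_pos.2 h0
  have hqs := lt_sqrt_self h0 h1
  obtain ⟨C, hC, hb⟩ := exists_norm_villat_le h0 h1 (inv_pos.2 hs) (inv_strictAnti₀ h0 hqs)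
  have hs1 : √q ≤ 1 := Real.sqrt_le_one.2 h1.le
  have hd : 0 < √q - q := by linarith
  refine ⟨2 + C * (2 + 1 + 2 / (√q - q)) + C * (2 + 1 + 1 / √q), by positivity,
    fun z hz ζ hζ δ hδ hd1 hd2 => ?_⟩
  have hζ0 := norm_pos_of_mem_ann h0 hζ
  have hδ2 : δ ≤ 2 := hd1.trans ((norm_sub_le _ _).trans (by linarith [hz.2, hζ.2]))
  have one_le : 1 ≤ 2 / δ := (one_le_div hδ).2 hδ2
  obtain ⟨n1, n2⟩ := norm_div_bounds h0 hz hζ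
  obtain ⟨n3, n4⟩ := norm_mul_bounds h0 hz hζ
  have b1 : ‖villat q (z / ζ)‖ ≤ C * (2 / δ + 1 / δ + 2 / (√q - q) / δ) := by
    refine (hb _ (hqs.le.trans n1) n2).trans ?_
    have : δ ≤ ‖1 - z / ζ‖ := by
      have e : 1 - z / ζ = (ζ - z) / ζ := by
        rw [sub_div, div_self (norm_pos_iff.1 hζ0)]
      rw [e, norm_div, norm_sub_rev, le_div_iff₀ hζ0]
      nlinarith [hζ.2]
    have h2 : √q - q ≤ ‖q - z / ζ‖ := by
      have := norm_sub_norm_le (z / ζ) (q : ℂ)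
      rw [norm_sub_rev, Complex.norm_real, Real.norm_of_nonneg h0.le] at this
      linarith
    have h3 : 1 / ‖q - z / ζ‖ ≤ 2 / (√q - q) / δ := by
      calc _ ≤ 1 / (√q - q) := by gcongr
        _ = 1 / (√q - q) * 1 := (mul_one _).symm
        _ ≤ 1 / (√q - q) * (2 / δ) := by gcongr
        _ = _ := by ring
    gcongr
  have b2 : ‖villat q (z * ζ)‖ ≤ C * (2 / δ + 1 / δ + 1 / √q / δ) := by
    refine (hb _ n3 (n4.trans ((one_le_inv₀ hs).2 hs1))).trans ?_
    have h2 := hd2.trans (norm_sub_le_norm_one_sub_mul_of_mem_ann hz hζ)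
    have h3 : √q * δ ≤ ‖q - z * ζ‖ :=
      (mul_le_mul_of_nonneg_left hd2 hs.le).trans (norm_sub_le_norm_qpar_sub_mul h0 hz hζ)
    have h4 : 1 / ‖q - z * ζ‖ ≤ 1 / √q / δ := by
      rw [div_div]
      gcongr
    gcongr
  calc ‖ringKernel q z ζ‖ ≤ 1 + ‖villat q (z / ζ)‖ + ‖villat q (z * ζ)‖ := by
        refine (norm_sub_le _ _).trans (add_le_add_left ((norm_add_le _ _).trans ?_) _)
        simp
    _ ≤ 2 / δ + C * (2 / δ + 1 / δ + 2 / (√q - q) / δ) + C * (2 / δ + 1 / δ + 1 / √q / δ) := by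
        gcongr
    _ = _ := by ring

lemma mul_ne_one_of_mem_ann (hz : z ∈ ann q) (hζ : ζ ∈ ann q) (h : z ≠ (starRingEnd ℂ) ζ) :
    z * ζ ≠ 1 := fun h' => by
  have := norm_sub_le_norm_one_sub_mul_of_mem_ann hz hζ
  rw [h', sub_self, norm_zero] at this
  exact h (sub_eq_zero.1 (norm_le_zero_iff.1 this))

lemma mul_ne_qpar_of_mem_ann (h0 : 0 < q) (hz : z ∈ ann q) (hζ : ζ ∈ ann q)
    (h : z ≠ (starRingEnd ℂ) ζ) : z * ζ ≠ q := fun h' => by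
  have hs : 0 < √q := Real.sqrt_pos.2 h0
  have := norm_sub_le_norm_qpar_sub_mul h0 hz hζ
  rw [h', sub_self, norm_zero] at this
  have h2 : ‖z - (starRingEnd ℂ) ζ‖ ≤ 0 := by
    by_contra! hh
    nlinarith
  exact h (sub_eq_zero.1 (norm_le_zero_iff.1 h2))

lemma differentiableAt_villat_mul (h0 : 0 < q) (h1 : q < 1) (hz : z ∈ ann q) (hζ : ζ ∈ ann q)
    (h : z ≠ (starRingEnd ℂ) ζ) : DifferentiableAt ℂ (villat q) (z * ζ) := by
  obtain ⟨n3, n4⟩ := norm_mul_bounds h0 hz hζ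
  exact differentiableAt_villat h0 h1 (by nlinarith)
    (n4.trans_lt ((one_lt_inv₀ h0).2 h1)) (mul_ne_one_of_mem_ann hz hζ h)
    (mul_ne_qpar_of_mem_ann h0 hz hζ h)

lemma differentiableAt_villat_div (h0 : 0 < q) (h1 : q < 1) (hz : z ∈ ann q) (hζ : ζ ∈ ann q)
    (h : z ≠ ζ) : DifferentiableAt ℂ (villat q) (z / ζ) := by
  obtain ⟨n1, n2⟩ := norm_div_bounds h0 hz hζ
  have hqs := lt_sqrt_self h0 h1
  have hs : 0 < √q := Real.sqrt_pos.2 h0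
  refine differentiableAt_villat h0 h1 (by nlinarith) (n2.trans_lt (inv_strictAnti₀ h0 hqs))
    (fun h' => h ((div_eq_one_iff_eq (ne_zero_of_mem_ann h0 hζ)).1 h')) fun h' => ?_
  rw [h', Complex.norm_real, Real.norm_of_nonneg h0.le] at n1
  linarith

lemma conj_ringKernel : (starRingEnd ℂ) (ringKernel q z ζ)
    = ringKernel q ((starRingEnd ℂ) z) ((starRingEnd ℂ) ζ) := by
  simp [ringKernel, conj_villat]

lemma div_ne_one_of_ne (h0 : 0 < q) (hζ : ζ ∈ ann q) (h : z ≠ ζ) : z / ζ ≠ 1 := fun h' =>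
  h ((div_eq_one_iff_eq (ne_zero_of_mem_ann h0 hζ)).1 h')

lemma villat_qpar_mul_div (h0 : 0 < q) (h1 : q < 1) (hz : z ∈ ann q) (hζ : ζ ∈ ann q) :
    villat q (q * (z / ζ)) = villat q (z / ζ) + 1 := by
  have hz0 := ne_zero_of_mem_ann h0 hz
  have hζ0 := ne_zero_of_mem_ann h0 hζ
  refine villat_mul h0 h1 (div_ne_zero hz0 hζ0) fun h => ?_
  have h2 := congrArg norm h
  obtain ⟨n1, n2⟩ := norm_div_bounds h0 hz hζ
  have hqs := lt_sqrt_self h0 h1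
  have hs : 0 < √q := Real.sqrt_pos.2 h0
  rw [norm_mul, norm_one, Complex.norm_real, Real.norm_of_nonneg h0.le] at h2
  have : q * ‖z / ζ‖ ≤ q * (√q)⁻¹ := by gcongr
  have h3 : q * (√q)⁻¹ < 1 := by
    rw [← div_eq_mul_inv, div_lt_one hs]
    exact hqs
  linarith

/-- Reflection of the first variable in the boundary circles and in the real axis. -/
lemma ringKernel_conj_left (h0 : 0 < q) (h1 : q < 1) (hz : z ∈ ann q) (hζ : ζ ∈ ann q)
    (h : z ≠ ζ) (h' : z ≠ (starRingEnd ℂ) ζ) (hb : z.im = 0 ∨ ‖z‖ = 1 ∨ ‖z‖ ^ 2 = q) :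
    ringKernel q ((starRingEnd ℂ) z) ζ = ringKernel q z ζ := by
  have hz0 := ne_zero_of_mem_ann h0 hz
  have hζ0 := ne_zero_of_mem_ann h0 hζ
  have hm : z * ζ ≠ 1 := mul_ne_one_of_mem_ann hz hζ h'
  have hd : z / ζ ≠ 1 := div_ne_one_of_ne h0 hζ h
  have i1 := villat_inv (q := q) (mul_ne_zero hz0 hζ0) hm
  have i2 := villat_inv (q := q) (div_ne_zero hz0 hζ0) hd
  rcases hb with hb | hb | hb
  · rw [Complex.conj_eq_iff_im.2 hb]
  -- On the unit circle reflection is inversion, and V(1/w) = 1 - V(w) interchanges the terms at z /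
  -- ζ and z ζ.
  · have e : (starRingEnd ℂ) z = z⁻¹ := by
      rw [Complex.inv_def, Complex.normSq_eq_norm_sq, hb]
      simp
    have e1 : z⁻¹ / ζ = (z * ζ)⁻¹ := by rw [mul_inv, div_eq_mul_inv]
    have e2 : z⁻¹ * ζ = (z / ζ)⁻¹ := by rw [inv_div, div_eq_inv_mul]
    rw [e, ringKernel, ringKernel, e1, e2, i1, i2]
    ring
  -- On the inner circle an extra factor q appears in both arguments. It adds 1 to each value of V,
  -- and the two ones cancel.
  · have e : (starRingEnd ℂ) z = q * z⁻¹ := by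
      rw [Complex.inv_def, Complex.normSq_eq_norm_sq, hb, mul_comm, mul_assoc, ← Complex.ofReal_mul,
        inv_mul_cancel₀ h0.ne']
      simp
    have e1 : q * z⁻¹ / ζ = q * (z * ζ)⁻¹ := by rw [mul_inv, div_eq_mul_inv, mul_assoc]
    have e2 : q * z⁻¹ * ζ = q * (ζ / z) := by rw [div_eq_inv_mul, mul_assoc]
    have e3 : villat q (ζ / z) = 1 - villat q (z / ζ) := by rw [← i2, inv_div]
    rw [e, ringKernel, ringKernel, e1, e2, villat_qpar_mul_div h0 h1 hζ hz,
      villat_mul h0 h1 (inv_ne_zero (mul_ne_zero hz0 hζ0)), i1, e3]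
    · ring
    · intro h2
      rw [← div_eq_mul_inv, div_eq_one_iff_eq (mul_ne_zero hz0 hζ0)] at h2
      exact mul_ne_qpar_of_mem_ann h0 hz hζ h' h2.symm

/-- The real part of the kernel pair vanishes when the first variable is on the boundary. -/
lemma re_ringKernel_pair (h0 : 0 < q) (h1 : q < 1) (hz : z ∈ ann q) (hζ : ζ ∈ ann q)
    (h : z ≠ ζ) (h' : z ≠ (starRingEnd ℂ) ζ) (hb : z.im = 0 ∨ ‖z‖ = 1 ∨ ‖z‖ ^ 2 = q) (a : ℂ) :
    (ringKernel q z ζ * a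
      - ringKernel q z ((starRingEnd ℂ) ζ) * (starRingEnd ℂ) a).re = 0 := by
  have e : ringKernel q z ((starRingEnd ℂ) ζ) = (starRingEnd ℂ) (ringKernel q z ζ) := by
    rw [conj_ringKernel, ringKernel_conj_left h0 h1 hz (conj_mem_ann.2 hζ) h' (by simpa using h) hb]
  rw [e, ← map_mul, Complex.sub_re, Complex.conj_re, sub_self]

/-- On the arcs ζ̄ is 1/ζ or q/ζ, so z ζ and z / ζ̄ agree up to a factor 1 or q, and so do z ζ̄ and
z / ζ. This puts the arc kernel and the ray kernel under one formula for all four sides. -/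
lemma kernelH1_eq_ringKernel {r α : ℝ} (hr0 : 0 < r) (hr1 : r < 1) (hα : 0 < α)
    (hz : z ∈ ann (qpar r α)) (hζ : ζ ∈ ann (qpar r α)) (h : z ≠ ζ) (h' : z ≠ (starRingEnd ℂ) ζ)
    (hb : ‖ζ‖ = 1 ∨ ‖ζ‖ ^ 2 = qpar r α) :
    kernelH1 r α z ζ = ringKernel (qpar r α) z ζ - ringKernel (qpar r α) z ((starRingEnd ℂ) ζ) := by
  have h0 := qpar_pos hr0 α
  have h1 := qpar_lt_one hr0 hr1 hα
  have hz0 := ne_zero_of_mem_ann h0 hz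
  have hζ0 := ne_zero_of_mem_ann h0 hζ
  rw [kernelH1_eq hr0 hr1 hα hz0 hζ0 h h']
  set q := qpar r α
  rcases hb with hb | hb
  · have e : (starRingEnd ℂ) ζ = ζ⁻¹ := by
      rw [Complex.inv_def, Complex.normSq_eq_norm_sq, hb]
      simp
    rw [ringKernel, ringKernel, e, div_inv_eq_mul, ← div_eq_mul_inv]
    ring
  · have e : z * (starRingEnd ℂ) ζ = q * (z / ζ) := by
      rw [div_eq_mul_inv, Complex.inv_def, Complex.normSq_eq_norm_sq, hb, mul_comm _ ((q⁻¹ : ℝ) : ℂ),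
        mul_left_comm z, ← mul_assoc, ← Complex.ofReal_mul, mul_inv_cancel₀ h0.ne']
      simp
    have e' : z * ζ = q * (z / (starRingEnd ℂ) ζ) := by
      have hc0 : (starRingEnd ℂ) ζ ≠ 0 := by simpa using hζ0
      rw [eq_comm, mul_div_assoc', div_eq_iff hc0, mul_assoc, Complex.mul_conj,
        Complex.normSq_eq_norm_sq, hb, mul_comm]
    rw [ringKernel, ringKernel, e, e', villat_qpar_mul_div h0 h1 hz hζ,
      villat_qpar_mul_div h0 h1 hz (conj_mem_ann.2 hζ)]
    ring

/-- The pole of the one-variable kernel in an exponential coordinate. -/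
lemma tendsto_mul_villat_exp (h0 : 0 < q) (h1 : q < 1) {α : ℝ} (hα : 0 < α) :
    Tendsto (fun s : ℂ => s * villat q (Complex.exp (α * s))) (𝓝[≠] 0) (𝓝 (-(α : ℂ)⁻¹)) := by
  have hq : (q : ℂ) ≠ 0 := by exact_mod_cast h0.ne'
  have hαc : (α : ℂ) ≠ 0 := by exact_mod_cast hα.ne'
  have hU : IsOpen {w : ℂ | q < ‖w‖} := isOpen_lt continuous_const continuous_norm
  have hA : ∀ w : ℂ, q < ‖w‖ → ContinuousAt (geomSum q) w := fun w hw =>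
    ((differentiableOn_geomSum h0 h1).differentiableAt (hU.mem_nhds hw)).continuousAt
  have c1 : ContinuousAt (fun w : ℂ => q / (q - w) + (geomSum q (w / q) - geomSum q w⁻¹)) 1 := by
    have : (q : ℂ) - 1 ≠ 0 := sub_ne_zero.2 (by exact_mod_cast h1.ne)
    refine (continuousAt_const.div (by fun_prop) this).add (ContinuousAt.sub ?_ ?_)
    · refine ContinuousAt.comp (f := fun w : ℂ => w / q) (hA _ ?_) (by fun_prop)
      rw [norm_div, Complex.norm_real, Real.norm_of_nonneg h0.le, norm_one, lt_div_iff₀ h0]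
      nlinarith
    · refine ContinuousAt.comp (f := fun w : ℂ => w⁻¹) (hA _ ?_) (continuousAt_inv₀ one_ne_zero)
      simpa using h1
  have hexp : Tendsto (fun s : ℂ => Complex.exp (α * s)) (𝓝[≠] 0) (𝓝 1) := by
    have : Continuous fun s : ℂ => Complex.exp (α * s) := by fun_prop
    simpa using (this.tendsto 0).mono_left nhdsWithin_le_nhds
  have hid : Tendsto (fun s : ℂ => s) (𝓝[≠] 0) (𝓝 0) := nhdsWithin_le_nhds
  have t1 := hid.mul (c1.tendsto.comp hexp)
  rw [zero_mul] at t1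
  have hder : HasDerivAt (fun s : ℂ => Complex.exp (α * s)) α 0 := by
    have := ((hasDerivAt_id (0 : ℂ)).const_mul (α : ℂ)).cexp
    simpa using this
  have t2 : Tendsto (fun s : ℂ => -(s⁻¹ * (Complex.exp (α * s) - 1))⁻¹) (𝓝[≠] 0)
      (𝓝 (-(α : ℂ)⁻¹)) := by
    have := (hasDerivAt_iff_tendsto_slope.1 hder).inv₀ hαc
    refine (this.neg).congr fun s => ?_
    simp [slope_def_field, div_eq_inv_mul]
  have t3 := t2.add t1
  rw [add_zero] at t3
  refine t3.congr' ?_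
  filter_upwards [self_mem_nhdsWithin] with s hs
  rw [villat_eq h0 h1 (Complex.exp_ne_zero _)]
  simp only [Function.comp_apply, mul_inv, inv_inv]
  rw [show 1 - Complex.exp (α * s) = -(Complex.exp (α * s) - 1) by ring, div_neg]
  ring

end

section

/-! ### Logarithmic coordinates -/

/-- The branch of the logarithm with imaginary part in `(0, 2π]`. -/
def lg (z : ℂ) : ℂ := Complex.log (-z) + Real.pi * Complex.I

lemma exp_lg {z : ℂ} (hz : z ≠ 0) : Complex.exp (lg z) = z := by
  rw [lg, Complex.exp_add, Complex.exp_log (neg_ne_zero.2 hz), Complex.exp_pi_mul_I]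
  ring

lemma measurable_lg : Measurable lg := by
  unfold lg
  fun_prop

lemma lg_re (z : ℂ) : (lg z).re = Real.log ‖z‖ := by simp [lg, Complex.log_re]

lemma lg_im (z : ℂ) : (lg z).im = (-z).arg + Real.pi := by simp [lg, Complex.log_im]

lemma argPos_eq {z : ℂ} (hz : -z ∈ Complex.slitPlane) : argPos z = (-z).arg + Real.pi := by
  rw [Complex.mem_slitPlane_iff] at hz
  simp only [Complex.neg_re, Complex.neg_im, neg_ne_zero] at hz
  rcases lt_trichotomy z.im 0 with h | h | h
  · rw [Complex.arg_neg_eq_arg_add_pi_of_im_neg h, argPos, if_neg]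
    · ring
    · exact not_le.2 (Complex.arg_neg_iff.2 h)
  · have hre : z.re < 0 := by
      rcases hz with h' | h'
      · linarith
      · exact absurd h h'
    have e1 : z.arg = Real.pi := Complex.arg_eq_pi_iff.2 ⟨hre, h⟩
    have e2 : (-z).arg = 0 := by
      rw [Complex.arg_eq_zero_iff]
      simp [hre.le, h]
    rw [argPos, e1, e2, if_pos Real.pi_pos.le, zero_add]
  · rw [Complex.arg_neg_eq_arg_sub_pi_of_im_pos h, argPos, if_pos]
    · ring
    · exact Complex.arg_nonneg_iff.2 h.le

lemma neg_mem_slitPlane_of_argPos_pos {z : ℂ} (h : 0 < argPos z) : -z ∈ Complex.slitPlane := by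
  rw [Complex.mem_slitPlane_iff]
  by_contra! h'
  simp only [Complex.neg_re, Complex.neg_im, neg_eq_zero] at h'
  have : z.arg = 0 := Complex.arg_eq_zero_iff.2 ⟨by linarith [h'.1], h'.2⟩
  rw [argPos, this, if_pos le_rfl] at h
  exact lt_irrefl _ h

lemma cpowPos_eq {z : ℂ} (hz : -z ∈ Complex.slitPlane) (s : ℝ) :
    cpowPos s z = Complex.exp (s * lg z) := by
  have h0 : 0 < ‖z‖ := norm_pos_iff.2 (neg_ne_zero.1 (Complex.slitPlane_ne_zero hz))
  rw [cpowPos, polarPow, argPos_eq hz, ← lg_im, Real.rpow_def_of_pos h0, ← lg_re,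
    Complex.ofReal_exp, ← Complex.exp_add]
  congr 1
  apply Complex.ext
  · simp
    ring
  · simp

lemma polarPow_eq {s ρ φ : ℝ} (hρ : 0 < ρ) :
    polarPow s ρ φ = Complex.exp (s * (Real.log ρ + φ * Complex.I)) := by
  rw [polarPow, Real.rpow_def_of_pos hρ, Complex.ofReal_exp, ← Complex.exp_add]
  congr 1
  push_cast
  ring

lemma polarPt_eq {ρ φ : ℝ} (hρ : 0 < ρ) :
    polarPt ρ φ = Complex.exp (Real.log ρ + φ * Complex.I) := by
  rw [polarPt, Complex.exp_add, ← Complex.ofReal_exp, Real.exp_log hρ]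
  congr 2
  ring

/-- The closed rectangle of logarithmic coordinates. -/
def cRect (r α : ℝ) : Set ℂ := Icc (Real.log r) 0 ×ℂ Icc 0 (Real.pi / α)

/-- The open rectangle of logarithmic coordinates. -/
def oRect (r α : ℝ) : Set ℂ := Ioo (Real.log r) 0 ×ℂ Ioo 0 (Real.pi / α)

variable {r α : ℝ}

lemma mem_cRect {u : ℂ} : u ∈ cRect r α ↔
    (Real.log r ≤ u.re ∧ u.re ≤ 0) ∧ 0 ≤ u.im ∧ u.im ≤ Real.pi / α := Iff.rfl

lemma mem_oRect {u : ℂ} : u ∈ oRect r α ↔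
    (Real.log r < u.re ∧ u.re < 0) ∧ 0 < u.im ∧ u.im < Real.pi / α := Iff.rfl

lemma oRect_subset_cRect : oRect r α ⊆ cRect r α := fun _ hu =>
  ⟨⟨hu.1.1.le, hu.1.2.le⟩, hu.2.1.le, hu.2.2.le⟩

lemma isCompact_cRect : IsCompact (cRect r α) := isCompact_Icc.reProdIm isCompact_Icc

lemma isOpen_oRect : IsOpen (oRect r α) := isOpen_Ioo.reProdIm isOpen_Ioo

lemma convex_oRect : Convex ℝ (oRect r α) := 
  ((convex_Ioo _ _).linear_preimage Complex.reLm).inter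
    ((convex_Ioo _ _).linear_preimage Complex.imLm)

lemma closure_oRect (hr0 : 0 < r) (hr1 : r < 1) (hα : 0 < α) :
    closure (oRect r α) = cRect r α := by
  have : 0 < Real.pi / α := by positivity
  rw [oRect, Complex.closure_reProdIm, closure_Ioo (Real.log_neg hr0 hr1).ne,
    closure_Ioo this.ne, cRect]

lemma mem_sectorRing_iff (hr0 : 0 < r) {z : ℂ} :
    z ∈ sectorRing r α ↔ -z ∈ Complex.slitPlane ∧ lg z ∈ oRect r α := by
  have key : -z ∈ Complex.slitPlane → ((r < ‖z‖ ∧ ‖z‖ < 1) ∧ 0 < argPos z ∧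
      argPos z < Real.pi / α ↔ lg z ∈ oRect r α) := fun h => by
    have h0 : 0 < ‖z‖ := norm_pos_iff.2 (neg_ne_zero.1 (Complex.slitPlane_ne_zero h))
    rw [mem_oRect, lg_re, lg_im, ← argPos_eq h, Real.log_lt_log_iff hr0 h0, Real.log_neg_iff h0]
  constructor
  · rintro ⟨h1, h2, h3, h4⟩
    have hs := neg_mem_slitPlane_of_argPos_pos h3
    exact ⟨hs, (key hs).1 ⟨⟨h1, h2⟩, h3, h4⟩⟩
  · rintro ⟨hs, h⟩
    obtain ⟨⟨h1, h2⟩, h3, h4⟩ := (key hs).2 h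
    exact ⟨h1, h2, h3, h4⟩

/-- The opening of the sector is at most a full turn, so the open rectangle lies in the strip 0 < Im
u < 2π, on which `lg` inverts the exponential. -/
lemma pi_div_le_two_pi (hα : 1 / 2 ≤ α) : Real.pi / α ≤ 2 * Real.pi := by
  rw [div_le_iff₀ (by linarith)]
  nlinarith [Real.pi_pos]

lemma lg_exp {u : ℂ} (h0 : 0 < u.im) (h1 : u.im ≤ 2 * Real.pi) : lg (Complex.exp u) = u := by
  have e : -Complex.exp u = Complex.exp (u - Real.pi * Complex.I) := by
    rw [Complex.exp_sub, Complex.exp_pi_mul_I]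
    ring
  rw [lg, e, Complex.log_exp]
  · ring
  · simpa using h0
  · simp
    linarith

lemma neg_exp_mem_slitPlane {u : ℂ} (h0 : 0 < u.im) (h1 : u.im < 2 * Real.pi) :
    -Complex.exp u ∈ Complex.slitPlane := by
  have e : -Complex.exp u = Complex.exp (u - Real.pi * Complex.I) := by
    rw [Complex.exp_sub, Complex.exp_pi_mul_I]
    ring
  rw [Complex.mem_slitPlane_iff_arg, e]
  refine ⟨fun h => ?_, Complex.exp_ne_zero _⟩
  rw [← Complex.log_im, Complex.log_exp (by simpa using h0) (by simp; linarith)] at h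
  simp at h
  linarith

lemma exp_mem_sectorRing (hr0 : 0 < r) (hα : 1 / 2 ≤ α) {u : ℂ} (hu : u ∈ oRect r α) :
    Complex.exp u ∈ sectorRing r α := by
  have h := pi_div_le_two_pi hα
  obtain ⟨_, h1, h2⟩ := mem_oRect.1 hu
  rw [mem_sectorRing_iff hr0, lg_exp h1 (by linarith)]
  exact ⟨neg_exp_mem_slitPlane h1 (by linarith), hu⟩

lemma sectorRing_eq_image (hr0 : 0 < r) (hα : 1 / 2 ≤ α) :
    sectorRing r α = Complex.exp '' oRect r α := by
  ext z
  constructor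
  · intro hz
    obtain ⟨h1, h2⟩ := (mem_sectorRing_iff hr0).1 hz
    exact ⟨lg z, h2, exp_lg (neg_ne_zero.1 (Complex.slitPlane_ne_zero h1))⟩
  · rintro ⟨u, hu, rfl⟩
    exact exp_mem_sectorRing hr0 hα hu

lemma lg_mem_oRect (hr0 : 0 < r) {z : ℂ} (hz : z ∈ sectorRing r α) : lg z ∈ oRect r α :=
  ((mem_sectorRing_iff hr0).1 hz).2

lemma ne_zero_of_mem_sectorRing (hr0 : 0 < r) {z : ℂ} (hz : z ∈ sectorRing r α) : z ≠ 0 :=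
  norm_pos_iff.1 (hr0.trans hz.1)

lemma differentiableAt_lg {z : ℂ} (hz : -z ∈ Complex.slitPlane) : DifferentiableAt ℂ lg z := by
  unfold lg
  exact (differentiableAt_id.neg.clog hz).add_const _

lemma differentiableAt_lg_of_mem (hr0 : 0 < r) {z : ℂ} (hz : z ∈ sectorRing r α) :
    DifferentiableAt ℂ lg z := differentiableAt_lg ((mem_sectorRing_iff hr0).1 hz).1

lemma hasDerivAt_lg {z : ℂ} (hz : -z ∈ Complex.slitPlane) : HasDerivAt lg z⁻¹ z := by
  have h : HasDerivAt (fun w : ℂ => -w) (-1) z := (hasDerivAt_id z).neg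
  have := (h.clog hz).add_const (Real.pi * Complex.I)
  rwa [neg_div_neg_eq, one_div] at this

lemma isOpen_sectorRing (hr0 : 0 < r) : IsOpen (sectorRing r α) := by
  rw [isOpen_iff_mem_nhds]
  intro z hz
  obtain ⟨h1, h2⟩ := (mem_sectorRing_iff hr0).1 hz
  have e1 : ∀ᶠ w in 𝓝 z, -w ∈ Complex.slitPlane :=
    continuous_neg.continuousAt.eventually (Complex.isOpen_slitPlane.mem_nhds h1)
  have e2 : ∀ᶠ w in 𝓝 z, lg w ∈ oRect r α :=
    (differentiableAt_lg h1).continuousAt.eventually (isOpen_oRect.mem_nhds h2)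
  filter_upwards [e1, e2] with w hw1 hw2 using (mem_sectorRing_iff hr0).2 ⟨hw1, hw2⟩

lemma isPreconnected_sectorRing (hr0 : 0 < r) (hα : 1 / 2 ≤ α) :
    IsPreconnected (sectorRing r α) := by
  rw [sectorRing_eq_image hr0 hα]
  exact convex_oRect.isPreconnected.image _ Complex.continuous_exp.continuousOn

lemma sectorRing_subset_ball : sectorRing r α ⊆ Metric.ball 0 1 := fun z hz => by
  simpa using hz.2.1

/-- Along an ultrafilter in the sector ring that tends to a boundary point, the logarithm tends
to a boundary point of the rectangle. -/
lemma exists_tendsto_lg (hr0 : 0 < r) (hr1 : r < 1) (hα : 1 / 2 ≤ α) {t : ℂ}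
    (ht : t ∈ frontier (sectorRing r α)) {f : Ultrafilter ℂ}
    (hf : ↑f ≤ 𝓝[sectorRing r α] t) :
    ∃ u₀ ∈ cRect r α, u₀ ∉ oRect r α ∧ Complex.exp u₀ = t ∧
      Tendsto lg f (𝓝[oRect r α] u₀) := by
  have hα0 : 0 < α := by linarith
  have hmem : ∀ᶠ z in (f : Filter ℂ), z ∈ sectorRing r α := hf self_mem_nhdsWithin
  have hlg : ∀ᶠ z in (f : Filter ℂ), lg z ∈ oRect r α := hmem.mono fun z hz => lg_mem_oRect hr0 hz
  -- For α = 1/2 a point of the slit has two logarithms in the closed rectangle, so `lg` need not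
  -- converge along the whole neighbourhood filter. Along an ultrafilter compactness selects one of
  -- them.
  obtain ⟨u₀, hu₀, hle⟩ := isCompact_cRect.ultrafilter_le_nhds (f.map lg) (by
    rw [le_principal_iff]
    exact hlg.mono fun z hz => oRect_subset_cRect hz)
  have ht1 : Tendsto lg (f : Filter ℂ) (𝓝 u₀) := hle
  have hexp : Complex.exp u₀ = t := by
    have h1 : Tendsto (fun z => Complex.exp (lg z)) (f : Filter ℂ) (𝓝 (Complex.exp u₀)) :=
      (Complex.continuous_exp.tendsto u₀).comp ht1
    have h2 : Tendsto (fun z => Complex.exp (lg z)) (f : Filter ℂ) (𝓝 t) := by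
      refine Tendsto.congr' (f₁ := fun z => z) ?_ (hf.trans nhdsWithin_le_nhds)
      filter_upwards [hmem] with z hz
      rw [exp_lg (ne_zero_of_mem_sectorRing hr0 hz)]
    exact tendsto_nhds_unique h1 h2
  refine ⟨u₀, hu₀, fun h => ?_, hexp, tendsto_nhdsWithin_iff.2 ⟨ht1, hlg⟩⟩
  have := exp_mem_sectorRing hr0 hα h
  rw [hexp] at this
  rw [(isOpen_sectorRing hr0).frontier_eq] at ht
  exact ht.2 this

lemma exp_mem_frontier (hr0 : 0 < r) (hr1 : r < 1) (hα : 1 / 2 ≤ α) {u : ℂ}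
    (hu : u ∈ cRect r α) (hu' : u ∉ oRect r α) :
    Complex.exp u ∈ frontier (sectorRing r α) := by
  have hα0 : 0 < α := by linarith
  rw [(isOpen_sectorRing hr0).frontier_eq]
  refine ⟨?_, fun h => ?_⟩
  · rw [sectorRing_eq_image hr0 hα]
    rw [← closure_oRect hr0 hr1 hα0] at hu
    exact image_closure_subset_closure_image Complex.continuous_exp ⟨u, hu, rfl⟩
  · obtain ⟨h1, h2⟩ := (mem_sectorRing_iff hr0).1 h
    obtain ⟨_, hi1, hi2⟩ := mem_cRect.1 hu
    have h2pi := pi_div_le_two_pi hα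
    rcases hi1.eq_or_lt with h0 | h0
    · have e : Complex.exp u = (Real.exp u.re : ℝ) := by
        rw [Complex.ofReal_exp]
        congr 1
        apply Complex.ext <;> simp [← h0]
      rw [e, Complex.mem_slitPlane_iff] at h1
      simp only [Complex.neg_re, Complex.ofReal_re, Complex.neg_im, Complex.ofReal_im, neg_zero,
        ne_eq, not_true_eq_false, or_false] at h1
      linarith [Real.exp_pos u.re]
    · rw [lg_exp h0 (by linarith)] at h2
      exact hu' h2

end

section

/-! ### The kernel in logarithmic coordinates -/

/-- The kernel `ζ ^ α H₂(z ^ α, ζ ^ α)` for `z = exp u`, `ζ = exp v`. -/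
def logKernel (r α : ℝ) (u v : ℂ) : ℂ :=
  ringKernel (qpar r α) (Complex.exp (α * u)) (Complex.exp (α * v))

/-- The entire function (exp s - 1) / s vanishes only at the nonzero multiples of 2πi, which this
compact rectangle avoids. The constant is the minimum of its modulus. -/
lemma exists_mul_norm_le_norm_exp_sub_one (a : ℝ) (ha : 0 ≤ a) :
    ∃ c : ℝ, 0 < c ∧ ∀ s : ℂ, |s.re| ≤ a → |s.im| ≤ Real.pi →
      c * ‖s‖ ≤ ‖Complex.exp s - 1‖ := by
  have hd : Differentiable ℂ (dslope Complex.exp 0) := by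
    rw [← differentiableOn_univ, Complex.differentiableOn_dslope univ_mem, differentiableOn_univ]
    exact Complex.differentiable_exp
  have hK : IsCompact (Icc (-a) a ×ℂ Icc (-Real.pi) Real.pi) := isCompact_Icc.reProdIm isCompact_Icc
  have hpi := Real.pi_pos
  obtain ⟨s₀, hs₀, hmin⟩ := hK.exists_isMinOn
    ⟨0, by simp [Complex.mem_reProdIm, ha, hpi.le]⟩ hd.continuous.norm.continuousOn
  have hne : dslope Complex.exp 0 s₀ ≠ 0 := by
    by_cases h : s₀ = 0
    · rw [h, dslope_same, Complex.deriv_exp]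
      simp
    · rw [dslope_of_ne _ h, slope_def_field]
      refine div_ne_zero (fun h1 => ?_) (by simpa using h)
      rw [Complex.exp_zero, sub_eq_zero, Complex.exp_eq_one_iff] at h1
      obtain ⟨n, hn⟩ := h1
      have him : s₀.im = n * (2 * Real.pi) := by
        rw [hn]
        simp
      have h2 : |s₀.im| ≤ Real.pi := abs_le.2 hs₀.2
      rw [him, abs_mul, abs_of_pos (by positivity : 0 < 2 * Real.pi)] at h2
      have h3 : |(n : ℝ)| < 1 := by nlinarith
      have h4 : n = 0 := by
        rw [← Int.abs_lt_one_iff]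
        exact_mod_cast h3
      rw [h4] at hn
      exact h (by simpa using hn)
  refine ⟨‖dslope Complex.exp 0 s₀‖, norm_pos_iff.2 hne, fun s h1 h2 => ?_⟩
  have h3 := hmin (show s ∈ Icc (-a) a ×ℂ Icc (-Real.pi) Real.pi from ⟨abs_le.1 h1, abs_le.1 h2⟩)
  simp only [mem_ofPred_eq] at h3
  by_cases h : s = 0
  · simp [h]
  · have hs : 0 < ‖s‖ := norm_pos_iff.2 h
    rw [dslope_of_ne _ h, slope_def_field, Complex.exp_zero, sub_zero, norm_div,
      le_div_iff₀ hs] at h3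
    exact h3

variable {r α : ℝ}

lemma norm_exp_mul (u : ℂ) : ‖Complex.exp (α * u)‖ = Real.exp (α * u.re) := by
  rw [Complex.norm_exp]
  simp

lemma qpar_eq_exp (hr0 : 0 < r) : qpar r α = Real.exp (α * Real.log r) ^ 2 := by
  rw [qpar, Real.rpow_def_of_pos hr0, ← Real.exp_nat_mul]
  congr 1
  push_cast
  ring

lemma exp_mem_ann (hr0 : 0 < r) (hα : 0 < α) {u : ℂ} (h1 : Real.log r ≤ u.re) (h2 : u.re ≤ 0) :
    Complex.exp (α * u) ∈ ann (qpar r α) := by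
  rw [ann, mem_ofPred_eq, norm_exp_mul, qpar_eq_exp hr0]
  refine ⟨by gcongr, Real.exp_le_one_iff.2 (by nlinarith)⟩

lemma exp_mem_ann_of_mem (hr0 : 0 < r) (hα : 0 < α) {u : ℂ} (hu : u ∈ cRect r α) :
    Complex.exp (α * u) ∈ ann (qpar r α) := exp_mem_ann hr0 hα hu.1.1 hu.1.2

lemma conj_exp_mul (u : ℂ) :
    conj (Complex.exp (α * u)) = Complex.exp (α * conj u) := by
  rw [← Complex.exp_conj, map_mul, Complex.conj_ofReal]

lemma exp_im_nonneg (hα : 0 < α) {u : ℂ} (hu : u ∈ cRect r α) :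
    0 ≤ (Complex.exp (α * u)).im := by
  rw [Complex.exp_im]
  refine mul_nonneg (Real.exp_pos _).le (Real.sin_nonneg_of_nonneg_of_le_pi ?_ ?_)
  · have := hu.2.1
    simp
    positivity
  · have := hu.2.2
    rw [le_div_iff₀ hα] at this
    simp
    linarith

lemma exp_im_pos (hα : 0 < α) {u : ℂ} (h1 : 0 < u.im) (h2 : u.im < Real.pi / α) :
    0 < (Complex.exp (α * u)).im := by
  rw [Complex.exp_im]
  refine mul_pos (Real.exp_pos _) (Real.sin_pos_of_pos_of_lt_pi ?_ ?_)
  · simp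
    positivity
  · rw [lt_div_iff₀ hα] at h2
    simp
    linarith

/-- Factor out exp (α v), whose modulus is at least r ^ α. The rectangle has height π/α, so α (u -
v) has imaginary part in [-π, π], where exp s - 1 is bounded below by a multiple of |s|. -/
lemma exists_mul_norm_sub_le_norm_exp_sub (hr0 : 0 < r) (hr1 : r < 1) (hα : 0 < α) :
    ∃ c : ℝ, 0 < c ∧ ∀ u ∈ cRect r α, ∀ v ∈ cRect r α,
      c * ‖u - v‖ ≤ ‖Complex.exp (α * u) - Complex.exp (α * v)‖ := by
  have hlog := Real.log_neg hr0 hr1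
  obtain ⟨c, hc, hb⟩ := exists_mul_norm_le_norm_exp_sub_one (α * (-Real.log r))
    (by nlinarith)
  refine ⟨Real.exp (α * Real.log r) * (c * α), by positivity, fun u hu v hv => ?_⟩
  have e : Complex.exp (α * u) - Complex.exp (α * v)
      = Complex.exp (α * v) * (Complex.exp (α * (u - v)) - 1) := by
    rw [mul_sub_one, ← Complex.exp_add]
    congr 2
    ring
  have hre : |(α * (u - v) : ℂ).re| ≤ α * (-Real.log r) := by
    have h : (α * (u - v) : ℂ).re = α * (u.re - v.re) := by simp
    rw [h, abs_mul, abs_of_pos hα]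
    gcongr
    rw [abs_le]
    constructor <;> linarith [hu.1.1, hu.1.2, hv.1.1, hv.1.2]
  have him : |(α * (u - v) : ℂ).im| ≤ Real.pi := by
    have h : (α * (u - v) : ℂ).im = α * (u.im - v.im) := by simp
    rw [h, abs_mul, abs_of_pos hα, ← le_div_iff₀' hα, abs_le]
    constructor <;> linarith [hu.2.1, hu.2.2, hv.2.1, hv.2.2]
  have h1 := hb _ hre him
  rw [norm_mul, Complex.norm_real, Real.norm_of_nonneg hα.le] at h1
  rw [e, norm_mul, norm_exp_mul]
  have h2 : Real.exp (α * Real.log r) ≤ Real.exp (α * v.re) :=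
    Real.exp_le_exp.2 (mul_le_mul_of_nonneg_left hv.1.1 hα.le)
  calc _ = Real.exp (α * Real.log r) * (c * (α * ‖u - v‖)) := by ring
    _ ≤ _ := by gcongr

lemma exp_mul_ne (hr0 : 0 < r) (hr1 : r < 1) (hα : 0 < α) {u v : ℂ} (hu : u ∈ cRect r α)
    (hv : v ∈ cRect r α) (h : u ≠ v) : Complex.exp (α * u) ≠ Complex.exp (α * v) := fun h' => by
  obtain ⟨c, hc, hb⟩ := exists_mul_norm_sub_le_norm_exp_sub hr0 hr1 hα
  have := hb u hu v hv
  rw [h', sub_self, norm_zero] at this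
  have h2 : 0 < ‖u - v‖ := norm_pos_iff.2 (sub_ne_zero.2 h)
  nlinarith [mul_pos hc h2]

/-- The squares differ by 4 Im z Im ζ. -/
lemma norm_sub_le_norm_sub_conj {z ζ : ℂ} (hz : 0 ≤ z.im) (hζ : 0 ≤ ζ.im) :
    ‖z - ζ‖ ≤ ‖z - conj ζ‖ := by
  refine (abs_le_of_sq_le_sq' ?_ (norm_nonneg _)).2
  rw [Complex.sq_norm, Complex.sq_norm, Complex.normSq_apply, Complex.normSq_apply]
  simp
  nlinarith [mul_nonneg hz hζ]

lemma exp_mul_ne_conj (hr0 : 0 < r) (hr1 : r < 1) (hα : 0 < α) {u v : ℂ} (hu : u ∈ cRect r α)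
    (hv : v ∈ cRect r α) (h : u ≠ v) :
    Complex.exp (α * u) ≠ conj (Complex.exp (α * v)) := fun h' => by
  have := norm_sub_le_norm_sub_conj (exp_im_nonneg hα hu) (exp_im_nonneg hα hv)
  rw [h', sub_self, norm_zero, ← h'] at this
  exact exp_mul_ne hr0 hr1 hα hu hv h (sub_eq_zero.1 (norm_le_zero_iff.1 this))

/-- The points exp (α u) fill part of the closed upper half-plane, so the distance to a conjugate
point is at least the distance to the point itself. One quantity therefore controls all poles,
including those met at v̄. -/
lemma exists_norm_logKernel_le (hr0 : 0 < r) (hr1 : r < 1) (hα : 0 < α) :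
    ∃ C : ℝ, 0 < C ∧ ∀ u ∈ cRect r α, ∀ v ∈ cRect r α, u ≠ v →
      ‖logKernel r α u v‖ ≤ C / ‖u - v‖ ∧ ‖logKernel r α u (conj v)‖ ≤ C / ‖u - v‖ := by
  obtain ⟨c, hc, hb⟩ := exists_mul_norm_sub_le_norm_exp_sub hr0 hr1 hα
  obtain ⟨C, hC, hk⟩ := exists_norm_ringKernel_le (qpar_pos hr0 α) (qpar_lt_one hr0 hr1 hα)
  refine ⟨C / c, by positivity, fun u hu v hv h => ?_⟩
  have hpos : 0 < ‖u - v‖ := norm_pos_iff.2 (sub_ne_zero.2 h)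
  have h1 := hb u hu v hv
  have h2 := h1.trans (norm_sub_le_norm_sub_conj (exp_im_nonneg hα hu) (exp_im_nonneg hα hv))
  have hu' := exp_mem_ann_of_mem hr0 hα hu
  have hv' := exp_mem_ann_of_mem hr0 hα hv
  rw [div_div]
  refine ⟨hk _ hu' _ hv' _ (by positivity) h1 h2, ?_⟩
  rw [logKernel, ← conj_exp_mul]
  refine hk _ hu' _ (conj_mem_ann.2 hv') _ (by positivity) h2 ?_
  rwa [Complex.conj_conj]

/-! ### Holomorphy and residues of the kernel in each variable -/

section differentiability

variable {u v : ℂ}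

lemma logKernel_eq : logKernel r α u v = 1 + villat (qpar r α) (Complex.exp (α * (u - v)))
    - villat (qpar r α) (Complex.exp (α * (u + v))) := by
  rw [logKernel, ringKernel, mul_sub, mul_add, Complex.exp_sub, Complex.exp_add]

lemma differentiableAt_villat_exp_sub (hr0 : 0 < r) (hr1 : r < 1) (hα : 0 < α)
    (hu : Complex.exp (α * u) ∈ ann (qpar r α)) (hv : Complex.exp (α * v) ∈ ann (qpar r α))
    (h : Complex.exp (α * u) ≠ Complex.exp (α * v)) :
    DifferentiableAt ℂ (villat (qpar r α)) (Complex.exp (α * (u - v))) := by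
  rw [mul_sub, Complex.exp_sub]
  exact differentiableAt_villat_div (qpar_pos hr0 α) (qpar_lt_one hr0 hr1 hα) hu hv h

lemma differentiableAt_villat_exp_add (hr0 : 0 < r) (hr1 : r < 1) (hα : 0 < α)
    (hu : Complex.exp (α * u) ∈ ann (qpar r α)) (hv : Complex.exp (α * v) ∈ ann (qpar r α))
    (h : Complex.exp (α * u) ≠ conj (Complex.exp (α * v))) :
    DifferentiableAt ℂ (villat (qpar r α)) (Complex.exp (α * (u + v))) := by
  rw [mul_add, Complex.exp_add]
  exact differentiableAt_villat_mul (qpar_pos hr0 α) (qpar_lt_one hr0 hr1 hα) hu hv h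

lemma differentiableAt_logKernel_left' (hr0 : 0 < r) (hr1 : r < 1) (hα : 0 < α)
    (hu : Complex.exp (α * u) ∈ ann (qpar r α)) (hv : Complex.exp (α * v) ∈ ann (qpar r α))
    (h : Complex.exp (α * u) ≠ Complex.exp (α * v))
    (h' : Complex.exp (α * u) ≠ conj (Complex.exp (α * v))) :
    DifferentiableAt ℂ (fun u => logKernel r α u v) u := by
  simp only [logKernel_eq]
  have d1 := differentiableAt_villat_exp_sub hr0 hr1 hα hu hv h
  have d2 := differentiableAt_villat_exp_add hr0 hr1 hα hu hv h'
  have d3 : DifferentiableAt ℂ (fun u : ℂ => villat (qpar r α) (Complex.exp (α * (u - v)))) u :=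
    d1.comp (f := fun u : ℂ => Complex.exp (α * (u - v))) u (by fun_prop)
  have d4 : DifferentiableAt ℂ (fun u : ℂ => villat (qpar r α) (Complex.exp (α * (u + v)))) u :=
    d2.comp (f := fun u : ℂ => Complex.exp (α * (u + v))) u (by fun_prop)
  exact (d3.const_add 1).sub d4

lemma differentiableAt_logKernel_right' (hr0 : 0 < r) (hr1 : r < 1) (hα : 0 < α)
    (hu : Complex.exp (α * u) ∈ ann (qpar r α)) (hv : Complex.exp (α * v) ∈ ann (qpar r α))
    (h : Complex.exp (α * u) ≠ Complex.exp (α * v))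
    (h' : Complex.exp (α * u) ≠ conj (Complex.exp (α * v))) :
    DifferentiableAt ℂ (fun v => logKernel r α u v) v := by
  simp only [logKernel_eq]
  have d1 := differentiableAt_villat_exp_sub hr0 hr1 hα hu hv h
  have d2 := differentiableAt_villat_exp_add hr0 hr1 hα hu hv h'
  have d3 : DifferentiableAt ℂ (fun v : ℂ => villat (qpar r α) (Complex.exp (α * (u - v)))) v :=
    d1.comp (f := fun v : ℂ => Complex.exp (α * (u - v))) v (by fun_prop)
  have d4 : DifferentiableAt ℂ (fun v : ℂ => villat (qpar r α) (Complex.exp (α * (u + v)))) v :=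
    d2.comp (f := fun v : ℂ => Complex.exp (α * (u + v))) v (by fun_prop)
  exact (d3.const_add 1).sub d4

lemma differentiableAt_logKernel_left (hr0 : 0 < r) (hr1 : r < 1) (hα : 0 < α)
    (hu : u ∈ cRect r α) (hv : v ∈ cRect r α) (h : u ≠ v) :
    DifferentiableAt ℂ (fun u => logKernel r α u v) u ∧
      DifferentiableAt ℂ (fun u => logKernel r α u (conj v)) u := by
  have hu' := exp_mem_ann_of_mem hr0 hα hu
  have hv' := exp_mem_ann_of_mem hr0 hα hv
  have h1 := exp_mul_ne hr0 hr1 hα hu hv h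
  have h2 := exp_mul_ne_conj hr0 hr1 hα hu hv h
  refine ⟨differentiableAt_logKernel_left' hr0 hr1 hα hu' hv' h1 h2, ?_⟩
  refine differentiableAt_logKernel_left' hr0 hr1 hα hu' ?_ ?_ ?_
  · rwa [← conj_exp_mul, conj_mem_ann]
  · rwa [← conj_exp_mul]
  · rwa [← conj_exp_mul, Complex.conj_conj]

lemma differentiableAt_logKernel_right (hr0 : 0 < r) (hr1 : r < 1) (hα : 0 < α)
    (hu : u ∈ cRect r α) (hv : v ∈ cRect r α) (h : u ≠ v) :
    DifferentiableAt ℂ (fun v => logKernel r α u v) v ∧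
      DifferentiableAt ℂ (fun v => logKernel r α u v) (conj v) := by
  have hu' := exp_mem_ann_of_mem hr0 hα hu
  have hv' := exp_mem_ann_of_mem hr0 hα hv
  have h1 := exp_mul_ne hr0 hr1 hα hu hv h
  have h2 := exp_mul_ne_conj hr0 hr1 hα hu hv h
  refine ⟨differentiableAt_logKernel_right' hr0 hr1 hα hu' hv' h1 h2, ?_⟩
  refine differentiableAt_logKernel_right' hr0 hr1 hα hu' ?_ ?_ ?_
  · rwa [← conj_exp_mul, conj_mem_ann]
  · rwa [← conj_exp_mul]
  · rwa [← conj_exp_mul, Complex.conj_conj]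

lemma norm_exp_mul_bounds (hr0 : 0 < r) (hα : 0 < α) {s : ℂ} (h1 : 2 * Real.log r < s.re)
    (h2 : s.re < 0) :
    qpar r α < ‖Complex.exp (α * s)‖ ∧ ‖Complex.exp (α * s)‖ < 1 := by
  rw [norm_exp_mul]
  refine ⟨?_, Real.exp_lt_one_iff.2 (by nlinarith)⟩
  rw [qpar_eq_exp hr0, ← Real.exp_nat_mul, Real.exp_lt_exp]
  push_cast
  nlinarith

lemma differentiableAt_villat_exp_of_re (hr0 : 0 < r) (hr1 : r < 1) (hα : 0 < α) {s : ℂ}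
    (h1 : 2 * Real.log r < s.re) (h2 : s.re < 0) :
    DifferentiableAt ℂ (villat (qpar r α)) (Complex.exp (α * s)) := by
  have h0 := qpar_pos hr0 α
  have h1' := qpar_lt_one hr0 hr1 hα
  obtain ⟨n1, n2⟩ := norm_exp_mul_bounds hr0 hα h1 h2
  refine differentiableAt_villat h0 h1' (by nlinarith) (n2.trans ((one_lt_inv₀ h0).2 h1'))
    (fun h => ?_) fun h => ?_
  · rw [h, norm_one] at n2
    exact lt_irrefl _ n2
  · rw [h, Complex.norm_real, Real.norm_of_nonneg h0.le] at n1
    exact lt_irrefl _ n1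

/-- The kernel is regular at conjugate points. -/
lemma differentiableAt_logKernel_conj (hr0 : 0 < r) (hr1 : r < 1) (hα : 0 < α)
    (hu : u ∈ oRect r α) (hv : v ∈ cRect r α) :
    DifferentiableAt ℂ (fun v => logKernel r α u v) (conj v) ∧
      DifferentiableAt ℂ (fun u => logKernel r α u (conj v)) u := by
  have hu' := exp_mem_ann_of_mem hr0 hα (oRect_subset_cRect hu)
  have hv' := exp_mem_ann_of_mem hr0 hα hv
  have him := exp_im_pos hα hu.2.1 hu.2.2
  have hne : Complex.exp (α * u) ≠ conj (Complex.exp (α * v)) := fun h => by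
    have h1 := congrArg Complex.im h
    have h2 := exp_im_nonneg hα hv
    rw [Complex.conj_im] at h1
    linarith
  rw [← conj_mem_ann, conj_exp_mul] at hv'
  rw [conj_exp_mul] at hne
  have d1 := differentiableAt_villat_exp_sub hr0 hr1 hα hu' hv' hne
  have d2 : DifferentiableAt ℂ (villat (qpar r α)) (Complex.exp (α * (u + conj v))) := by
    apply differentiableAt_villat_exp_of_re hr0 hr1 hα
    · simp
      linarith [hu.1.1, hv.1.1]
    · simp
      linarith [hu.1.2, hv.1.2]
  simp only [logKernel_eq]
  constructor
  · exact ((d1.comp (f := fun v : ℂ => Complex.exp (α * (u - v))) _ (by fun_prop)).const_add 1).sub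
      (d2.comp (f := fun v : ℂ => Complex.exp (α * (u + v))) _ (by fun_prop))
  · exact ((d1.comp (f := fun u : ℂ => Complex.exp (α * (u - conj v))) _
      (by fun_prop)).const_add 1).sub
      (d2.comp (f := fun u : ℂ => Complex.exp (α * (u + conj v))) _ (by fun_prop))

/-- Only the term in u - v is singular at u = v; the hypothesis says that the term in u + v causes
no trouble. -/
lemma tendsto_sub_mul_logKernel_left (hr0 : 0 < r) (hr1 : r < 1) (hα : 0 < α)
    (h : ContinuousAt (villat (qpar r α)) (Complex.exp (α * (v + v)))) :
    Tendsto (fun u => (u - v) * logKernel r α u v) (𝓝[≠] v) (𝓝 (-(α : ℂ)⁻¹)) := by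
  have hs : Tendsto (fun u : ℂ => u - v) (𝓝[≠] v) (𝓝[≠] 0) := by
    refine tendsto_nhdsWithin_iff.2 ⟨?_, ?_⟩
    · refine Tendsto.mono_left ?_ nhdsWithin_le_nhds
      simpa using (continuous_id.sub continuous_const).tendsto (f := fun u => u - v) v
    · filter_upwards [self_mem_nhdsWithin] with u hu
      simpa [sub_eq_zero] using hu
  have t1 := (tendsto_mul_villat_exp (qpar_pos hr0 α) (qpar_lt_one hr0 hr1 hα) hα).comp hs
  have c : ContinuousAt (fun u => 1 - villat (qpar r α) (Complex.exp (α * (u + v)))) v :=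
    continuousAt_const.sub
      (ContinuousAt.comp (f := fun u : ℂ => Complex.exp (α * (u + v))) h (by fun_prop))
  have t2 : Tendsto (fun u => (u - v) * (1 - villat (qpar r α) (Complex.exp (α * (u + v)))))
      (𝓝[≠] v) (𝓝 0) := by
    have := (hs.mono_right nhdsWithin_le_nhds).mul (c.tendsto.mono_left nhdsWithin_le_nhds)
    rwa [zero_mul] at this
  have t3 := t1.add t2
  rw [add_zero] at t3
  refine t3.congr fun u => ?_
  rw [logKernel_eq, Function.comp_apply]
  ring

lemma tendsto_sub_mul_logKernel_right (hr0 : 0 < r) (hr1 : r < 1) (hα : 0 < α)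
    (hu : u ∈ oRect r α) :
    Tendsto (fun v => (v - u) * logKernel r α u v) (𝓝[≠] u) (𝓝 ((α : ℂ)⁻¹)) := by
  have hs : Tendsto (fun v : ℂ => u - v) (𝓝[≠] u) (𝓝[≠] 0) := by
    refine tendsto_nhdsWithin_iff.2 ⟨?_, ?_⟩
    · refine Tendsto.mono_left ?_ nhdsWithin_le_nhds
      simpa using (continuous_const.sub continuous_id).tendsto (f := fun v => u - v) u
    · filter_upwards [self_mem_nhdsWithin] with v hv
      simpa [sub_eq_zero, eq_comm] using hv
  have t1 := (tendsto_mul_villat_exp (qpar_pos hr0 α) (qpar_lt_one hr0 hr1 hα) hα).comp hs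
  have h : ContinuousAt (villat (qpar r α)) (Complex.exp (α * (u + u))) :=
    (differentiableAt_villat_exp_of_re hr0 hr1 hα (by simp; linarith [hu.1.1])
      (by simp; linarith [hu.1.2])).continuousAt
  have c : ContinuousAt (fun v => 1 - villat (qpar r α) (Complex.exp (α * (u + v)))) u :=
    continuousAt_const.sub
      (ContinuousAt.comp (f := fun v : ℂ => Complex.exp (α * (u + v))) h (by fun_prop))
  have t2 : Tendsto (fun v => (u - v) * (1 - villat (qpar r α) (Complex.exp (α * (u + v)))))
      (𝓝[≠] u) (𝓝 0) := by
    have := (hs.mono_right nhdsWithin_le_nhds).mul (c.tendsto.mono_left nhdsWithin_le_nhds)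
    rwa [zero_mul] at this
  have t3 := (t1.add t2).neg
  rw [add_zero, neg_neg] at t3
  refine t3.congr fun v => ?_
  rw [logKernel_eq, Function.comp_apply]
  ring

end differentiability

lemma measurable_logKernel (hr0 : 0 < r) (hr1 : r < 1) (hα : 0 < α) :
    Measurable fun p : ℂ × ℂ => logKernel r α p.1 p.2 := by
  have h := measurable_villat (qpar_pos hr0 α) (qpar_lt_one hr0 hr1 hα)
  unfold logKernel ringKernel
  fun_prop

/-- Under u ↦ exp (α u) the horizontal sides go to the real axis and the vertical sides to the two
circles, exactly the sets in which the kernel can be reflected. -/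
lemma boundary_exp (hr0 : 0 < r) (hα : 0 < α) {u : ℂ} (hu : u ∈ cRect r α) (hu' : u ∉ oRect r α) :
    (Complex.exp (α * u)).im = 0 ∨ ‖Complex.exp (α * u)‖ = 1 ∨
      ‖Complex.exp (α * u)‖ ^ 2 = qpar r α := by
  obtain ⟨⟨h1, h2⟩, h3, h4⟩ := mem_cRect.1 hu
  rw [norm_exp_mul, qpar_eq_exp hr0, Complex.exp_im]
  rcases h1.eq_or_lt with e | h1
  · right; right; rw [e]
  rcases h2.eq_or_lt with e | h2
  · right; left; simp [e]
  rcases h3.eq_or_lt with e | h3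
  · left; simp [← e]
  rcases h4.eq_or_lt with e | h4
  · left
    have : (α * u : ℂ).im = Real.pi := by
      simp [e]
      field_simp
    rw [this, Real.sin_pi, mul_zero]
  · exact absurd ⟨⟨h1, h2⟩, h3, h4⟩ hu'

/-- The real part of the kernel pair vanishes when the first variable is on the boundary. -/
lemma re_logKernel_pair (hr0 : 0 < r) (hr1 : r < 1) (hα : 0 < α) {u v : ℂ} (hu : u ∈ cRect r α)
    (hu' : u ∉ oRect r α) (hv : v ∈ cRect r α) (h : u ≠ v) (a : ℂ) :
    (logKernel r α u v * a - logKernel r α u (conj v) * conj a).re = 0 := by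
  have := re_ringKernel_pair (qpar_pos hr0 α) (qpar_lt_one hr0 hr1 hα)
    (exp_mem_ann_of_mem hr0 hα hu) (exp_mem_ann_of_mem hr0 hα hv) (exp_mul_ne hr0 hr1 hα hu hv h)
    (exp_mul_ne_conj hr0 hr1 hα hu hv h) (boundary_exp hr0 hα hu hu') a
  rwa [conj_exp_mul] at this

end

section

/-! ### The minimum principle and parametric integrals -/

/-- Minimum principle for the real part of a holomorphic function, with lower limits at the
boundary. -/
lemma re_nonneg_of_frontier {U : Set ℂ} (hU : IsOpen U) (hb : Bornology.IsBounded U) {F : ℂ → ℂ}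
    (hF : DifferentiableOn ℂ F U)
    (h : ∀ t ∈ frontier U, ∀ ε : ℝ, 0 < ε → ∀ᶠ z in 𝓝[U] t, -ε ≤ (F z).re) :
    ∀ z ∈ U, 0 ≤ (F z).re := by
  intro z₀ hz₀
  by_contra! hneg
  set ε := -(F z₀).re / 2 with hε
  have hε0 : 0 < ε := by linarith
  -- V is the set where the claim fails by more than ε, and Re F(z₀) = -2ε places z₀ in it. The
  -- boundary hypothesis keeps the closure of V inside U, so |exp (-F)| ≤ exp ε on its frontier,
  -- against the maximum principle at z₀.
  set V := {z | z ∈ U ∧ (F z).re < -ε} with hV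
  have hVU : V ⊆ U := fun z hz => hz.1
  have hVo : IsOpen V := by
    have : V = U ∩ (fun z => (F z).re) ⁻¹' Iio (-ε) := rfl
    rw [this]
    exact (Complex.continuous_re.comp_continuousOn hF.continuousOn).isOpen_inter_preimage hU
      isOpen_Iio
  have hcl : closure V ⊆ U := fun t ht => by
    by_contra htU
    have hfr : t ∈ frontier U := by
      rw [hU.frontier_eq]
      exact ⟨closure_mono hVU ht, htU⟩
    have h1 := h t hfr ε hε0
    rw [mem_closure_iff_frequently] at ht
    rw [eventually_nhdsWithin_iff] at h1
    obtain ⟨z, hz, hz'⟩ := (ht.and_eventually h1).exists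
    have := hz' hz.1
    linarith [hz.2]
  have hd : DiffContOnCl ℂ (fun z => Complex.exp (-F z)) V :=
    ⟨(hF.mono hVU).neg.cexp,
      Complex.continuous_exp.comp_continuousOn (hF.continuousOn.mono hcl).neg⟩
  have hfr : ∀ z ∈ frontier V, ‖Complex.exp (-F z)‖ ≤ Real.exp ε := fun z hz => by
    rw [hVo.frontier_eq] at hz
    have hzU := hcl hz.1
    have : -ε ≤ (F z).re := by
      by_contra! hlt
      exact hz.2 ⟨hzU, hlt⟩
    rw [Complex.norm_exp, Complex.neg_re, Real.exp_le_exp]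
    linarith
  have := Complex.norm_le_of_forall_mem_frontier_norm_le (hb.subset hVU) hd hfr
    (subset_closure (show z₀ ∈ V from ⟨hz₀, by linarith⟩))
  rw [Complex.norm_exp, Complex.neg_re, Real.exp_le_exp] at this
  linarith

/-- A holomorphic function whose real part tends to zero at the boundary of a bounded domain is an
imaginary constant. -/
lemma eq_imaginary_const_of_tendsto_re {U : Set ℂ} (hU : IsOpen U) (hb : Bornology.IsBounded U)
    (hc : IsPreconnected U) {F : ℂ → ℂ} (hF : DifferentiableOn ℂ F U)
    (h : ∀ t ∈ frontier U, Tendsto (fun z => (F z).re) (𝓝[U] t) (𝓝 0)) :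
    ∃ c : ℝ, ∀ z ∈ U, F z = Complex.I * c := by
  have h1 := re_nonneg_of_frontier hU hb hF fun t ht ε hε =>
    ((h t ht).eventually (lt_mem_nhds (neg_lt_zero.2 hε))).mono fun _ hz => hz.le
  have h2 := re_nonneg_of_frontier hU hb hF.neg fun t ht ε hε =>
    ((h t ht).eventually (gt_mem_nhds hε)).mono fun z hz => by
      simp only [Pi.neg_apply, Complex.neg_re]
      linarith
  have h0 : ∀ z ∈ U, (F z).re = 0 := fun z hz => by
    have a := h1 z hz
    have b := h2 z hz
    simp only [Pi.neg_apply, Complex.neg_re] at b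
    linarith
  have hder : U.EqOn (deriv F) 0 := fun z hz => by
    have hd := ((hF.differentiableAt (hU.mem_nhds hz)).hasDerivAt.hasFDerivAt).restrictScalars ℝ
    have hre := Complex.reCLM.hasFDerivAt.comp z hd
    have hzero : HasFDerivAt (Complex.reCLM ∘ F) (0 : ℂ →L[ℝ] ℝ) z := by
      refine (hasFDerivAt_const (0 : ℝ) z).congr_of_eventuallyEq ?_
      filter_upwards [hU.mem_nhds hz] with w hw using h0 w hw
    -- In the direction of the conjugate of F' the derivative of Re F is |F'|².
    have := congrArg (fun L : ℂ →L[ℝ] ℝ => L (conj (deriv F z))) (hre.unique hzero)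
    simp only [ContinuousLinearMap.comp_apply, ContinuousLinearMap.coe_restrictScalars',
      Complex.reCLM_apply, zero_apply,
      ContinuousLinearMap.toSpanSingleton_apply, smul_eq_mul] at this
    rw [mul_comm, Complex.mul_conj, Complex.ofReal_re] at this
    exact Complex.normSq_eq_zero.1 this
  obtain ⟨a, ha⟩ := hU.exists_is_const_of_deriv_eq_zero hc hF hder
  refine ⟨a.im, fun z hz => ?_⟩
  have := h0 z hz
  rw [ha z hz] at this ⊢
  apply Complex.ext <;> simp [this]

/-! ### Differentiation of integrals depending holomorphically on a parameter -/

section parametric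

variable {S : Type*} [MeasurableSpace S] {μ : Measure S} {k : ℂ → S → ℂ} {z₀ : ℂ} {ε : ℝ}

lemma aestronglyMeasurable_deriv_param (hε : 0 < ε)
    (hm : ∀ z ∈ Metric.ball z₀ ε, AEStronglyMeasurable (k z) μ)
    (hd : ∀ᵐ s ∂μ, DifferentiableAt ℂ (fun z => k z s) z₀) :
    AEStronglyMeasurable (fun s => deriv (fun z => k z s) z₀) μ := by
  classical
  -- The derivative is a limit of difference quotients, replaced by 0 outside the ball, where
  -- measurability of `k z` is not assumed.
  refine aestronglyMeasurable_of_tendsto_ae (𝓝[≠] z₀)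
    (f := fun z s => if z ∈ Metric.ball z₀ ε then (z - z₀)⁻¹ * (k z s - k z₀ s) else 0)
    (fun z => ?_) ?_
  · split_ifs with hz
    · exact ((hm z hz).sub (hm z₀ (Metric.mem_ball_self hε))).const_mul _
    · exact aestronglyMeasurable_const
  · filter_upwards [hd] with s hs
    refine (hasDerivAt_iff_tendsto_slope.1 hs.hasDerivAt).congr' ?_
    filter_upwards [nhdsWithin_le_nhds (Metric.ball_mem_nhds z₀ hε)] with z hz
    rw [if_pos hz, slope_def_field, div_eq_inv_mul]

/-- The increment of a bounded holomorphic function on a ball. -/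
lemma norm_sub_le_of_bounded_holomorphic {g : ℂ → ℂ} {B : ℝ} {z : ℂ}
    (hg : DifferentiableOn ℂ g (Metric.ball z₀ ε)) (hB : ∀ w ∈ Metric.ball z₀ ε, ‖g w‖ ≤ B)
    (hz : z ∈ Metric.ball z₀ ε) : ‖g z - g z₀‖ ≤ 2 * B / ε * ‖z - z₀‖ := by
  have h0 : z₀ ∈ Metric.ball z₀ ε :=
    Metric.mem_ball_self (dist_nonneg.trans_lt (Metric.mem_ball.1 hz))
  rw [← dist_eq_norm, ← dist_eq_norm]
  refine Complex.dist_le_div_mul_dist_of_mapsTo_ball hg (fun w hw => ?_) hz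
  rw [Metric.mem_closedBall, dist_eq_norm]
  refine (norm_sub_le _ _).trans ?_
  linarith [hB w hw, hB z₀ h0]

/-- For holomorphic integrands a dominating function b for the values suffices: the Schwarz lemma
turns it into the Lipschitz bound 2b/ε that differentiation under the integral requires. -/
lemma differentiableAt_integral_of_bounded_holomorphic (hε : 0 < ε) {b : S → ℝ}
    (hb : Integrable b μ) (hm : ∀ z ∈ Metric.ball z₀ ε, AEStronglyMeasurable (k z) μ)
    (hd : ∀ᵐ s ∂μ, DifferentiableOn ℂ (fun z => k z s) (Metric.ball z₀ ε))
    (hB : ∀ᵐ s ∂μ, ∀ z ∈ Metric.ball z₀ ε, ‖k z s‖ ≤ b s) :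
    DifferentiableAt ℂ (fun z => ∫ s, k z s ∂μ) z₀ := by
  have h0 : z₀ ∈ Metric.ball z₀ ε := Metric.mem_ball_self hε
  have hd' : ∀ᵐ s ∂μ, DifferentiableAt ℂ (fun z => k z s) z₀ := hd.mono fun s hs =>
    hs.differentiableAt (Metric.ball_mem_nhds z₀ hε)
  refine (hasFDerivAt_integral_of_dominated_loc_of_lip' (bound := fun s => 2 * b s / ε)
    (F' := fun s => (deriv (fun z => k z s) z₀) • ContinuousLinearMap.id ℂ ℂ)
    (Metric.ball_mem_nhds z₀ hε) hm ?_ ?_ ?_ ?_ ?_).2.differentiableAt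
  · exact hb.mono' (hm z₀ h0) (hB.mono fun s hs => hs z₀ h0)
  · exact (aestronglyMeasurable_deriv_param hε hm hd').smul_const _
  · filter_upwards [hd, hB] with s hs1 hs2 z hz
    exact norm_sub_le_of_bounded_holomorphic hs1 hs2 hz
  · exact (hb.const_mul 2).div_const ε
  · filter_upwards [hd'] with s hs
    have e : (deriv (fun z => k z s) z₀) • ContinuousLinearMap.id ℂ ℂ
        = ContinuousLinearMap.toSpanSingleton ℂ (deriv (fun z => k z s) z₀) := by
      ext
      simp
    rw [e]
    exact hs.hasDerivAt.hasFDerivAt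

end parametric

end

section

/-! ### The boundary of the rectangle -/

/-- The corner of the rectangle at which the `i`-th side starts. -/
def sideStart (r α : ℝ) : Fin 4 → ℂ :=
  ![Real.log r, 0, (Real.pi / α : ℝ) * Complex.I, Real.log r + (Real.pi / α : ℝ) * Complex.I]

/-- The direction of the `i`-th side. -/
def sideDir : Fin 4 → ℂ := ![1, Complex.I, -1, -Complex.I]

/-- The length of the `i`-th side. -/
def sideLen (r α : ℝ) : Fin 4 → ℝ := ![-Real.log r, Real.pi / α, -Real.log r, Real.pi / α]

/-- The point of the `i`-th side at distance `τ` from its start. -/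
def sidePt (r α : ℝ) (i : Fin 4) (τ : ℝ) : ℂ := sideStart r α i + τ * sideDir i

variable {r α : ℝ}

lemma sideLen_pos (hr0 : 0 < r) (hr1 : r < 1) (hα : 0 < α) (i : Fin 4) : 0 < sideLen r α i := by
  have h1 := Real.log_neg hr0 hr1
  have h2 : 0 < Real.pi / α := by positivity
  fin_cases i <;> simpa [sideLen]

lemma sideDir_mul_conj (i : Fin 4) : sideDir i * conj (sideDir i) = 1 := by
  fin_cases i <;> simp [sideDir]

lemma sideDir_succ (i : Fin 4) : sideDir (i + 1) = Complex.I * sideDir i := by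
  fin_cases i <;> simp [sideDir]

lemma sidePt_zero (i : Fin 4) : sidePt r α i 0 = sideStart r α i := by simp [sidePt]

lemma sidePt_sideLen (i : Fin 4) : sidePt r α i (sideLen r α i) = sideStart r α (i + 1) := by
  fin_cases i <;> (simp [sidePt, sideStart, sideLen, sideDir]; try ring)

lemma continuous_sidePt (i : Fin 4) : Continuous (sidePt r α i) := by
  unfold sidePt
  fun_prop

lemma sidePt_mem (hr0 : 0 < r) (hr1 : r < 1) (hα : 0 < α) (i : Fin 4) {τ : ℝ}
    (hτ : τ ∈ Icc 0 (sideLen r α i)) : sidePt r α i τ ∈ cRect r α ∧ sidePt r α i τ ∉ oRect r α := by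
  have h1 := Real.log_neg hr0 hr1
  have h2 : 0 < Real.pi / α := by positivity
  obtain ⟨a, b⟩ := hτ
  have hre : (sidePt r α i τ).re = ![Real.log r + τ, 0, -τ, Real.log r] i := by
    fin_cases i <;> simp [sidePt, sideStart, sideDir]
  have him : (sidePt r α i τ).im = ![0, τ, Real.pi / α, Real.pi / α - τ] i := by
    fin_cases i <;> simp [sidePt, sideStart, sideDir, sub_eq_add_neg]
  rw [mem_cRect, mem_oRect, hre, him]
  fin_cases i <;> simp [sideLen] at b <;> simp only [Fin.zero_eta, Fin.mk_one, Fin.reduceFinMk,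
    Matrix.cons_val] <;>
    exact ⟨⟨⟨by linarith, by linarith⟩, by linarith, by linarith⟩, fun h => by
      linarith [h.1.1, h.1.2, h.2.1, h.2.2]⟩

/-- The rectangle lies to the left of its sides. -/
lemma im_side_nonneg {u : ℂ} (hu : u ∈ cRect r α) (i : Fin 4) :
    0 ≤ ((u - sideStart r α i) * conj (sideDir i)).im := by
  obtain ⟨⟨h1, h2⟩, h3, h4⟩ := mem_cRect.1 hu
  fin_cases i <;> simp [sideStart, sideDir] <;> linarith

lemma im_side_pos {u : ℂ} (hu : u ∈ oRect r α) (i : Fin 4) :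
    0 < ((u - sideStart r α i) * conj (sideDir i)).im := by
  obtain ⟨⟨h1, h2⟩, h3, h4⟩ := mem_oRect.1 hu
  fin_cases i <;> simp [sideStart, sideDir] <;> linarith

/-- The Cauchy theorem for the boundary of the rectangle. -/
lemma sum_integral_side_eq_zero (hr0 : 0 < r) (hr1 : r < 1) (hα : 0 < α) {φ : ℂ → ℂ}
    (hc : ContinuousOn φ (cRect r α)) (hd : DifferentiableOn ℂ φ (oRect r α)) :
    ∑ i, ∫ τ in (0 : ℝ)..sideLen r α i, φ (sidePt r α i τ) * sideDir i = 0 := by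
  have h1 := Real.log_neg hr0 hr1
  have h2 : 0 < Real.pi / α := by positivity
  have key := Complex.integral_boundary_rect_eq_zero_of_continuousOn_of_differentiableOn φ
    (Real.log r : ℂ) ((Real.pi / α : ℝ) * Complex.I) (by
      simpa [uIcc_of_le h1.le, uIcc_of_le h2.le, cRect] using hc) (by
      simpa [h1.le, h2.le, oRect] using hd)
  simp only [Complex.ofReal_re, Complex.ofReal_im, Complex.re_ofReal_mul, Complex.I_re, mul_zero,
    Complex.im_ofReal_mul, Complex.I_im, mul_one, Complex.ofReal_zero, zero_mul, add_zero,
    zero_add, smul_eq_mul] at key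
  rw [Fin.sum_univ_four]
  have e0 : ∫ τ in (0 : ℝ)..sideLen r α 0, φ (sidePt r α 0 τ) * sideDir 0
      = ∫ x in Real.log r..0, φ x := by
    have := intervalIntegral.integral_comp_add_right (a := 0) (b := -Real.log r)
      (fun x : ℝ => φ x) (Real.log r)
    rw [zero_add, neg_add_cancel] at this
    rw [← this]
    simp [sideLen, sidePt, sideStart, sideDir, add_comm]
  have e1 : ∫ τ in (0 : ℝ)..sideLen r α 1, φ (sidePt r α 1 τ) * sideDir 1
      = Complex.I * ∫ y in (0 : ℝ)..Real.pi / α, φ (y * Complex.I) := by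
    rw [← intervalIntegral.integral_const_mul]
    simp [sideLen, sidePt, sideStart, sideDir, mul_comm]
  have e2 : ∫ τ in (0 : ℝ)..sideLen r α 2, φ (sidePt r α 2 τ) * sideDir 2
      = -∫ x in Real.log r..0, φ (x + (Real.pi / α : ℝ) * Complex.I) := by
    have := intervalIntegral.integral_comp_sub_left (a := 0) (b := -Real.log r)
      (fun x : ℝ => φ (x + (Real.pi / α : ℝ) * Complex.I)) 0
    rw [zero_sub, neg_neg, sub_zero] at this
    rw [← this, ← intervalIntegral.integral_neg]
    simp [sideLen, sidePt, sideStart, sideDir, add_comm]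
  have e3 : ∫ τ in (0 : ℝ)..sideLen r α 3, φ (sidePt r α 3 τ) * sideDir 3
      = -(Complex.I * ∫ y in (0 : ℝ)..Real.pi / α, φ (Real.log r + y * Complex.I)) := by
    have := intervalIntegral.integral_comp_sub_left (a := 0) (b := Real.pi / α)
      (fun y : ℝ => φ (Real.log r + y * Complex.I)) (Real.pi / α)
    rw [sub_self, sub_zero] at this
    rw [← this, ← intervalIntegral.integral_const_mul, ← intervalIntegral.integral_neg]
    refine intervalIntegral.integral_congr fun τ _ => ?_
    simp only [sidePt, sideStart, sideDir, Matrix.cons_val]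
    push_cast
    rw [show (Real.log r : ℂ) + Real.pi / α * Complex.I + τ * -Complex.I
      = Real.log r + (Real.pi / α - τ) * Complex.I by ring]
    ring
  rw [e0, e1, e2, e3]
  linear_combination key

lemma log_I_mul {x : ℂ} (hx : 0 < x.re) :
    Complex.log (Complex.I * x) = Complex.log x + Real.pi / 2 * Complex.I := by
  have hx0 : x ≠ 0 := fun h => by simp [h] at hx
  have h := abs_lt.1 (Complex.abs_arg_lt_pi_div_two_iff.2 (Or.inl hx))
  rw [(Complex.log_mul_eq_add_log_iff Complex.I_ne_zero hx0).2, Complex.log_I, add_comm]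
  rw [Complex.arg_I, mem_Ioc]
  constructor <;> linarith [Real.pi_pos, h.1, h.2]

/-- The winding number of the boundary of the rectangle about an interior point. -/
lemma sum_integral_side_inv {u : ℂ} (hu : u ∈ oRect r α) :
    ∑ i, ∫ τ in (0 : ℝ)..sideLen r α i, (sidePt r α i τ - u)⁻¹ * sideDir i
      = 2 * Real.pi * Complex.I := by
  -- Multiplication by i and by the conjugate direction rotates each side, seen from u, into the
  -- right half-plane, where the principal logarithm is a primitive of the integrand. Passing from
  -- one side to the next rotates by a quarter turn, so each corner contributes πi/2 while the
  -- logarithms themselves telescope around the boundary.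
  have hre : ∀ i (τ : ℝ), 0 < (Complex.I * (sidePt r α i τ - u) * conj (sideDir i)).re :=
    fun i τ => by
      have h := im_side_pos hu i
      have e : Complex.I * (sidePt r α i τ - u) * conj (sideDir i)
          = Complex.I * (τ - (u - sideStart r α i) * conj (sideDir i)) := by
        rw [sidePt]
        linear_combination (Complex.I * τ) * sideDir_mul_conj i
      rw [e, Complex.I_mul_re, Complex.sub_im, Complex.ofReal_im]
      linarith
  set L : Fin 4 → ℂ := fun i => Complex.log (Complex.I * (sideStart r α i - u) * conj (sideDir i))
  have hint : ∀ i, ∫ τ in (0 : ℝ)..sideLen r α i, (sidePt r α i τ - u)⁻¹ * sideDir i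
      = L (i + 1) + Real.pi / 2 * Complex.I - L i := fun i => by
    have hne : ∀ τ : ℝ, sidePt r α i τ - u ≠ 0 := fun τ h => by
      have := hre i τ
      rw [h] at this
      simp at this
    have hd0 : conj (sideDir i) ≠ 0 := fun h => by
      have := sideDir_mul_conj i
      rw [h, mul_zero] at this
      exact zero_ne_one this
    have hder : ∀ τ : ℝ, HasDerivAt
        (fun τ : ℝ => Complex.log (Complex.I * (sidePt r α i τ - u) * conj (sideDir i)))
        ((sidePt r α i τ - u)⁻¹ * sideDir i) τ := fun τ => by
      have h1 : HasDerivAt (fun τ : ℝ => Complex.I * (sidePt r α i τ - u) * conj (sideDir i))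
          (Complex.I * sideDir i * conj (sideDir i)) τ := by
        have h2 : HasDerivAt (fun τ : ℝ => (τ : ℂ)) 1 τ := Complex.ofRealCLM.hasDerivAt
        have h3 := ((((h2.mul_const (sideDir i)).const_add (sideStart r α i)).sub_const
          u).const_mul Complex.I).mul_const (conj (sideDir i))
        simpa [sidePt, mul_assoc] using h3
      have h4 := h1.clog_real (Or.inl (hre i τ))
      convert h4 using 1
      rw [mul_assoc Complex.I (sideDir i), sideDir_mul_conj, mul_one, eq_div_iff]
      · have h5 := inv_mul_cancel₀ (hne τ)
        linear_combination (Complex.I * sideDir i * conj (sideDir i)) * h5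
          + Complex.I * sideDir_mul_conj i
      · exact mul_ne_zero (mul_ne_zero Complex.I_ne_zero (hne τ)) hd0
    have hcont : Continuous fun τ : ℝ => (sidePt r α i τ - u)⁻¹ * sideDir i :=
      (((continuous_sidePt i).sub continuous_const).inv₀ hne).mul continuous_const
    rw [intervalIntegral.integral_eq_sub_of_hasDerivAt (fun τ _ => hder τ)
      (hcont.intervalIntegrable _ _), sidePt_zero, sidePt_sideLen]
    have e : Complex.I * (sideStart r α (i + 1) - u) * conj (sideDir i)
        = Complex.I * (Complex.I * (sideStart r α (i + 1) - u) * conj (sideDir (i + 1))) := by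
      rw [sideDir_succ, map_mul, Complex.conj_I]
      linear_combination (Complex.I * (sideStart r α (i + 1) - u) * conj (sideDir i))
        * Complex.I_mul_I
    have h5 := hre (i + 1) 0
    rw [sidePt_zero] at h5
    rw [e, log_I_mul h5]
  simp only [hint, Finset.sum_sub_distrib, Finset.sum_add_distrib]
  rw [show ∑ i, L (i + 1) = ∑ i, L i from Equiv.sum_comp (Equiv.addRight (1 : Fin 4)) L]
  simp
  ring

end

section

/-! ### The Poisson kernel of the rectangle -/

/-- The combination of the kernel at `v` and at its conjugate whose real part vanishes when `u`
is on the boundary. -/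
def pairKernel (r α : ℝ) (u v a : ℂ) : ℂ :=
  logKernel r α u v * a - logKernel r α u (conj v) * conj a

/-- The coefficient of the kernel pair on the `i`-th side. -/
def sideCoef (α : ℝ) (i : Fin 4) : ℂ := α * sideDir i / (2 * Real.pi * Complex.I)

variable {r α : ℝ}

lemma conj_sideCoef (i : Fin 4) :
    conj (sideCoef α i) = -(α * conj (sideDir i) / (2 * Real.pi * Complex.I)) := by
  simp [sideCoef, div_neg, map_ofNat]

lemma integral_side_pairKernel {u : ℂ} (i : Fin 4) (τ : ℝ) :
    pairKernel r α u (sidePt r α i τ) (sideCoef α i) = α / (2 * Real.pi * Complex.I) *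
      (logKernel r α u (sidePt r α i τ) * sideDir i
        + logKernel r α u (conj (sidePt r α i τ)) * conj (sideDir i)) := by
  rw [pairKernel, conj_sideCoef, sideCoef]
  ring

lemma continuousOn_logKernel_side (hr0 : 0 < r) (hr1 : r < 1) (hα : 0 < α) {u : ℂ}
    (hu : u ∈ oRect r α) (i : Fin 4) :
    ContinuousOn (fun τ => logKernel r α u (sidePt r α i τ)) (Icc 0 (sideLen r α i)) ∧
    ContinuousOn (fun τ => logKernel r α u (conj (sidePt r α i τ))) (Icc 0 (sideLen r α i)) := by
  have key : ∀ τ ∈ Icc 0 (sideLen r α i), DifferentiableAt ℂ (fun v => logKernel r α u v)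
      (sidePt r α i τ) ∧ DifferentiableAt ℂ (fun v => logKernel r α u v)
      (conj (sidePt r α i τ)) := fun τ hτ => by
    obtain ⟨h1, h2⟩ := sidePt_mem hr0 hr1 hα i hτ
    exact differentiableAt_logKernel_right hr0 hr1 hα (oRect_subset_cRect hu) h1
      fun h => h2 (h ▸ hu)
  have hs := continuous_sidePt (r := r) (α := α) i
  refine ⟨fun τ hτ => ?_, fun τ hτ => ?_⟩
  · exact (ContinuousAt.comp (f := fun τ => sidePt r α i τ) (key τ hτ).1.continuousAt
      hs.continuousAt).continuousWithinAt
  · exact (ContinuousAt.comp (f := fun τ => conj (sidePt r α i τ)) (key τ hτ).2.continuousAt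
      (Complex.continuous_conj.comp hs).continuousAt).continuousWithinAt

lemma continuousOn_pairKernel_side (hr0 : 0 < r) (hr1 : r < 1) (hα : 0 < α) {u : ℂ}
    (hu : u ∈ oRect r α) (i : Fin 4) (a : ℂ) :
    ContinuousOn (fun τ => pairKernel r α u (sidePt r α i τ) a) (Icc 0 (sideLen r α i)) := by
  obtain ⟨h1, h2⟩ := continuousOn_logKernel_side hr0 hr1 hα hu i
  exact (h1.mul continuousOn_const).sub (h2.mul continuousOn_const)

/-- The residue theorem by hand: after subtracting the pole α⁻¹ / (v - u) the kernel is holomorphic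
inside and continuous up to the boundary, so Cauchy's theorem removes it and the winding number
remains. -/
lemma sum_integral_logKernel (hr0 : 0 < r) (hr1 : r < 1) (hα : 0 < α) {u : ℂ}
    (hu : u ∈ oRect r α) :
    ∑ i, ∫ τ in (0 : ℝ)..sideLen r α i, logKernel r α u (sidePt r α i τ) * sideDir i
      = (α : ℂ)⁻¹ * (2 * Real.pi * Complex.I) := by
  have hu' := oRect_subset_cRect hu
  obtain ⟨h, hd, he⟩ := exists_differentiableOn_of_simplePole isOpen_oRect hu
    (g := fun v => logKernel r α u v) (fun v hv =>
      (differentiableAt_logKernel_right hr0 hr1 hα hu' (oRect_subset_cRect hv.1)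
        fun e => hv.2 e.symm).1.differentiableWithinAt)
    (tendsto_sub_mul_logKernel_right hr0 hr1 hα hu)
  have hc : ContinuousOn h (cRect r α) := fun v hv => by
    by_cases hvu : v = u
    · subst hvu
      exact (hd.differentiableAt (isOpen_oRect.mem_nhds hu)).continuousAt.continuousWithinAt
    · refine ContinuousAt.continuousWithinAt ?_
      have h1 : h =ᶠ[𝓝 v] fun v => logKernel r α u v - (α : ℂ)⁻¹ / (v - u) := by
        filter_upwards [isOpen_ne.mem_nhds hvu] with w hw
        rw [he w hw]
        ring
      refine ContinuousAt.congr ?_ h1.symm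
      refine (differentiableAt_logKernel_right hr0 hr1 hα hu' hv
        fun e => hvu e.symm).1.continuousAt.sub ?_
      exact continuousAt_const.div (by fun_prop) (sub_ne_zero.2 hvu)
  have hzero := sum_integral_side_eq_zero hr0 hr1 hα hc hd
  have hwind := sum_integral_side_inv hu
  have hs : ∀ i, ∀ τ ∈ Icc 0 (sideLen r α i), sidePt r α i τ - u ≠ 0 := fun i τ hτ e =>
    (sidePt_mem hr0 hr1 hα i hτ).2 (sub_eq_zero.1 e ▸ hu)
  calc _ = ∑ i, ((α : ℂ)⁻¹ * (∫ τ in (0 : ℝ)..sideLen r α i, (sidePt r α i τ - u)⁻¹ * sideDir i)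
        + ∫ τ in (0 : ℝ)..sideLen r α i, h (sidePt r α i τ) * sideDir i) := by
        refine Finset.sum_congr rfl fun i _ => ?_
        have hl := (sideLen_pos hr0 hr1 hα i).le
        rw [← intervalIntegral.integral_const_mul, ← intervalIntegral.integral_add]
        · refine intervalIntegral.integral_congr fun τ hτ => ?_
          rw [uIcc_of_le hl] at hτ
          rw [he _ (sub_ne_zero.1 (hs i τ hτ))]
          ring
        · refine ContinuousOn.intervalIntegrable ?_
          rw [uIcc_of_le hl]
          refine continuousOn_const.mul (ContinuousOn.mul ?_ continuousOn_const)
          exact ((continuous_sidePt i).continuousOn.sub continuousOn_const).inv₀ (hs i)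
        · refine ContinuousOn.intervalIntegrable ?_
          rw [uIcc_of_le hl]
          refine ContinuousOn.mul ?_ continuousOn_const
          exact hc.comp (continuous_sidePt i).continuousOn fun τ hτ =>
            (sidePt_mem hr0 hr1 hα i hτ).1
    _ = _ := by
        rw [Finset.sum_add_distrib, hzero, ← Finset.mul_sum, hwind, add_zero]

/-- The function v ↦ conj K(u, v̄) is holomorphic at every point of the closed rectangle, because
conjugate points avoid the pole; Cauchy's theorem applies to it. -/
lemma sum_integral_logKernel_conj (hr0 : 0 < r) (hr1 : r < 1) (hα : 0 < α) {u : ℂ}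
    (hu : u ∈ oRect r α) :
    ∑ i, ∫ τ in (0 : ℝ)..sideLen r α i,
      logKernel r α u (conj (sidePt r α i τ)) * conj (sideDir i) = 0 := by
  have hd : ∀ v ∈ cRect r α, DifferentiableAt ℂ (fun v => conj (logKernel r α u (conj v))) v :=
    fun v hv => by
      have := (differentiableAt_logKernel_conj hr0 hr1 hα hu hv).1.conj_conj
      rwa [Complex.conj_conj] at this
  have := congrArg conj (sum_integral_side_eq_zero hr0 hr1 hα
    (fun v hv => (hd v hv).continuousAt.continuousWithinAt)
    fun v hv => (hd v (oRect_subset_cRect hv)).differentiableWithinAt)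
  rw [map_sum, map_zero] at this
  rw [← this]
  refine Finset.sum_congr rfl fun i _ => ?_
  have hl := (sideLen_pos hr0 hr1 hα i).le
  rw [intervalIntegral.integral_of_le hl, intervalIntegral.integral_of_le hl, ← integral_conj]
  simp

/-- The total mass of the Poisson kernel. -/
lemma sum_integral_pairKernel (hr0 : 0 < r) (hr1 : r < 1) (hα : 0 < α) {u : ℂ}
    (hu : u ∈ oRect r α) :
    ∑ i, ∫ τ in (0 : ℝ)..sideLen r α i, pairKernel r α u (sidePt r α i τ) (sideCoef α i) = 1 := by
  have hα' : (α : ℂ) ≠ 0 := by exact_mod_cast hα.ne'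
  simp only [integral_side_pairKernel]
  calc _ = ∑ i, (α / (2 * Real.pi * Complex.I) *
        (∫ τ in (0 : ℝ)..sideLen r α i, logKernel r α u (sidePt r α i τ) * sideDir i)
        + α / (2 * Real.pi * Complex.I) * ∫ τ in (0 : ℝ)..sideLen r α i,
          logKernel r α u (conj (sidePt r α i τ)) * conj (sideDir i)) := by
        refine Finset.sum_congr rfl fun i _ => ?_
        have hl := (sideLen_pos hr0 hr1 hα i).le
        obtain ⟨h1, h2⟩ := continuousOn_logKernel_side hr0 hr1 hα hu i
        rw [← uIcc_of_le hl] at h1 h2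
        rw [intervalIntegral.integral_const_mul, intervalIntegral.integral_add
          (f := fun τ => logKernel r α u (sidePt r α i τ) * sideDir i)
          (g := fun τ => logKernel r α u (conj (sidePt r α i τ)) * conj (sideDir i))
          (h1.mul continuousOn_const).intervalIntegrable
          (h2.mul continuousOn_const).intervalIntegrable, mul_add]
    _ = _ := by
        rw [Finset.sum_add_distrib, ← Finset.mul_sum, ← Finset.mul_sum,
          sum_integral_logKernel hr0 hr1 hα hu, sum_integral_logKernel_conj hr0 hr1 hα hu]
        have : (2 * Real.pi * Complex.I : ℂ) ≠ 0 := by simp [Real.pi_ne_zero]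
        field_simp
        simp

/-- Strengthens the residue to convergence of the regular part, which is needed to compare the
kernel with an explicit singular part. On U the exponential equals 1 only at s = 0, and the other
poles of V lie outside its image. -/
lemma villat_exp_simplePole (hr0 : 0 < r) (hr1 : r < 1) (hα : 0 < α) :
    ∃ c : ℂ, Tendsto (fun s : ℂ => villat (qpar r α) (Complex.exp (α * s)) + (α : ℂ)⁻¹ / s)
      (𝓝[≠] 0) (𝓝 c) := by
  have hlog := Real.log_neg hr0 hr1
  have h2 : 0 < Real.pi / α := by positivity
  set U : Set ℂ := Ioo (Real.log r) (-Real.log r) ×ℂ Ioo (-(Real.pi / α)) (Real.pi / α)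
  have hU : IsOpen U := isOpen_Ioo.reProdIm isOpen_Ioo
  have h0 : (0 : ℂ) ∈ U := by
    refine ⟨⟨?_, ?_⟩, ?_, ?_⟩ <;> simp <;> linarith
  obtain ⟨c, hc, hb⟩ := exists_mul_norm_le_norm_exp_sub_one (α * (-Real.log r)) (by nlinarith)
  have q0 := qpar_pos hr0 α
  have q1 := qpar_lt_one hr0 hr1 hα
  have hd : DifferentiableOn ℂ (fun s : ℂ => villat (qpar r α) (Complex.exp (α * s))) (U \ {0}) := by
    rintro s ⟨⟨⟨a1, a2⟩, a3, a4⟩, hs⟩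
    have e1 : (α * s : ℂ).re = α * s.re := by simp
    have e2 : (α * s : ℂ).im = α * s.im := by simp
    have n1 : Real.exp (α * Real.log r) < ‖Complex.exp (α * s)‖ := by
      rw [norm_exp_mul]
      gcongr
    have n2 : ‖Complex.exp (α * s)‖ < (Real.exp (α * Real.log r))⁻¹ := by
      rw [norm_exp_mul, ← Real.exp_neg, ← mul_neg]
      gcongr
    have e3 := qpar_eq_exp (α := α) hr0
    set R := Real.exp (α * Real.log r) with hR
    have hR0 : 0 < R := Real.exp_pos _
    have hR1 : R < 1 := Real.exp_lt_one_iff.2 (by nlinarith)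
    have hne : Complex.exp (α * s) ≠ 1 := fun h => by
      have h3 := hb (α * s) (by
        rw [e1, abs_mul, abs_of_pos hα]
        gcongr
        rw [abs_le]
        constructor <;> linarith) (by
        rw [e2, abs_mul, abs_of_pos hα, ← le_div_iff₀' hα, abs_le]
        constructor <;> linarith)
      rw [h, sub_self, norm_zero] at h3
      have h4 : 0 < ‖(α * s : ℂ)‖ := by
        rw [norm_pos_iff]
        exact mul_ne_zero (by exact_mod_cast hα.ne') hs
      nlinarith [mul_pos hc h4]
    refine ((differentiableAt_villat q0 q1 ?_ ?_ hne ?_).comp (f := fun s : ℂ =>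
      Complex.exp (α * s)) s (by fun_prop)).differentiableWithinAt
    · nlinarith
    · refine n2.trans ?_
      rw [e3]
      exact inv_strictAnti₀ (by positivity) (by nlinarith)
    · intro h
      rw [h, Complex.norm_real, Real.norm_of_nonneg q0.le, e3] at n1
      nlinarith
  obtain ⟨h, hh, he⟩ := exists_differentiableOn_of_simplePole hU h0 hd (c := -(α : ℂ)⁻¹) (by
    simpa using tendsto_mul_villat_exp q0 q1 hα)
  refine ⟨h 0, ?_⟩
  refine ((hh.differentiableAt (hU.mem_nhds h0)).continuousAt.tendsto.mono_left
    nhdsWithin_le_nhds).congr' ?_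
  filter_upwards [self_mem_nhdsWithin] with s hs
  rw [he s hs]
  ring

end

/-! ### Nonnegativity of the Poisson kernel -/

section

variable {r α : ℝ}

lemma sideCoef_mul_inv (hα : 0 < α) (i : Fin 4) :
    2 * sideCoef α i * (α : ℂ)⁻¹ = sideDir i / (Real.pi * Complex.I) := by
  have hα' : (α : ℂ) ≠ 0 := by exact_mod_cast hα.ne'
  rw [sideCoef]
  field_simp

/-- This dichotomy decides how the two halves of the pair combine: on horizontal sides they coincide
and the coefficient is imaginary, while on vertical sides they form the kernel H₁ and the
coefficient is real. In both cases the singular part doubles. -/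
lemma sidePt_interior (hr0 : 0 < r) (hα : 0 < α) (i : Fin 4) {τ : ℝ}
    (hτ : τ ∈ Ioo 0 (sideLen r α i)) :
    (conj (Complex.exp (α * sidePt r α i τ)) = Complex.exp (α * sidePt r α i τ) ∧
      conj (sideCoef α i) = -sideCoef α i ∧
      Real.log r < (sidePt r α i τ).re ∧ (sidePt r α i τ).re < 0) ∨
    ((‖Complex.exp (α * sidePt r α i τ)‖ = 1 ∨ ‖Complex.exp (α * sidePt r α i τ)‖ ^ 2 = qpar r α) ∧
      conj (sideCoef α i) = sideCoef α i ∧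
      0 < (sidePt r α i τ).im ∧ (sidePt r α i τ).im < Real.pi / α) := by
  obtain ⟨h1, h2⟩ := hτ
  rw [conj_sideCoef, sideCoef, norm_exp_mul, qpar_eq_exp hr0, Complex.conj_eq_iff_im, Complex.exp_im]
  fin_cases i
  · left
    simp [sideLen] at h2
    refine ⟨?_, ?_, ?_, ?_⟩ <;> simp [sidePt, sideStart, sideDir]
    · exact h1
    · linarith
  · right
    simp [sideLen] at h2
    refine ⟨?_, ?_, ?_, ?_⟩ <;> simp [sidePt, sideStart, sideDir]
    · ring
    · exact h1
    · exact h2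
  · left
    simp [sideLen] at h2
    refine ⟨?_, ?_, ?_, ?_⟩ <;> simp [sidePt, sideStart, sideDir]
    · rw [mul_div_cancel₀ _ hα.ne', Real.sin_pi]
    · linarith
    · exact h1
  · right
    simp [sideLen] at h2
    refine ⟨?_, ?_, ?_, ?_⟩ <;> simp [sidePt, sideStart, sideDir]
    · ring
    · exact h2
    · exact h1

/-- The singular part of the Poisson kernel at a point of an open side. -/
lemma tendsto_pairKernel_add (hr0 : 0 < r) (hr1 : r < 1) (hα : 0 < α) (i : Fin 4) {τ : ℝ}
    (hτ : τ ∈ Ioo 0 (sideLen r α i)) :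
    ∃ ℓ : ℂ, Tendsto (fun u => pairKernel r α u (sidePt r α i τ) (sideCoef α i)
      + 2 * sideCoef α i * (α : ℂ)⁻¹ / (u - sidePt r α i τ))
      (𝓝[cRect r α \ {sidePt r α i τ}] (sidePt r α i τ)) (𝓝 ℓ) := by
  obtain ⟨hv, hv'⟩ := sidePt_mem hr0 hr1 hα i (Ioo_subset_Icc_self hτ)
  have hcase := sidePt_interior hr0 hα i hτ
  set v := sidePt r α i τ
  set a := sideCoef α i
  obtain ⟨c, hc⟩ := villat_exp_simplePole hr0 hr1 hα
  have hs : Tendsto (fun u : ℂ => u - v) (𝓝[cRect r α \ {v}] v) (𝓝[≠] 0) := by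
    refine tendsto_nhdsWithin_iff.2 ⟨?_, ?_⟩
    · refine Tendsto.mono_left ?_ nhdsWithin_le_nhds
      simpa using (continuous_id.sub continuous_const).tendsto (f := fun u => u - v) v
    · filter_upwards [self_mem_nhdsWithin] with u hu
      simpa [sub_eq_zero] using hu.2
  have t1 := hc.comp hs
  have hmem : ∀ᶠ u in 𝓝[cRect r α \ {v}] v, u ∈ cRect r α ∧ u ≠ v := self_mem_nhdsWithin
  have hva := exp_mem_ann_of_mem hr0 hα hv
  rcases hcase with ⟨h1, h2, h3, h4⟩ | ⟨h1, h2, h3, h4⟩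
  -- Horizontal side: the kernel takes the same value at v and v̄, so the pair is 2 a K(u, v), and
  -- only its term in u - v is singular.
  · have d : ContinuousAt (villat (qpar r α)) (Complex.exp (α * (v + v))) :=
      (differentiableAt_villat_exp_of_re hr0 hr1 hα (by simp; linarith)
        (by simp; linarith)).continuousAt
    have t2 : Tendsto (fun u => villat (qpar r α) (Complex.exp (α * (u + v))))
        (𝓝[cRect r α \ {v}] v) (𝓝 (villat (qpar r α) (Complex.exp (α * (v + v))))) :=
      (ContinuousAt.comp (f := fun u : ℂ => Complex.exp (α * (u + v))) d
        (by fun_prop)).tendsto.mono_left nhdsWithin_le_nhds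
    refine ⟨_, (((tendsto_const_nhds (x := (1 : ℂ))).add t1).sub t2).const_mul (2 * a) |>.congr
      fun u => ?_⟩
    rw [conj_exp_mul] at h1
    have e : logKernel r α u (conj v) = logKernel r α u v := by rw [logKernel, logKernel, h1]
    rw [pairKernel, e, h2, logKernel_eq, Function.comp_apply]
    ring
  -- Vertical side: the pair is a H₁, that is 2a times the difference of the values of V at exp (α
  -- (u - v)) and exp (α (u - v̄)); the second is regular at u = v.
  · have him := exp_im_pos hα h3 h4
    have hne : Complex.exp (α * v) ≠ Complex.exp (α * conj v) := fun h => by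
      rw [← conj_exp_mul] at h
      have := congrArg Complex.im h
      rw [Complex.conj_im] at this
      linarith
    have hva' := hva
    rw [← conj_mem_ann, conj_exp_mul] at hva'
    have d := (differentiableAt_villat_exp_sub hr0 hr1 hα hva hva' hne).continuousAt
    have t2 : Tendsto (fun u => villat (qpar r α) (Complex.exp (α * (u - conj v))))
        (𝓝[cRect r α \ {v}] v) (𝓝 (villat (qpar r α) (Complex.exp (α * (v - conj v))))) :=
      (ContinuousAt.comp (f := fun u : ℂ => Complex.exp (α * (u - conj v))) d
        (by fun_prop)).tendsto.mono_left nhdsWithin_le_nhds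
    refine ⟨_, (t1.sub t2).const_mul (2 * a) |>.congr' ?_⟩
    filter_upwards [hmem] with u hu
    have n1 := exp_mul_ne hr0 hr1 hα hu.1 hv hu.2
    have n2 := exp_mul_ne_conj hr0 hr1 hα hu.1 hv hu.2
    have e := kernelH1_eq_ringKernel hr0 hr1 hα (exp_mem_ann_of_mem hr0 hα hu.1) hva n1 n2 h1
    rw [kernelH1_eq hr0 hr1 hα (Complex.exp_ne_zero _) (Complex.exp_ne_zero _) n1 n2,
      conj_exp_mul, ← Complex.exp_sub, ← Complex.exp_sub, ← mul_sub, ← mul_sub] at e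
    have e' : pairKernel r α u v a
        = a * (ringKernel (qpar r α) (Complex.exp (α * u)) (Complex.exp (α * v)) -
          ringKernel (qpar r α) (Complex.exp (α * u)) (Complex.exp (α * conj v))) := by
      rw [pairKernel, h2, logKernel, logKernel]
      ring
    rw [e', ← e, Function.comp_apply]
    ring

/-- Up to sign this is the Poisson kernel of the half-plane to the left of the side, the model for
the singularity of the kernel of the rectangle. -/
lemma re_sing (hα : 0 < α) (i : Fin 4) (u : ℂ) (τ : ℝ) :
    (2 * sideCoef α i * (α : ℂ)⁻¹ / (u - sidePt r α i τ)).re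
      = -(((u - sideStart r α i) * conj (sideDir i)).im
        / (Real.pi * Complex.normSq (u - sidePt r α i τ))) := by
  rw [sideCoef_mul_inv hα]
  have e : ((u - sideStart r α i) * conj (sideDir i)).im
      = ((u - sidePt r α i τ) * conj (sideDir i)).im := by
    have : (u - sideStart r α i) * conj (sideDir i)
        = (u - sidePt r α i τ) * conj (sideDir i) + τ := by
      rw [sidePt]
      linear_combination (τ : ℂ) * sideDir_mul_conj i
    rw [this]
    simp
  rw [e]
  generalize u - sidePt r α i τ = w
  have : sideDir i / (Real.pi * Complex.I) / w
      = ((Real.pi * Complex.normSq w : ℝ) : ℂ)⁻¹ * (-Complex.I * (sideDir i * conj w)) := by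
    rw [div_div, div_eq_mul_inv, mul_inv, mul_inv, Complex.inv_I, Complex.inv_def w]
    push_cast
    rw [mul_inv]
    ring
  rw [this, ← Complex.ofReal_inv, Complex.re_ofReal_mul]
  simp
  ring

/-- The Poisson kernel is nonnegative. -/
lemma re_pairKernel_side_nonneg (hr0 : 0 < r) (hr1 : r < 1) (hα : 0 < α) (i : Fin 4) {τ : ℝ}
    (hτ : τ ∈ Ioo 0 (sideLen r α i)) {u : ℂ} (hu : u ∈ oRect r α) :
    0 ≤ (pairKernel r α u (sidePt r α i τ) (sideCoef α i)).re := by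
  obtain ⟨hv, hv'⟩ := sidePt_mem hr0 hr1 hα i (Ioo_subset_Icc_self hτ)
  obtain ⟨ℓ, hℓ⟩ := tendsto_pairKernel_add hr0 hr1 hα i hτ
  have hre := fun u => re_sing (r := r) hα i u τ
  -- The limit is evaluated by approaching along the side itself, where the real parts of the pair
  -- and of the singular part both vanish.
  have hℓ0 : ℓ.re = 0 := by
    have hside : Tendsto (fun s => sidePt r α i s) (𝓝[≠] τ)
        (𝓝[cRect r α \ {sidePt r α i τ}] (sidePt r α i τ)) := by
      refine tendsto_nhdsWithin_iff.2
        ⟨((continuous_sidePt i).tendsto τ).mono_left nhdsWithin_le_nhds, ?_⟩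
      filter_upwards [self_mem_nhdsWithin,
        nhdsWithin_le_nhds (isOpen_Ioo.mem_nhds hτ)] with s hs hs'
      refine ⟨(sidePt_mem hr0 hr1 hα i (Ioo_subset_Icc_self hs')).1, fun h => hs ?_⟩
      have h2 : (s : ℂ) * sideDir i = τ * sideDir i := add_left_cancel h
      have h3 : (s : ℂ) = τ := by
        have hd := sideDir_mul_conj i
        linear_combination conj (sideDir i) * h2 - (s - τ) * hd
      exact_mod_cast h3
    have t := (Complex.continuous_re.tendsto ℓ).comp (hℓ.comp hside)
    refine tendsto_nhds_unique t (tendsto_const_nhds.congr' ?_)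
    filter_upwards [self_mem_nhdsWithin, hside self_mem_nhdsWithin,
      nhdsWithin_le_nhds (isOpen_Ioo.mem_nhds hτ)] with s hs hmem hs'
    obtain ⟨m1, m2⟩ := sidePt_mem hr0 hr1 hα i (Ioo_subset_Icc_self hs')
    have z1 : (pairKernel r α (sidePt r α i s) (sidePt r α i τ) (sideCoef α i)).re = 0 :=
      re_logKernel_pair hr0 hr1 hα m1 m2 hv hmem.2 _
    have z2 : ((sidePt r α i s - sideStart r α i) * conj (sideDir i)).im = 0 := by
      rw [sidePt, add_sub_cancel_left, mul_assoc, sideDir_mul_conj]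
      simp
    simp only [Function.comp_apply, Complex.add_re, hre, z1, z2]
    simp
  refine re_nonneg_of_frontier isOpen_oRect (isCompact_cRect.isBounded.subset oRect_subset_cRect)
    (F := fun u => pairKernel r α u (sidePt r α i τ) (sideCoef α i)) ?_ ?_ u hu
  · intro u hu
    obtain ⟨d1, d2⟩ := differentiableAt_logKernel_left hr0 hr1 hα (oRect_subset_cRect hu) hv
      fun h => hv' (h ▸ hu)
    exact ((d1.mul_const _).sub (d2.mul_const _)).differentiableWithinAt
  · intro t ht ε hε
    rw [isOpen_oRect.frontier_eq, closure_oRect hr0 hr1 hα] at ht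
    -- At the pole the real part is the nonnegative half-plane kernel plus a term tending to zero;
    -- at every other boundary point it tends to zero outright. The minimum principle needs only
    -- these lower bounds.
    by_cases htv : t = sidePt r α i τ
    · subst htv
      have hsub : oRect r α ⊆ cRect r α \ {sidePt r α i τ} := fun w hw =>
        ⟨oRect_subset_cRect hw, fun h => hv' (h ▸ hw)⟩
      have t := (Complex.continuous_re.tendsto ℓ).comp (hℓ.mono_left (nhdsWithin_mono _ hsub))
      rw [hℓ0] at t
      filter_upwards [t.eventually (lt_mem_nhds (neg_lt_zero.2 hε)), self_mem_nhdsWithin]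
        with w hw hw'
      simp only [Function.comp_apply, Complex.add_re, hre] at hw
      have : 0 ≤ ((w - sideStart r α i) * conj (sideDir i)).im
          / (Real.pi * Complex.normSq (w - sidePt r α i τ)) :=
        div_nonneg (im_side_nonneg (oRect_subset_cRect hw') i)
          (mul_nonneg Real.pi_pos.le (Complex.normSq_nonneg _))
      linarith
    · obtain ⟨d1, d2⟩ := differentiableAt_logKernel_left hr0 hr1 hα ht.1 hv htv
      have c := ((d1.mul_const (sideCoef α i)).sub
        (d2.mul_const (conj (sideCoef α i)))).continuousAt
      have t := (Complex.continuous_re.continuousAt.comp c).tendsto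
      simp only [Function.comp_apply, Pi.sub_apply] at t
      rw [re_logKernel_pair hr0 hr1 hα ht.1 ht.2 hv htv] at t
      filter_upwards [nhdsWithin_le_nhds (t.eventually (lt_mem_nhds (neg_lt_zero.2 hε)))] with w hw
      exact hw.le

end

section

/-! ### The Poisson operator of the rectangle -/

/-- The holomorphic function on the rectangle with real boundary values `g`. -/
def poisson (r α : ℝ) (g : ℂ → ℝ) (u : ℂ) : ℂ :=
  ∑ i, ∫ τ in (0 : ℝ)..sideLen r α i,
    (g (sidePt r α i τ) : ℂ) * pairKernel r α u (sidePt r α i τ) (sideCoef α i)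

variable {r α : ℝ} {g : ℂ → ℝ}

lemma exists_norm_pairKernel_le (hr0 : 0 < r) (hr1 : r < 1) (hα : 0 < α) :
    ∃ C : ℝ, 0 < C ∧ ∀ u ∈ cRect r α, ∀ v ∈ cRect r α, u ≠ v → ∀ a : ℂ,
      ‖pairKernel r α u v a‖ ≤ C * ‖a‖ / ‖u - v‖ := by
  obtain ⟨C, hC, hb⟩ := exists_norm_logKernel_le hr0 hr1 hα
  refine ⟨2 * C, by positivity, fun u hu v hv h a => ?_⟩
  obtain ⟨h1, h2⟩ := hb u hu v hv h
  calc ‖pairKernel r α u v a‖ ≤ ‖logKernel r α u v‖ * ‖a‖ + ‖logKernel r α u (conj v)‖ * ‖a‖ := by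
        refine (norm_sub_le _ _).trans ?_
        rw [norm_mul, norm_mul, Complex.norm_conj]
    _ ≤ C / ‖u - v‖ * ‖a‖ + C / ‖u - v‖ * ‖a‖ := by gcongr
    _ = _ := by ring

lemma isCompact_boundary : IsCompact (cRect r α \ oRect r α) :=
  isCompact_cRect.diff isOpen_oRect

lemma continuousOn_comp_side (hr0 : 0 < r) (hr1 : r < 1) (hα : 0 < α)
    (hg : ContinuousOn g (cRect r α \ oRect r α)) (i : Fin 4) :
    ContinuousOn (fun τ => g (sidePt r α i τ)) (Icc 0 (sideLen r α i)) :=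
  hg.comp (continuous_sidePt i).continuousOn fun _ hτ => sidePt_mem hr0 hr1 hα i hτ

lemma differentiableOn_poisson (hr0 : 0 < r) (hr1 : r < 1) (hα : 0 < α)
    (hg : ContinuousOn g (cRect r α \ oRect r α)) :
    DifferentiableOn ℂ (poisson r α g) (oRect r α) := by
  intro u₀ hu₀
  obtain ⟨C, hC, hb⟩ := exists_norm_pairKernel_le hr0 hr1 hα
  obtain ⟨M, hM⟩ := isCompact_boundary.exists_bound_of_continuousOn hg
  obtain ⟨ε, hε, hball⟩ := Metric.isOpen_iff.1 isOpen_oRect u₀ hu₀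
  refine DifferentiableAt.differentiableWithinAt ?_
  unfold poisson
  refine DifferentiableAt.fun_sum fun i _ => ?_
  have hl := (sideLen_pos hr0 hr1 hα i).le
  simp only [intervalIntegral.integral_of_le hl]
  have hsub : Metric.ball u₀ (ε / 2) ⊆ oRect r α :=
    (Metric.ball_subset_ball (by linarith)).trans hball
  have hmem : ∀ᵐ τ ∂volume.restrict (Ioc 0 (sideLen r α i)), τ ∈ Icc 0 (sideLen r α i) :=
    (ae_restrict_mem measurableSet_Ioc).mono fun _ h => Ioc_subset_Icc_self h
  refine differentiableAt_integral_of_bounded_holomorphic (half_pos hε)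
    (b := fun _ => M * (C * ‖sideCoef α i‖ / (ε / 2))) (integrable_const _) ?_ ?_ ?_
  · intro u hu
    refine ContinuousOn.aestronglyMeasurable (ContinuousOn.mono ?_ Ioc_subset_Icc_self)
      measurableSet_Ioc
    exact (Complex.continuous_ofReal.comp_continuousOn
      (continuousOn_comp_side hr0 hr1 hα hg i)).mul
      (continuousOn_pairKernel_side hr0 hr1 hα (hsub hu) i _)
  · filter_upwards [hmem] with τ hτ u hu
    obtain ⟨hv, hv'⟩ := sidePt_mem hr0 hr1 hα i hτ
    obtain ⟨d1, d2⟩ := differentiableAt_logKernel_left hr0 hr1 hα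
      (oRect_subset_cRect (hsub hu)) hv fun h => hv' (h ▸ hsub hu)
    exact (((d1.mul_const _).sub (d2.mul_const _)).const_mul _).differentiableWithinAt
  · filter_upwards [hmem] with τ hτ u hu
    obtain ⟨hv, hv'⟩ := sidePt_mem hr0 hr1 hα i hτ
    have hdist : ε / 2 ≤ ‖u - sidePt r α i τ‖ := by
      by_contra! h
      refine hv' (hball ?_)
      rw [Metric.mem_ball, dist_eq_norm] at hu ⊢
      calc _ = ‖(u - u₀) - (u - sidePt r α i τ)‖ := by congr 1; ring
        _ ≤ _ := norm_sub_le _ _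
        _ < ε := by linarith
    have h1 := hM _ ⟨hv, hv'⟩
    have h2 := hb u (oRect_subset_cRect (hsub hu)) _ hv (fun h => hv' (h ▸ hsub hu))
      (sideCoef α i)
    rw [norm_mul, Complex.norm_real]
    have hM0 : 0 ≤ M := (norm_nonneg _).trans h1
    calc _ ≤ M * (C * ‖sideCoef α i‖ / ‖u - sidePt r α i τ‖) := by gcongr
      _ ≤ _ := by gcongr

lemma re_intervalIntegral {F : ℝ → ℂ} {a b : ℝ} (hF : IntervalIntegrable F volume a b) :
    (∫ τ in a..b, F τ).re = ∫ τ in a..b, (F τ).re :=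
  (Complex.reCLM.intervalIntegral_comp_comm hF).symm

/-- The usual argument for an approximate identity. Near u₀ the oscillation of g is below ε/2 and is
multiplied by a nonnegative kernel of mass 1; away from u₀ the kernel is bounded and its real part
tends to zero, so dominated convergence applies. Treating all four sides at once covers the corners
as well. -/
lemma tendsto_re_poisson (hr0 : 0 < r) (hr1 : r < 1) (hα : 0 < α)
    (hg : ContinuousOn g (cRect r α \ oRect r α)) {u₀ : ℂ} (hu₀ : u₀ ∈ cRect r α)
    (hu₀' : u₀ ∉ oRect r α) :
    Tendsto (fun u => (poisson r α g u).re) (𝓝[oRect r α] u₀) (𝓝 (g u₀)) := by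
  obtain ⟨C, hC, hb⟩ := exists_norm_pairKernel_le hr0 hr1 hα
  obtain ⟨M, hM⟩ := isCompact_boundary.exists_bound_of_continuousOn hg
  have hM0 : 0 ≤ M := (norm_nonneg _).trans (hM u₀ ⟨hu₀, hu₀'⟩)
  set p : Fin 4 → ℂ → ℝ → ℝ := fun i u τ =>
    (pairKernel r α u (sidePt r α i τ) (sideCoef α i)).re with hp
  have hl := fun i => (sideLen_pos hr0 hr1 hα i).le
  have hpc : ∀ i, ∀ u ∈ oRect r α, ContinuousOn (p i u) (Icc 0 (sideLen r α i)) := fun i u hu =>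
    Complex.continuous_re.comp_continuousOn (continuousOn_pairKernel_side hr0 hr1 hα hu i _)
  have hgc := continuousOn_comp_side hr0 hr1 hα hg
  have hint : ∀ i, ∀ {F : ℝ → ℝ}, ContinuousOn F (Icc 0 (sideLen r α i)) →
      IntervalIntegrable F volume 0 (sideLen r α i) := fun i F hF => by
    rw [← uIcc_of_le (hl i)] at hF
    exact hF.intervalIntegrable
  have hmass : ∀ u ∈ oRect r α, ∑ i, ∫ τ in (0 : ℝ)..sideLen r α i, p i u τ = 1 := fun u hu => by
    have h := congrArg Complex.re (sum_integral_pairKernel hr0 hr1 hα hu)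
    rw [Complex.re_sum, Complex.one_re] at h
    rw [← h]
    refine Finset.sum_congr rfl fun i _ => (re_intervalIntegral ?_).symm
    have := continuousOn_pairKernel_side hr0 hr1 hα hu i (sideCoef α i)
    rw [← uIcc_of_le (hl i)] at this
    exact this.intervalIntegrable
  have hre : ∀ u ∈ oRect r α, (poisson r α g u).re - g u₀
      = ∑ i, ∫ τ in (0 : ℝ)..sideLen r α i, (g (sidePt r α i τ) - g u₀) * p i u τ := fun u hu => by
    have h1 : (poisson r α g u).re
        = ∑ i, ∫ τ in (0 : ℝ)..sideLen r α i, g (sidePt r α i τ) * p i u τ := by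
      rw [poisson, Complex.re_sum]
      refine Finset.sum_congr rfl fun i _ => ?_
      rw [re_intervalIntegral]
      · simp [hp]
      · have h2 := (Complex.continuous_ofReal.comp_continuousOn (hgc i)).mul
          (continuousOn_pairKernel_side hr0 hr1 hα hu i (sideCoef α i))
        rw [← uIcc_of_le (hl i)] at h2
        exact h2.intervalIntegrable
    have h3 : g u₀ = ∑ i, ∫ τ in (0 : ℝ)..sideLen r α i, g u₀ * p i u τ := by
      simp only [intervalIntegral.integral_const_mul]
      rw [← Finset.mul_sum, hmass u hu, mul_one]
    rw [h1]
    conv_lhs => rw [h3]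
    rw [← Finset.sum_sub_distrib]
    refine Finset.sum_congr rfl fun i _ => ?_
    rw [← intervalIntegral.integral_sub (f := fun τ => g (sidePt r α i τ) * p i u τ)
      (g := fun τ => g u₀ * p i u τ) (hint i ((hgc i).mul (hpc i u hu)))
      (hint i (continuousOn_const.mul (hpc i u hu)))]
    simp only [sub_mul]
  rw [Metric.tendsto_nhds]
  intro ε hε
  obtain ⟨δ, hδ, hgδ⟩ := Metric.continuousWithinAt_iff.1 (hg u₀ ⟨hu₀, hu₀'⟩) (ε / 2) (half_pos hε)
  classical
  -- With this cut-off a single pointwise bound, ε/2 times the kernel plus the far part, holds on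
  -- every open side, where the kernel is known to be nonnegative.
  set far : Fin 4 → ℂ → ℝ → ℝ := fun i u τ =>
    if δ ≤ ‖sidePt r α i τ - u₀‖ then |g (sidePt r α i τ) - g u₀| * p i u τ else 0 with hfar
  have hmeas : ∀ i, MeasurableSet {τ | δ ≤ ‖sidePt r α i τ - u₀‖} := fun i =>
    (isClosed_le continuous_const ((continuous_sidePt i).sub continuous_const).norm).measurableSet
  have hfarm : ∀ i, ∀ u ∈ oRect r α, AEStronglyMeasurable (far i u)
      (volume.restrict (uIoc 0 (sideLen r α i))) := fun i u hu => by
    rw [uIoc_of_le (hl i)]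
    have h1 : AEStronglyMeasurable (fun τ => |g (sidePt r α i τ) - g u₀| * p i u τ)
        (volume.restrict (Ioc 0 (sideLen r α i))) :=
      ((((hgc i).sub continuousOn_const).abs.mul (hpc i u hu)).mono
        Ioc_subset_Icc_self).aestronglyMeasurable measurableSet_Ioc
    exact h1.indicator (hmeas i)
  have hnear : ∀ᶠ u in 𝓝[oRect r α] u₀, u ∈ oRect r α ∧ ‖u - u₀‖ < δ / 2 := by
    filter_upwards [self_mem_nhdsWithin,
      nhdsWithin_le_nhds (Metric.ball_mem_nhds u₀ (half_pos hδ))] with u hu hu'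
    exact ⟨hu, by rwa [← dist_eq_norm]⟩
  have hfarb : ∀ i, ∀ u, u ∈ oRect r α ∧ ‖u - u₀‖ < δ / 2 → ∀ τ ∈ Icc 0 (sideLen r α i),
      ‖far i u τ‖ ≤ 2 * M * (C * ‖sideCoef α i‖ / (δ / 2)) := by
    rintro i u ⟨hu, hud⟩ τ hτ
    obtain ⟨hv, hv'⟩ := sidePt_mem hr0 hr1 hα i hτ
    simp only [hfar]
    split_ifs with hd
    · have h1 : |g (sidePt r α i τ) - g u₀| ≤ 2 * M := by
        have a := hM _ ⟨hv, hv'⟩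
        have b := hM u₀ ⟨hu₀, hu₀'⟩
        rw [Real.norm_eq_abs] at a b
        exact (abs_sub _ _).trans (by linarith)
      have hdist : δ / 2 ≤ ‖u - sidePt r α i τ‖ := by
        have := norm_sub_norm_le (sidePt r α i τ - u₀) (u - u₀)
        rw [sub_sub_sub_cancel_right, norm_sub_rev _ u] at this
        linarith
      have h2 := hb u (oRect_subset_cRect hu) _ hv (fun h => hv' (h ▸ hu)) (sideCoef α i)
      rw [norm_mul, Real.norm_eq_abs, abs_abs, Real.norm_eq_abs]
      calc _ ≤ 2 * M * (C * ‖sideCoef α i‖ / ‖u - sidePt r α i τ‖) := by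
            gcongr
            exact (Complex.abs_re_le_norm _).trans h2
        _ ≤ _ := by gcongr
    · rw [norm_zero]
      positivity
  have hfart : Tendsto (fun u => ∑ i, ∫ τ in (0 : ℝ)..sideLen r α i, far i u τ) (𝓝[oRect r α] u₀)
      (𝓝 (0 : ℝ)) := by
    have hz : ∑ i : Fin 4, ∫ τ in (0 : ℝ)..sideLen r α i, (0 : ℝ) = 0 := by simp
    suffices h : ∀ i, Tendsto (fun u => ∫ τ in (0 : ℝ)..sideLen r α i, far i u τ)
        (𝓝[oRect r α] u₀) (𝓝 (∫ τ in (0 : ℝ)..sideLen r α i, (0 : ℝ))) by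
      have := tendsto_finsetSum Finset.univ fun i _ => h i
      rwa [hz] at this
    intro i
    refine intervalIntegral.tendsto_integral_filter_of_dominated_convergence
      (fun _ => 2 * M * (C * ‖sideCoef α i‖ / (δ / 2))) ?_ ?_ intervalIntegrable_const ?_
    · exact hnear.mono fun u hu => hfarm i u hu.1
    · filter_upwards [hnear] with u hu
      refine ae_of_all _ fun τ hτ => hfarb i u hu τ ?_
      rw [uIoc_of_le (hl i)] at hτ
      exact Ioc_subset_Icc_self hτ
    · refine ae_of_all _ fun τ hτ => ?_
      rw [uIoc_of_le (hl i)] at hτ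
      obtain ⟨hv, hv'⟩ := sidePt_mem hr0 hr1 hα i (Ioc_subset_Icc_self hτ)
      simp only [hfar]
      split_ifs with hd
      · have hne : u₀ ≠ sidePt r α i τ := fun h => by
          rw [← h, sub_self, norm_zero] at hd
          linarith
        obtain ⟨d1, d2⟩ := differentiableAt_logKernel_left hr0 hr1 hα hu₀ hv hne
        have c := ((d1.mul_const (sideCoef α i)).sub
          (d2.mul_const (conj (sideCoef α i)))).continuousAt
        have t := ((Complex.continuous_re.continuousAt.comp c).tendsto.const_mul
          |g (sidePt r α i τ) - g u₀|).mono_left (nhdsWithin_le_nhds (s := oRect r α))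
        simp only [Function.comp_apply, Pi.sub_apply] at t
        rwa [re_logKernel_pair hr0 hr1 hα hu₀ hu₀' hv hne, mul_zero] at t
      · exact tendsto_const_nhds
  filter_upwards [hnear, hfart.eventually (gt_mem_nhds (half_pos hε))] with u hu hsmall
  have hu' := hu.1
  rw [Real.dist_eq, hre u hu']
  have hfari : ∀ i, IntervalIntegrable (far i u) volume 0 (sideLen r α i) := fun i => by
    rw [intervalIntegrable_iff, uIoc_of_le (hl i)]
    have hm := hfarm i u hu'
    rw [uIoc_of_le (hl i)] at hm
    refine Integrable.mono' (g := fun _ => 2 * M * (C * ‖sideCoef α i‖ / (δ / 2)))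
      (integrable_const _) hm ?_
    filter_upwards [ae_restrict_mem measurableSet_Ioc] with τ hτ
    exact hfarb i u hu τ (Ioc_subset_Icc_self hτ)
  have hbound : ∀ i, |∫ τ in (0 : ℝ)..sideLen r α i, (g (sidePt r α i τ) - g u₀) * p i u τ|
      ≤ (ε / 2) * (∫ τ in (0 : ℝ)..sideLen r α i, p i u τ)
        + ∫ τ in (0 : ℝ)..sideLen r α i, far i u τ := fun i => by
    rw [← intervalIntegral.integral_const_mul, ← intervalIntegral.integral_add
      (f := fun τ => ε / 2 * p i u τ) (hint i (continuousOn_const.mul (hpc i u hu'))) (hfari i)]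
    refine (intervalIntegral.abs_integral_le_integral_abs (hl i)).trans ?_
    refine intervalIntegral.integral_mono_on_of_le_Ioo (hl i)
      (hint i ((((hgc i).sub continuousOn_const).mul (hpc i u hu')).abs))
      ((hint i (continuousOn_const.mul (hpc i u hu'))).add (hfari i)) fun τ hτ => ?_
    have hnn : 0 ≤ p i u τ := re_pairKernel_side_nonneg hr0 hr1 hα i hτ hu'
    have hv := sidePt_mem hr0 hr1 hα i (Ioo_subset_Icc_self hτ)
    rw [abs_mul, abs_of_nonneg hnn]
    simp only [hfar]
    split_ifs with hd
    · nlinarith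
    · have := hgδ hv (by rw [dist_eq_norm]; exact not_le.1 hd)
      rw [Real.dist_eq] at this
      rw [add_zero]
      gcongr
  calc _ ≤ ∑ i, |∫ τ in (0 : ℝ)..sideLen r α i, (g (sidePt r α i τ) - g u₀) * p i u τ| :=
        Finset.abs_sum_le_sum_abs _ _
    _ ≤ _ := Finset.sum_le_sum fun i _ => hbound i
    _ < ε := by
        rw [Finset.sum_add_distrib, ← Finset.mul_sum, hmass u hu']
        linarith

end

section

/-! ### Weakly singular integrals -/

/-- In polar coordinates the integrand becomes y ^ (1 - q), integrable at the origin because 1 - q >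
-1. -/
lemma lintegral_ball_enorm_inv_rpow_lt_top {q : ℝ} (hq2 : q < 2) (R : ℝ) :
    ∫⁻ s in Metric.ball (0 : ℂ) R, ‖s⁻¹‖ₑ ^ q < ⊤ := by
  rcases le_or_gt R 0 with hR | hR
  · simp [Metric.ball_eq_empty.2 hR]
  have h1 : IntegrableOn (fun s : ℂ => ‖s‖ ^ (-q)) (Metric.ball (0 : ℂ) R) := by
    rw [integrableOn_fun_norm_addHaar (μ := (volume : Measure ℂ)) (f := fun y : ℝ => y ^ (-q))]
    have : IntegrableOn (fun y : ℝ => y ^ (1 - q)) (Ioo 0 R) := by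
      rw [intervalIntegral.integrableOn_Ioo_rpow_iff hR]
      linarith
    refine this.congr_fun (fun y hy => ?_) measurableSet_Ioo
    simp only [Complex.finrank_real_complex, smul_eq_mul]
    rw [sub_eq_add_neg, Real.rpow_add hy.1]
    norm_num
  have h2 := h1.2
  rw [hasFiniteIntegral_iff_enorm] at h2
  refine lt_of_le_of_lt (le_of_eq ?_) h2
  have hne : ∀ᵐ s ∂(volume.restrict (Metric.ball (0 : ℂ) R)), s ≠ 0 :=
    ae_restrict_of_ae (Measure.ae_ne volume 0)
  refine lintegral_congr_ae ?_
  filter_upwards [hne] with s hs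
  have hs' : 0 < ‖s‖ := norm_pos_iff.2 hs
  rw [← ofReal_norm, ← ofReal_norm, norm_inv, ENNReal.ofReal_rpow_of_pos (by positivity),
    Real.inv_rpow hs'.le, ← Real.rpow_neg hs'.le,
    Real.norm_of_nonneg (Real.rpow_nonneg hs'.le _)]

lemma exists_lintegral_ball_enorm_inv_rpow_lt {q : ℝ} (hq2 : q < 2) {ε : ENNReal} (hε : ε ≠ 0) :
    ∃ δ : ℝ, 0 < δ ∧ ∫⁻ s in Metric.ball (0 : ℂ) δ, ‖s⁻¹‖ₑ ^ q < ε := by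
  obtain ⟨δ', hδ', h⟩ := exists_pos_setLIntegral_lt_of_measure_lt
    (lintegral_ball_enorm_inv_rpow_lt_top hq2 1).ne hε
  have h1 : Tendsto (fun δ : ℝ => volume (Metric.ball (0 : ℂ) δ)) (𝓝[>] 0) (𝓝 0) := by
    have : Tendsto (fun δ : ℝ => ENNReal.ofReal δ ^ 2 * (NNReal.pi : ENNReal)) (𝓝 0)
        (𝓝 (ENNReal.ofReal 0 ^ 2 * (NNReal.pi : ENNReal))) := by
      refine ENNReal.Tendsto.mul_const ?_ (Or.inr ENNReal.coe_ne_top)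
      exact (ENNReal.continuous_pow 2).tendsto _ |>.comp (ENNReal.continuous_ofReal.tendsto 0)
    simp only [ENNReal.ofReal_zero, ne_eq, OfNat.ofNat_ne_zero, not_false_eq_true, zero_pow,
      zero_mul] at this
    simpa only [Complex.volume_ball] using this.mono_left nhdsWithin_le_nhds
  have h2 : ∀ᶠ δ : ℝ in 𝓝[>] 0, volume (Metric.ball (0 : ℂ) δ) < δ' :=
    h1.eventually (gt_mem_nhds hδ')
  have h3 : ∀ᶠ δ : ℝ in 𝓝[>] 0, δ < 1 :=
    eventually_nhdsWithin_of_eventually_nhds (gt_mem_nhds one_pos)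
  obtain ⟨δ, ⟨hd1, hd2⟩, hd3⟩ := ((h2.and h3).and self_mem_nhdsWithin).exists
  refine ⟨δ, hd3, ?_⟩
  have h4 := h (Metric.ball 0 δ) (lt_of_le_of_lt (Measure.restrict_apply_le _ _) hd1)
  rwa [Measure.restrict_restrict measurableSet_ball,
    inter_eq_self_of_subset_left (Metric.ball_subset_ball hd2.le)] at h4

variable {Ω : Set ℂ} {f : ℂ → ℂ} {p : ENNReal}

/-- The exponent p may be infinite. On a set of finite measure it can be replaced by min p 3, which
is finite and still above 2, so that its conjugate is below 2. -/
lemma memLp_real_exponent (hv : volume Ω ≠ ⊤) (hp : 2 < p)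
    (hf : MemLp f p (volume.restrict Ω)) :
    ∃ p₀ q : ℝ, p₀.HolderConjugate q ∧ q < 2 ∧ ∫⁻ ζ in Ω, ‖f ζ‖ₑ ^ p₀ < ⊤ := by
  have : IsFiniteMeasure (volume.restrict Ω) := ⟨by simpa using hv.lt_top⟩
  set p₁ : ENNReal := min p 3 with hp₁
  have h1 : MemLp f p₁ (volume.restrict Ω) := hf.mono_exponent (min_le_left _ _)
  have h2 : p₁ ≠ ⊤ := ((min_le_right p 3).trans_lt (by norm_num)).ne
  have h3 : 2 < p₁ := lt_min hp (by norm_num)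
  have h4 : 2 < p₁.toReal := by
    have := (ENNReal.toReal_lt_toReal (by norm_num) h2).2 h3
    simpa using this
  refine ⟨p₁.toReal, p₁.toReal.conjExponent, Real.HolderConjugate.conjExponent (by linarith),
    ?_, ?_⟩
  · rw [Real.conjExponent, div_lt_iff₀ (by linarith)]
    linarith
  · exact lintegral_rpow_enorm_lt_top_of_eLpNorm_lt_top (zero_lt_two.trans h3).ne' h2 h1.2

/-- Hölder's inequality separates f from the kernel, and translation makes the kernel factor
independent of z. -/
lemma lintegral_ball_div_le {p₀ q : ℝ} (hpq : p₀.HolderConjugate q)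
    (hfm : AEStronglyMeasurable f (volume.restrict Ω)) (z : ℂ) (δ : ℝ) :
    ∫⁻ ζ in Metric.ball z δ ∩ Ω, ‖f ζ / (ζ - z)‖ₑ ≤
      (∫⁻ ζ in Ω, ‖f ζ‖ₑ ^ p₀) ^ (1 / p₀) *
        (∫⁻ s in Metric.ball (0 : ℂ) δ, ‖s⁻¹‖ₑ ^ q) ^ (1 / q) := by
  have hm1 : AEMeasurable (fun ζ => ‖f ζ‖ₑ) (volume.restrict (Metric.ball z δ ∩ Ω)) :=
    (hfm.mono_measure (Measure.restrict_mono inter_subset_right le_rfl)).enorm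
  have hm2 : AEMeasurable (fun ζ : ℂ => ‖(ζ - z)⁻¹‖ₑ)
      (volume.restrict (Metric.ball z δ ∩ Ω)) := by fun_prop
  have h := ENNReal.lintegral_mul_le_Lp_mul_Lq _ hpq hm1 hm2
  simp only [Pi.mul_apply, ← enorm_mul, ← div_eq_mul_inv] at h
  refine h.trans ?_
  have hq := hpq.symm.nonneg
  have hp := hpq.nonneg
  refine mul_le_mul' (ENNReal.rpow_le_rpow (lintegral_mono_set inter_subset_right)
    (by positivity)) (ENNReal.rpow_le_rpow ?_ (by positivity))
  · calc ∫⁻ ζ in Metric.ball z δ ∩ Ω, ‖(ζ - z)⁻¹‖ₑ ^ q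
        ≤ ∫⁻ ζ in Metric.ball z δ, ‖(ζ - z)⁻¹‖ₑ ^ q := lintegral_mono_set inter_subset_left
      _ = ∫⁻ s in Metric.ball (0 : ℂ) δ, ‖s⁻¹‖ₑ ^ q := by
        rw [← lintegral_indicator measurableSet_ball, ← lintegral_indicator measurableSet_ball,
          ← lintegral_sub_right_eq_self
            ((Metric.ball (0 : ℂ) δ).indicator fun s => ‖s⁻¹‖ₑ ^ q) z]
        refine lintegral_congr fun ζ => ?_
        simp [indicator, Metric.mem_ball, dist_eq_norm]

/-- The uniformity of δ in z is the point: it takes the place of a dominating function when the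
singularity moves with the parameter. -/
lemma exists_lintegral_ball_div_le (hv : volume Ω ≠ ⊤) (hp : 2 < p)
    (hf : MemLp f p (volume.restrict Ω)) {ε : ENNReal} (hε : ε ≠ 0) :
    ∃ δ : ℝ, 0 < δ ∧ ∀ z, ∫⁻ ζ in Metric.ball z δ ∩ Ω, ‖f ζ / (ζ - z)‖ₑ ≤ ε := by
  obtain ⟨p₀, q, hpq, hq, hI⟩ := memLp_real_exponent hv hp hf
  set A := (∫⁻ ζ in Ω, ‖f ζ‖ₑ ^ p₀) ^ (1 / p₀) with hA
  have hAt : A ≠ ⊤ := ENNReal.rpow_ne_top_of_nonneg (by have := hpq.nonneg; positivity) hI.ne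
  have h1 : Tendsto (fun x : ENNReal => A * x ^ (1 / q)) (𝓝 0) (𝓝 (A * 0 ^ (1 / q))) :=
    ENNReal.Tendsto.const_mul (ENNReal.continuous_rpow_const.tendsto 0) (Or.inr hAt)
  rw [ENNReal.zero_rpow_of_pos (by have := hpq.symm.pos; positivity), mul_zero] at h1
  have h2 : ∀ᶠ x : ENNReal in 𝓝 0, A * x ^ (1 / q) < ε :=
    h1.eventually (gt_mem_nhds (pos_iff_ne_zero.2 hε))
  obtain ⟨η, hη, hη'⟩ := ENNReal.nhds_zero_basis.eventually_iff.1 h2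
  obtain ⟨δ, hδ, hδ'⟩ := exists_lintegral_ball_enorm_inv_rpow_lt hq (ne_of_gt hη)
  exact ⟨δ, hδ, fun z => (lintegral_ball_div_le hpq hf.1 z δ).trans (hη' hδ').le⟩

lemma lintegral_compl_ball_div_le (hΩ : MeasurableSet Ω) {δ : ℝ} (hδ : 0 < δ) (z : ℂ) :
    ∫⁻ ζ in (Metric.ball z δ)ᶜ ∩ Ω, ‖f ζ / (ζ - z)‖ₑ ≤
      ENNReal.ofReal δ⁻¹ * ∫⁻ ζ in Ω, ‖f ζ‖ₑ := by
  rw [← lintegral_const_mul' _ _ ENNReal.ofReal_ne_top]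
  refine le_trans (setLIntegral_mono' (measurableSet_ball.compl.inter hΩ) fun ζ hζ => ?_)
    (lintegral_mono_set inter_subset_right)
  have h1 : δ ≤ ‖ζ - z‖ := by simpa [dist_eq_norm] using hζ.1
  rw [div_eq_mul_inv, enorm_mul, mul_comm]
  gcongr
  rw [← ofReal_norm, norm_inv]
  exact ENNReal.ofReal_le_ofReal (inv_anti₀ hδ h1)

lemma exists_lintegral_div_le (hΩ : MeasurableSet Ω) (hv : volume Ω ≠ ⊤) (hp : 2 < p)
    (hf : MemLp f p (volume.restrict Ω)) :
    ∃ B : ENNReal, B ≠ ⊤ ∧ ∀ z, ∫⁻ ζ in Ω, ‖f ζ / (ζ - z)‖ₑ ≤ B := by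
  obtain ⟨δ, hδ, h⟩ := exists_lintegral_ball_div_le hv hp hf one_ne_zero
  have : IsFiniteMeasure (volume.restrict Ω) := ⟨by simpa using hv.lt_top⟩
  have hfi : Integrable f (volume.restrict Ω) := hf.integrable (one_le_two.trans hp.le)
  refine ⟨1 + ENNReal.ofReal δ⁻¹ * ∫⁻ ζ in Ω, ‖f ζ‖ₑ, ?_, fun z => ?_⟩
  · exact ENNReal.add_ne_top.2 ⟨ENNReal.one_ne_top,
      ENNReal.mul_ne_top ENNReal.ofReal_ne_top hfi.2.ne⟩
  · have hs : Ω = (Metric.ball z δ ∩ Ω) ∪ ((Metric.ball z δ)ᶜ ∩ Ω) := by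
      rw [← union_inter_distrib_right, union_compl_self, univ_inter]
    calc ∫⁻ ζ in Ω, ‖f ζ / (ζ - z)‖ₑ
        = ∫⁻ ζ in (Metric.ball z δ ∩ Ω) ∪ ((Metric.ball z δ)ᶜ ∩ Ω), ‖f ζ / (ζ - z)‖ₑ := by
          rw [← hs]
      _ ≤ _ := lintegral_union_le _ _ _
      _ ≤ _ := add_le_add (h z) (lintegral_compl_ball_div_le hΩ hδ z)

lemma integrableOn_div_sub (hΩ : MeasurableSet Ω) (hv : volume Ω ≠ ⊤) (hp : 2 < p)
    (hf : MemLp f p (volume.restrict Ω)) (z : ℂ) :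
    IntegrableOn (fun ζ => f ζ / (ζ - z)) Ω := by
  obtain ⟨B, hB, h⟩ := exists_lintegral_div_le hΩ hv hp hf
  refine ⟨?_, (h z).trans_lt hB.lt_top⟩
  have h1 : AEStronglyMeasurable (fun ζ : ℂ => (ζ - z)⁻¹) (volume.restrict Ω) := by
    exact Measurable.aestronglyMeasurable (by fun_prop)
  simp only [div_eq_mul_inv]
  exact hf.1.mul h1

lemma ae_ne_restrict (z : ℂ) : ∀ᵐ ζ ∂(volume.restrict Ω), ζ ≠ z :=
  ae_restrict_of_ae (Measure.ae_ne volume z)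

lemma integrableOn_of_norm_le_div (hΩ : MeasurableSet Ω) (hv : volume Ω ≠ ⊤) (hp : 2 < p)
    (hf : MemLp f p (volume.restrict Ω)) {C : ℝ} {z : ℂ} {g : ℂ → ℂ}
    (hg : AEStronglyMeasurable g (volume.restrict Ω))
    (h : ∀ ζ ∈ Ω, ζ ≠ z → ‖g ζ‖ ≤ C * ‖f ζ / (ζ - z)‖) : IntegrableOn g Ω := by
  refine ((integrableOn_div_sub hΩ hv hp hf z).norm.const_mul C).mono' hg ?_
  filter_upwards [ae_restrict_mem hΩ, ae_ne_restrict z] with ζ h1 h2 using h ζ h1 h2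

/-- Continuity of weakly singular integrals with respect to a parameter. -/
theorem tendsto_integral_of_norm_le_div (hΩ : MeasurableSet Ω) (hv : volume Ω ≠ ⊤) (hp : 2 < p)
    (hf : MemLp f p (volume.restrict Ω)) {ι : Type*} {l : Filter ι} [l.IsCountablyGenerated]
    {x : ι → ℂ} {t : ℂ} (hx : Tendsto x l (𝓝 t)) {F : ι → ℂ → ℂ} {F₀ : ℂ → ℂ} {C : ℝ}
    (hC : 0 ≤ C)
    (hm : ∀ᶠ i in l, AEStronglyMeasurable (F i) (volume.restrict Ω))
    (hb : ∀ᶠ i in l, ∀ ζ ∈ Ω, ζ ≠ x i → ‖F i ζ‖ ≤ C * ‖f ζ / (ζ - x i)‖)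
    (hF : ∀ ζ ∈ Ω, ζ ≠ t → Tendsto (fun i => F i ζ) l (𝓝 (F₀ ζ))) :
    Tendsto (fun i => ∫ ζ in Ω, F i ζ) l (𝓝 (∫ ζ in Ω, F₀ ζ)) := by
  rcases l.eq_or_neBot with rfl | hl
  · exact tendsto_bot
  have : IsFiniteMeasure (volume.restrict Ω) := ⟨by simpa using hv.lt_top⟩
  have hfi : Integrable f (volume.restrict Ω) := hf.integrable (one_le_two.trans hp.le)
  have hb₀ : ∀ ζ ∈ Ω, ζ ≠ t → ‖F₀ ζ‖ ≤ C * ‖f ζ / (ζ - t)‖ := by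
    intro ζ hζ hne
    have h1 : Tendsto (fun i => C * ‖f ζ / (ζ - x i)‖) l (𝓝 (C * ‖f ζ / (ζ - t)‖)) :=
      ((tendsto_const_nhds.div (tendsto_const_nhds.sub hx) (sub_ne_zero.2 hne)).norm).const_mul C
    refine le_of_tendsto_of_tendsto (hF ζ hζ hne).norm h1 ?_
    filter_upwards [hb, hx.eventually_ne hne.symm] with i h2 h3 using h2 ζ hζ h3.symm
  have hm₀ : AEStronglyMeasurable F₀ (volume.restrict Ω) := by
    obtain ⟨u, hu⟩ := exists_seq_tendsto l
    obtain ⟨N, hN⟩ := eventually_atTop.1 (hu.eventually hm)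
    refine aestronglyMeasurable_of_tendsto_ae (u := atTop) (f := fun k => F (u (k + N)))
      (fun k => hN _ (Nat.le_add_left _ _)) ?_
    filter_upwards [ae_restrict_mem hΩ, ae_ne_restrict t] with ζ h1 h2
    exact ((hF ζ h1 h2).comp hu).comp (tendsto_add_atTop_nat N)
  have hi₀ : IntegrableOn F₀ Ω := integrableOn_of_norm_le_div hΩ hv hp hf hm₀ hb₀
  have hi : ∀ᶠ i in l, IntegrableOn (F i) Ω := by
    filter_upwards [hm, hb] with i h1 h2 using integrableOn_of_norm_le_div hΩ hv hp hf h1 h2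
  rw [Metric.tendsto_nhds]
  intro ε hε
  -- The near parts of `F i` and of the limit and the difference of the far parts get ε/3 each. The
  -- 1 in C + 1 allows C = 0 and makes the inequality strict.
  obtain ⟨δ, hδ, hδ'⟩ := exists_lintegral_ball_div_le hv hp hf
    (ε := ENNReal.ofReal (ε / (3 * (C + 1)))) (by simpa using by positivity)
  -- the part near the singularity
  have hnear : ∀ (z : ℂ) (g : ℂ → ℂ), dist z t < δ / 2 →
      (∀ ζ ∈ Ω, ζ ≠ z → ‖g ζ‖ ≤ C * ‖f ζ / (ζ - z)‖) →
      ‖∫ ζ in Metric.ball t (δ / 2) ∩ Ω, g ζ‖ < ε / 3 := by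
    intro z g hz hg
    have h1 : ENNReal.ofReal ‖∫ ζ in Metric.ball t (δ / 2) ∩ Ω, g ζ‖ ≤
        ENNReal.ofReal (C * (ε / (3 * (C + 1)))) := by
      rw [ofReal_norm]
      calc ‖∫ ζ in Metric.ball t (δ / 2) ∩ Ω, g ζ‖ₑ
          ≤ ∫⁻ ζ in Metric.ball t (δ / 2) ∩ Ω, ‖g ζ‖ₑ := enorm_integral_le_lintegral_enorm _
        _ ≤ ∫⁻ ζ in Metric.ball t (δ / 2) ∩ Ω, ENNReal.ofReal C * ‖f ζ / (ζ - z)‖ₑ := by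
          refine lintegral_mono_ae ?_
          filter_upwards [ae_restrict_mem (measurableSet_ball.inter hΩ), ae_ne_restrict z]
            with ζ h1 h2
          rw [← ofReal_norm, ← ofReal_norm, ← ENNReal.ofReal_mul hC]
          exact ENNReal.ofReal_le_ofReal (hg ζ h1.2 h2)
        _ ≤ ∫⁻ ζ in Metric.ball z δ ∩ Ω, ENNReal.ofReal C * ‖f ζ / (ζ - z)‖ₑ := by
          refine lintegral_mono_set (inter_subset_inter_left _ (Metric.ball_subset_ball' ?_))
          rw [dist_comm]
          linarith
        _ ≤ ENNReal.ofReal C * ENNReal.ofReal (ε / (3 * (C + 1))) := by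
          rw [lintegral_const_mul' _ _ ENNReal.ofReal_ne_top]
          gcongr
          exact hδ' z
        _ = _ := (ENNReal.ofReal_mul hC).symm
    have h2 := (ENNReal.ofReal_le_ofReal_iff (by positivity)).1 h1
    refine h2.trans_lt ?_
    rw [mul_div_assoc', div_lt_div_iff₀ (by positivity) (by norm_num)]
    nlinarith
  -- the part away from the singularity
  have hfar : Tendsto (fun i => ∫ ζ in (Metric.ball t (δ / 2))ᶜ ∩ Ω, F i ζ) l
      (𝓝 (∫ ζ in (Metric.ball t (δ / 2))ᶜ ∩ Ω, F₀ ζ)) := by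
    have hsub : volume.restrict ((Metric.ball t (δ / 2))ᶜ ∩ Ω) ≤ volume.restrict Ω :=
      Measure.restrict_mono inter_subset_right le_rfl
    refine tendsto_integral_filter_of_dominated_convergence
      (fun ζ => C * (‖f ζ‖ * (δ / 4)⁻¹)) (hm.mono fun i h => h.mono_measure hsub) ?_
      (((hfi.mono_measure hsub).norm.mul_const _).const_mul _) ?_
    · filter_upwards [hb, hx.eventually (Metric.ball_mem_nhds t (ε := δ / 4) (by positivity))]
        with i h1 h2
      filter_upwards [ae_restrict_mem (measurableSet_ball.compl.inter hΩ)] with ζ h3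
      have h4 : δ / 2 ≤ dist ζ t := by simpa using h3.1
      have h5 : dist (x i) t < δ / 4 := h2
      have h6 : δ / 4 ≤ ‖ζ - x i‖ := by
        rw [← dist_eq_norm]
        linarith [dist_triangle ζ (x i) t]
      have h7 : ζ ≠ x i := by
        rintro rfl
        rw [sub_self, norm_zero] at h6
        linarith
      refine (h1 ζ h3.2 h7).trans ?_
      rw [norm_div, div_eq_mul_inv]
      gcongr
    · filter_upwards [ae_restrict_mem (measurableSet_ball.compl.inter hΩ)] with ζ h3
      refine hF ζ h3.2 ?_
      rintro rfl
      exact h3.1 (Metric.mem_ball_self (by positivity))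
  have hsplit : ∀ g : ℂ → ℂ, IntegrableOn g Ω → ∫ ζ in Ω, g ζ =
      (∫ ζ in Metric.ball t (δ / 2) ∩ Ω, g ζ) + ∫ ζ in (Metric.ball t (δ / 2))ᶜ ∩ Ω, g ζ := by
    intro g hg
    rw [inter_comm, inter_comm _ Ω, ← sdiff_eq, integral_inter_add_sdiff measurableSet_ball hg]
  filter_upwards [hi, hb, Metric.tendsto_nhds.1 hfar (ε / 3) (by positivity),
    hx.eventually (Metric.ball_mem_nhds t (ε := δ / 2) (by positivity))] with i h1 h2 h3 h4
  have h5 := hnear (x i) (F i) h4 h2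
  have h6 := hnear t F₀ (by rw [dist_self]; positivity) hb₀
  rw [dist_eq_norm] at h3 ⊢
  rw [hsplit _ h1, hsplit _ hi₀, add_sub_add_comm]
  refine (norm_add_le _ _).trans_lt ?_
  linarith [norm_sub_le (∫ ζ in Metric.ball t (δ / 2) ∩ Ω, F i ζ)
    (∫ ζ in Metric.ball t (δ / 2) ∩ Ω, F₀ ζ)]

end

section

/-! ### Test functions and the Cauchy kernel -/

section Test

variable {φ : ℂ → ℂ}

lemma continuous_dbar (hφ : ContDiff ℝ ∞ φ) : Continuous (dbar φ) := by
  have h := hφ.continuous_fderiv (by simp)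
  unfold dbar
  fun_prop

lemma hasCompactSupport_dbar (hc : HasCompactSupport φ) : HasCompactSupport (dbar φ) := by
  refine (hc.fderiv ℝ).mono fun z hz => ?_
  contrapose! hz
  simp only [Function.mem_support, ne_eq, not_not] at hz
  simp [dbar, hz]

lemma tsupport_dbar_subset : tsupport (dbar φ) ⊆ tsupport φ := by
  refine closure_minimal (fun z hz => ?_) (isClosed_tsupport φ)
  by_contra h
  have h1 : fderiv ℝ φ z = 0 := by
    by_contra h2
    exact h (support_fderiv_subset ℝ (Function.mem_support.2 h2))
  exact hz (by simp [dbar, h1])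

/-- Stokes' theorem in polar coordinates around the pole. -/
theorem integral_dbar_div_sub (hφ : ContDiff ℝ ∞ φ) (hc : HasCompactSupport φ) (ζ : ℂ) :
    ∫ z, dbar φ z / (z - ζ) = -(Real.pi : ℂ) * φ ζ := by
  have hd : ∀ z, DifferentiableAt ℝ φ z := fun z => hφ.differentiable (by simp) z
  have hcont := hφ.continuous_fderiv (by simp)
  set e : ℝ → ℂ := fun θ => Complex.exp (θ * Complex.I) with he
  have hec : Continuous e := by rw [he]; fun_prop
  set P : ℝ × ℝ → ℂ := fun x => ζ + x.1 * e x.2 with hP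
  have hPc : Continuous P := by rw [hP]; fun_prop
  -- A is the radial derivative and ρ B the angular one; the integrand times the Jacobian ρ is (A +
  -- iB)/2. Along every ray A integrates to -φ(ζ), and along every circle B integrates to zero by
  -- periodicity.
  set A : ℝ × ℝ → ℂ := fun x => fderiv ℝ φ (P x) (e x.2) with hA
  set B : ℝ × ℝ → ℂ := fun x => fderiv ℝ φ (P x) (Complex.I * e x.2) with hB
  have hAc : Continuous A := by rw [hA]; fun_prop
  have hBc : Continuous B := by rw [hB]; fun_prop
  obtain ⟨R, hR⟩ := hc.isCompact.isBounded.subset_ball ζ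
  have hzero : ∀ x : ℝ × ℝ, R ≤ |x.1| → P x ∉ tsupport φ := by
    intro x hx hm
    have h1 := hR hm
    rw [Metric.mem_ball, dist_eq_norm] at h1
    have h2 : ‖P x - ζ‖ = |x.1| := by
      simp [hP, he, Complex.norm_exp]
    linarith
  have hfz : ∀ x : ℝ × ℝ, R ≤ |x.1| → fderiv ℝ φ (P x) = 0 := by
    intro x hx
    by_contra h2
    exact hzero x hx (support_fderiv_subset ℝ (Function.mem_support.2 h2))
  have hint : ∀ G : ℝ × ℝ → ℂ, Continuous G → (∀ x : ℝ × ℝ, R ≤ |x.1| → G x = 0) →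
      IntegrableOn G (Ioi 0 ×ˢ Ioo (-Real.pi) Real.pi) := by
    intro G hG h0
    have h1 : IntegrableOn G (Icc 0 R ×ˢ Icc (-Real.pi) Real.pi) :=
      hG.continuousOn.integrableOn_compact (isCompact_Icc.prod isCompact_Icc)
    refine h1.of_forall_sdiff_eq_zero (measurableSet_Ioi.prod measurableSet_Ioo) ?_
    rintro ⟨x, y⟩ ⟨hx1, hx2⟩
    refine h0 _ ?_
    by_contra h3
    push Not at h3
    refine hx2 ⟨⟨le_of_lt hx1.1, ?_⟩, hx1.2.1.le, hx1.2.2.le⟩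
    exact (le_abs_self x).trans h3.le
  have hAi := hint A hAc fun x hx => by simp [hA, hfz x hx]
  have hBi := hint B hBc fun x hx => by simp [hB, hfz x hx]
  have hIA : ∫ x in Ioi (0 : ℝ) ×ˢ Ioo (-Real.pi) Real.pi, A x = -(2 * Real.pi : ℂ) * φ ζ := by
    have hAi' : Integrable A ((volume.restrict (Ioi (0 : ℝ))).prod
        (volume.restrict (Ioo (-Real.pi) Real.pi))) := by
      rwa [Measure.prod_restrict]
    have h1 : ∀ θ : ℝ, ∫ ρ in Ioi (0 : ℝ), A (ρ, θ) = -φ ζ := by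
      intro θ
      set ψ : ℝ → ℂ := fun ρ => φ (P (ρ, θ)) with hψ
      have h2 : ContDiff ℝ 1 ψ := by
        have : ContDiff ℝ 1 fun ρ : ℝ => P (ρ, θ) := by
          simp only [hP]
          have := Complex.ofRealCLM.contDiff (n := 1)
          exact contDiff_const.add (this.mul contDiff_const)
        exact (hφ.of_le (by simp)).comp this
      have h3 : HasCompactSupport ψ := by
        refine HasCompactSupport.intro (isCompact_Icc (a := -R) (b := R)) fun ρ hρ => ?_
        refine image_eq_zero_of_notMem_tsupport (f := φ) (hzero (ρ, θ) ?_)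
        by_contra h4
        push Not at h4
        exact hρ (abs_le.1 h4.le)
      have h4 : ∀ ρ, deriv ψ ρ = A (ρ, θ) := by
        intro ρ
        have h5 : HasDerivAt (fun ρ : ℝ => P (ρ, θ)) (e θ) ρ := by
          simpa [hP] using ((Complex.ofRealCLM.hasDerivAt (x := ρ)).mul_const (e θ)).const_add ζ
        exact ((hd _).hasFDerivAt.comp_hasDerivAt ρ h5).deriv
      simp only [← h4]
      rw [h3.integral_Ioi_deriv_eq h2]
      simp [hψ, hP]
    rw [Measure.volume_eq_prod, ← Measure.prod_restrict, integral_prod_symm _ hAi']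
    simp only [h1, integral_const, Measure.restrict_apply_univ, measureReal_def,
      Real.volume_Ioo]
    rw [ENNReal.toReal_ofReal (by linarith [Real.pi_pos])]
    rw [Complex.real_smul]
    push_cast
    ring
  have hIB : ∫ x in Ioi (0 : ℝ) ×ˢ Ioo (-Real.pi) Real.pi, B x = 0 := by
    rw [Measure.volume_eq_prod] at hBi ⊢
    rw [setIntegral_prod _ hBi]
    refine (setIntegral_congr_fun measurableSet_Ioi fun ρ (hρ : 0 < ρ) => ?_).trans
      (integral_zero _ _)
    have h1 : ∀ θ : ℝ, HasDerivAt (fun θ : ℝ => φ (P (ρ, θ))) ((ρ : ℂ) * B (ρ, θ)) θ := by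
      intro θ
      have h2 : HasDerivAt (fun θ : ℝ => P (ρ, θ)) (ρ • (Complex.I * e θ)) θ := by
        have h3 : HasDerivAt (fun θ : ℝ => (θ : ℂ) * Complex.I) Complex.I θ := by
          simpa using (Complex.ofRealCLM.hasDerivAt (x := θ)).mul_const Complex.I
        have h4 := (h3.cexp.const_mul (ρ : ℂ)).const_add ζ
        rw [Complex.real_smul, mul_comm Complex.I]
        exact h4
      have h3 := (hd _).hasFDerivAt.comp_hasDerivAt θ h2
      rwa [map_smul, Complex.real_smul] at h3
    have h2 : ∫ θ in (-Real.pi)..Real.pi, (ρ : ℂ) * B (ρ, θ) = 0 := by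
      rw [intervalIntegral.integral_eq_sub_of_hasDerivAt (fun θ _ => h1 θ)
        (Continuous.intervalIntegrable (by fun_prop) _ _), sub_eq_zero]
      simp [hP, he, Complex.exp_neg]
    rw [intervalIntegral.integral_const_mul, mul_eq_zero,
      intervalIntegral.integral_of_le (by linarith [Real.pi_pos]),
      integral_Ioc_eq_integral_Ioo] at h2
    exact h2.resolve_left (by exact_mod_cast hρ.ne')
  have h0 : ∫ z, dbar φ z / (z - ζ) = ∫ z, dbar φ (ζ + z) / z := by
    rw [← integral_add_left_eq_self _ ζ]
    simp
  rw [h0, ← Complex.integral_comp_polarCoord_symm]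
  have h1 : ∀ x ∈ Ioi (0 : ℝ) ×ˢ Ioo (-Real.pi) Real.pi,
      x.1 • (dbar φ (ζ + Complex.polarCoord.symm x) / Complex.polarCoord.symm x)
        = (1 / 2 : ℂ) * (A x + Complex.I * B x) := by
    rintro ⟨ρ, θ⟩ ⟨hρ, -⟩
    have hρ' : (ρ : ℂ) ≠ 0 := by exact_mod_cast (ne_of_gt hρ : ρ ≠ 0)
    have h2 : Complex.polarCoord.symm (ρ, θ) = ρ * e θ := by
      rw [Complex.polarCoord_symm_apply, he]
      simp only [Complex.exp_mul_I, Complex.ofReal_cos, Complex.ofReal_sin]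
    have h3 : e θ ≠ 0 := Complex.exp_ne_zero _
    have hlin : ∀ (L : ℂ →L[ℝ] ℂ) (a : ℂ), L a = a.re * L 1 + a.im * L Complex.I := by
      intro L a
      conv_lhs => rw [← Complex.re_add_im a, map_add, show (a.re : ℂ) = a.re • (1 : ℂ) by simp,
        show (a.im : ℂ) * Complex.I = a.im • Complex.I by simp, map_smul, map_smul]
      simp
    have he1 : e θ = (Real.cos θ : ℂ) + Real.sin θ * Complex.I := by
      rw [he]
      simp only [Complex.exp_mul_I, Complex.ofReal_cos, Complex.ofReal_sin]
    have hre : (e θ).re = Real.cos θ := by rw [he1]; simp [-Complex.ofReal_cos, -Complex.ofReal_sin]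
    have him : (e θ).im = Real.sin θ := by rw [he1]; simp [-Complex.ofReal_cos, -Complex.ofReal_sin]
    have hcs : (Real.cos θ : ℂ) ^ 2 + (Real.sin θ : ℂ) ^ 2 = 1 := by
      exact_mod_cast Real.cos_sq_add_sin_sq θ
    rw [h2, Complex.real_smul]
    simp only [hA, hB, hP, dbar]
    set L := fderiv ℝ φ (ζ + ρ * e θ)
    rw [hlin L (e θ), hlin L (Complex.I * e θ)]
    simp only [Complex.mul_re, Complex.mul_im, Complex.I_re, Complex.I_im, hre, him]
    rw [mul_div_assoc', div_eq_iff (mul_ne_zero hρ' h3), he1]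
    push_cast
    simp only [Complex.ofReal_cos, Complex.ofReal_sin] at hcs ⊢
    linear_combination (-(ρ : ℂ) / 2 * (L 1 + Complex.I * L Complex.I)) * hcs
      + (-(ρ : ℂ) / 2 * Complex.sin θ * Complex.cos θ * L Complex.I
        + (ρ : ℂ) / 2 * L 1 * Complex.sin θ ^ 2) * Complex.I_sq
  rw [polarCoord_target,
    setIntegral_congr_fun (measurableSet_Ioi.prod measurableSet_Ioo) h1, integral_const_mul,
    integral_add hAi (hBi.const_mul _), integral_const_mul, hIA, hIB]
  ring

lemma integrable_mul_of_tsupport_subset {Ω : Set ℂ} {h ψ : ℂ → ℂ} (hh : ContinuousOn h Ω)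
    (hψ : Continuous ψ) (hc : HasCompactSupport ψ) (hs : tsupport ψ ⊆ Ω) :
    Integrable (fun z => h z * ψ z) := by
  have h1 : IntegrableOn (fun z => h z * ψ z) (tsupport ψ) :=
    ((hh.mono hs).mul hψ.continuousOn).integrableOn_compact hc.isCompact
  refine (integrableOn_iff_integrable_of_support_subset fun z hz => ?_).1 h1
  by_contra h2
  exact hz (by simp [image_eq_zero_of_notMem_tsupport h2])

lemma setIntegral_mul_eq_integral {Ω : Set ℂ} {h ψ : ℂ → ℂ} (hs : tsupport ψ ⊆ Ω) :
    ∫ z in Ω, h z * ψ z = ∫ z, h z * ψ z := by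
  refine setIntegral_eq_integral_of_forall_compl_eq_zero fun z hz => ?_
  simp [image_eq_zero_of_notMem_tsupport fun h => hz (hs h)]

/-- Integration by parts in the directions 1 and i. For holomorphic h the derivative in the
direction i is i times the one in the direction 1, so the two contributions cancel through 1 + i² =
0. -/
lemma integral_mul_dbar_of_differentiableOn {Ω : Set ℂ} (hΩ : IsOpen Ω) {h : ℂ → ℂ}
    (hh : DifferentiableOn ℂ h Ω) (hφ : ContDiff ℝ ∞ φ) (hc : HasCompactSupport φ)
    (hs : tsupport φ ⊆ Ω) : ∫ z, h z * dbar φ z = 0 := by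
  have hcf := hφ.continuous_fderiv (by simp)
  have hsub : ∀ v : ℂ, tsupport (fun z => fderiv ℝ φ z v) ⊆ tsupport φ := fun v =>
    tsupport_fderiv_apply_subset ℝ v
  have hcv : ∀ v : ℂ, HasCompactSupport fun z => fderiv ℝ φ z v := fun v =>
    hc.fderiv_apply ℝ v
  have hfd : ∀ z ∈ Ω, HasFDerivAt h ((ContinuousLinearMap.toSpanSingleton ℂ
      (deriv h z)).restrictScalars ℝ) z := fun z hz =>
    (hh.differentiableAt (hΩ.mem_nhds hz)).hasDerivAt.hasFDerivAt.restrictScalars ℝ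
  have hdc : ContinuousOn (deriv h) Ω := (hh.deriv hΩ).continuousOn
  have key : ∀ v : ℂ, ∫ z, h z * fderiv ℝ φ z v = -(v * ∫ z, deriv h z * φ z) := by
    intro v
    have hv : ∀ z ∈ tsupport φ, fderiv ℝ h z v = v * deriv h z := fun z hz => by
      rw [(hfd z (hs hz)).fderiv]
      simp
    have h0 : (fun z => fderiv ℝ h z v * φ z) = fun z => v * (deriv h z * φ z) := by
      funext z
      by_cases hz : z ∈ tsupport φ
      · rw [hv z hz, mul_assoc]
      · simp [image_eq_zero_of_notMem_tsupport hz]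
    rw [integral_mul_fderiv_eq_neg_fderiv_mul_of_integrable, h0, integral_const_mul]
    · rw [h0]
      exact (integrable_mul_of_tsupport_subset hdc hφ.continuous hc hs).const_mul v
    · exact integrable_mul_of_tsupport_subset hh.continuousOn (by fun_prop) (hcv v)
        ((hsub v).trans hs)
    · exact integrable_mul_of_tsupport_subset hh.continuousOn hφ.continuous hc hs
    · exact fun z hz => (hfd z (hs hz)).differentiableAt
    · exact fun z _ => hφ.differentiable (by simp) z
  have hi : ∀ v : ℂ, Integrable fun z => h z * fderiv ℝ φ z v := fun v =>
    integrable_mul_of_tsupport_subset hh.continuousOn (by fun_prop) (hcv v) ((hsub v).trans hs)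
  have e : ∀ z, h z * dbar φ z = (1 / 2 : ℂ) * (h z * fderiv ℝ φ z 1
      + Complex.I * (h z * fderiv ℝ φ z Complex.I)) := fun z => by
    rw [dbar]
    ring
  simp only [e]
  rw [integral_const_mul, integral_add (hi 1) ((hi _).const_mul _), integral_const_mul, key, key]
  linear_combination (1 / 2 * (-∫ z, deriv h z * φ z)) * Complex.I_sq

/-- The Cauchy–Pompeiu formula for a compactly supported function and a function with a simple
pole. -/
theorem setIntegral_mul_dbar_of_simplePole {Ω : Set ℂ} (hΩ : IsOpen Ω) {g : ℂ → ℂ} {ζ a : ℂ}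
    (hζ : ζ ∈ Ω) (hg : DifferentiableOn ℂ g (Ω \ {ζ}))
    (ha : Tendsto (fun z => (z - ζ) * g z) (𝓝[≠] ζ) (𝓝 a))
    (hφ : ContDiff ℝ ∞ φ) (hc : HasCompactSupport φ) (hs : tsupport φ ⊆ Ω) :
    ∫ z in Ω, g z * dbar φ z = -(Real.pi : ℂ) * a * φ ζ := by
  obtain ⟨h, hh, he⟩ := exists_differentiableOn_of_simplePole hΩ hζ hg ha
  have hs' := (tsupport_dbar_subset (φ := φ)).trans hs
  rw [setIntegral_mul_eq_integral hs']
  have e : (fun z => g z * dbar φ z) =ᵐ[volume]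
      fun z => a * (dbar φ z / (z - ζ)) + h z * dbar φ z := by
    filter_upwards [Measure.ae_ne volume ζ] with z hz
    rw [he z hz]
    ring
  have hi : Integrable fun z => dbar φ z / (z - ζ) := by
    have h1 : Integrable (fun z => (z - ζ)⁻¹ * dbar φ z) := by
      obtain ⟨M, hM⟩ := (continuous_dbar hφ).bounded_above_of_compact_support
        (hasCompactSupport_dbar hc)
      have hK := (hasCompactSupport_dbar hc).isCompact
      have h2 : IntegrableOn (fun z : ℂ => (1 : ℂ) / (z - ζ)) (tsupport (dbar φ)) := by
        refine integrableOn_div_sub (f := fun _ => 1) (p := ⊤) hK.measurableSet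
          hK.measure_lt_top.ne (by simp) ?_ ζ
        have : IsFiniteMeasure (volume.restrict (tsupport (dbar φ))) :=
          ⟨by simpa using hK.measure_lt_top⟩
        exact memLp_const 1
      have h3 : IntegrableOn (fun z => (z - ζ)⁻¹ * dbar φ z) (tsupport (dbar φ)) := by
        simp only [one_div] at h2
        exact Integrable.mul_bdd (c := M) h2 (continuous_dbar hφ).aestronglyMeasurable
          (Eventually.of_forall hM)
      refine (integrableOn_iff_integrable_of_support_subset fun z hz => ?_).1 h3
      by_contra h4
      exact hz (by simp [image_eq_zero_of_notMem_tsupport h4])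
    simpa only [div_eq_mul_inv, mul_comm] using h1
  rw [integral_congr_ae e, integral_add (hi.const_mul a)
    (integrable_mul_of_tsupport_subset hh.continuousOn (continuous_dbar hφ)
      (hasCompactSupport_dbar hc) hs'), integral_const_mul, integral_dbar_div_sub hφ hc,
    integral_mul_dbar_of_differentiableOn hΩ hh hφ hc hs]
  ring

end Test

end

section

/-! ### Potentials of Cauchy type kernels -/

lemma twoRe_eq (z ζ : ℂ) : twoRe z ζ = ((2 * (ζ.re - z.re) : ℝ) : ℂ) := by
  rw [twoRe, Complex.add_conj]
  simp

lemma norm_twoRe_le (z ζ : ℂ) : ‖twoRe z ζ‖ ≤ 2 * ‖ζ - z‖ := by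
  rw [twoRe_eq, Complex.norm_real, Real.norm_eq_abs, abs_mul, abs_two, ← Complex.sub_re]
  gcongr
  exact Complex.abs_re_le_norm _

lemma norm_twoRe_le_four {Ω : Set ℂ} (hb : Ω ⊆ Metric.ball 0 1) {z ζ : ℂ} (hz : z ∈ Ω)
    (hζ : ζ ∈ Ω) : ‖twoRe z ζ‖ ≤ 4 := by
  have h1 : ‖z‖ < 1 := by simpa using hb hz
  have h2 : ‖ζ‖ < 1 := by simpa using hb hζ
  linarith [norm_twoRe_le z ζ, norm_sub_le ζ z]

lemma continuous_twoRe : Continuous fun p : ℂ × ℂ => twoRe p.1 p.2 := by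
  unfold twoRe
  exact (continuous_snd.sub continuous_fst).add
    (Complex.continuous_conj.comp (continuous_snd.sub continuous_fst))

lemma hasFDerivAt_twoRe (z ζ : ℂ) :
    HasFDerivAt (fun z => twoRe z ζ) ((-2 : ℝ) • Complex.ofRealCLM.comp Complex.reCLM) z := by
  have h1 : (fun z => twoRe z ζ)
      = fun z => ((2 * ζ.re : ℝ) : ℂ) + ((-2 : ℝ) • Complex.ofRealCLM.comp Complex.reCLM) z := by
    funext z
    rw [twoRe_eq]
    simp
    ring
  rw [h1]
  exact (ContinuousLinearMap.hasFDerivAt _).const_add _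

lemma norm_twoRe_sub_le (x z ζ : ℂ) : ‖twoRe x ζ - twoRe z ζ‖ ≤ 2 * ‖x - z‖ := by
  have : twoRe x ζ - twoRe z ζ = twoRe x z := by
    simp only [twoRe_eq]
    push_cast
    ring
  rw [this, norm_sub_rev]
  exact norm_twoRe_le x z

lemma norm_twoRe_pow_sub_le {Ω : Set ℂ} (hb : Ω ⊆ Metric.ball 0 1) {x z ζ : ℂ} (hx : x ∈ Ω)
    (hz : z ∈ Ω) (hζ : ζ ∈ Ω) (j : ℕ) :
    ‖twoRe x ζ ^ (j + 1) - twoRe z ζ ^ (j + 1)‖ ≤ 2 * ‖x - z‖ * ((j + 1) * 4 ^ j) := by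
  have h1 := norm_twoRe_le_four hb hx hζ
  have h2 := norm_twoRe_le_four hb hz hζ
  have h3 := norm_twoRe_sub_le x z ζ
  rw [twoRe_eq x ζ, twoRe_eq z ζ] at *
  rw [← Complex.ofReal_sub, Complex.norm_real] at h3
  rw [Complex.norm_real] at h1 h2
  rw [← Complex.ofReal_pow, ← Complex.ofReal_pow, ← Complex.ofReal_sub, Complex.norm_real]
  simp only [Real.norm_eq_abs] at *
  refine (abs_pow_sub_pow_le _ _ _).trans ?_
  rw [Nat.add_sub_cancel, mul_assoc]
  push_cast
  gcongr
  exact max_le h1 h2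

/-- Kernels with the singularity of `f ζ / (ζ - z)`, holomorphic in `z`, and with vanishing real
part on the boundary. -/
structure IsCauchyKernel (Ω : Set ℂ) (f : ℂ → ℂ) (C : ℝ) (K : ℂ → ℂ → ℂ) : Prop where
  nonneg : 0 ≤ C
  norm_le : ∀ z ∈ Ω, ∀ ζ ∈ Ω, ζ ≠ z → ‖K z ζ‖ ≤ C * ‖f ζ / (ζ - z)‖
  measurable : ∀ z, AEStronglyMeasurable (K z) (volume.restrict Ω)
  measurable_prod : AEStronglyMeasurable (Function.uncurry K)
    ((volume.restrict Ω).prod (volume.restrict Ω))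
  differentiableOn : ∀ ζ ∈ Ω, DifferentiableOn ℂ (fun z => K z ζ) (Ω \ {ζ})
  residue : ∀ ζ ∈ Ω, Tendsto (fun z => (z - ζ) * K z ζ) (𝓝[≠] ζ) (𝓝 (-f ζ))
  boundary : ∀ t ∈ frontier Ω, ∀ ζ ∈ Ω, Tendsto (fun z => (K z ζ).re) (𝓝[Ω] t) (𝓝 0)

/-- The potential with weight `(2 Re (ζ - z)) ^ j`. -/
def potential (Ω : Set ℂ) (K : ℂ → ℂ → ℂ) (j : ℕ) (z : ℂ) : ℂ :=
  ∫ ζ in Ω, twoRe z ζ ^ j * K z ζ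

section Potential

variable {Ω : Set ℂ} {f : ℂ → ℂ} {p : ENNReal} {C : ℝ} {K : ℂ → ℂ → ℂ}

lemma volume_ne_top_of_subset_ball (hb : Ω ⊆ Metric.ball 0 1) : volume Ω ≠ ⊤ :=
  ((measure_mono hb).trans_lt measure_ball_lt_top).ne

namespace IsCauchyKernel

lemma norm_weighted_le (hK : IsCauchyKernel Ω f C K) (hb : Ω ⊆ Metric.ball 0 1) (j : ℕ)
    {z ζ : ℂ} (hz : z ∈ Ω) (hζ : ζ ∈ Ω) (h : ζ ≠ z) :
    ‖twoRe z ζ ^ j * K z ζ‖ ≤ 4 ^ j * C * ‖f ζ / (ζ - z)‖ := by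
  rw [norm_mul, norm_pow, mul_assoc]
  gcongr
  · exact norm_twoRe_le_four hb hz hζ
  · exact hK.norm_le z hz ζ hζ h

lemma measurable_weighted (hK : IsCauchyKernel Ω f C K) (j : ℕ) (z : ℂ) :
    AEStronglyMeasurable (fun ζ => twoRe z ζ ^ j * K z ζ) (volume.restrict Ω) :=
  ((continuous_twoRe.comp (Continuous.prodMk_right z)).pow j).aestronglyMeasurable.mul
    (hK.measurable z)

lemma integrableOn_weighted (hK : IsCauchyKernel Ω f C K) (hΩ : IsOpen Ω)
    (hb : Ω ⊆ Metric.ball 0 1) (hp : 2 < p) (hf : MemLp f p (volume.restrict Ω)) (j : ℕ)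
    {z : ℂ} (hz : z ∈ Ω) : IntegrableOn (fun ζ => twoRe z ζ ^ j * K z ζ) Ω :=
  integrableOn_of_norm_le_div hΩ.measurableSet (volume_ne_top_of_subset_ball hb) hp hf
    (hK.measurable_weighted j z) fun _ hζ h => hK.norm_weighted_le hb j hz hζ h

lemma differentiableAt (hK : IsCauchyKernel Ω f C K) (hΩ : IsOpen Ω) {z ζ : ℂ} (hz : z ∈ Ω)
    (hζ : ζ ∈ Ω) (h : ζ ≠ z) : DifferentiableAt ℂ (fun z => K z ζ) z :=
  (hK.differentiableOn ζ hζ).differentiableAt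
    ((hΩ.sdiff isClosed_singleton).mem_nhds ⟨hz, fun h' => h (h' : z = ζ).symm⟩)

theorem continuousOn_potential (hK : IsCauchyKernel Ω f C K) (hΩ : IsOpen Ω)
    (hb : Ω ⊆ Metric.ball 0 1) (hp : 2 < p) (hf : MemLp f p (volume.restrict Ω)) (j : ℕ) :
    ContinuousOn (potential Ω K j) Ω := by
  intro z hz
  refine ContinuousAt.continuousWithinAt ?_
  refine tendsto_integral_of_norm_le_div hΩ.measurableSet (volume_ne_top_of_subset_ball hb) hp hf
    tendsto_id (mul_nonneg (pow_nonneg (by norm_num : (0 : ℝ) ≤ 4) j) hK.nonneg)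
    (Eventually.of_forall fun x => hK.measurable_weighted j x) ?_ fun ζ hζ h => ?_
  · filter_upwards [hΩ.mem_nhds hz] with x hx ζ hζ h using hK.norm_weighted_le hb j hx hζ h
  · exact (((continuous_twoRe.comp (Continuous.prodMk_left ζ)).pow j).tendsto z).mul
      (hK.differentiableAt hΩ hz hζ h).continuousAt

/-- The weight is real, so the real part passes to K alone. The integrands tend to zero pointwise,
and the convergence theorem for weakly singular integrals carries this to the integral. -/
theorem tendsto_re_potential (hK : IsCauchyKernel Ω f C K) (hΩ : IsOpen Ω)
    (hb : Ω ⊆ Metric.ball 0 1) (hp : 2 < p) (hf : MemLp f p (volume.restrict Ω)) (j : ℕ)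
    {t : ℂ} (ht : t ∈ frontier Ω) :
    Tendsto (fun z => (potential Ω K j z).re) (𝓝[Ω] t) (𝓝 0) := by
  have key : Tendsto (fun z => ∫ ζ in Ω, (((twoRe z ζ ^ j * K z ζ).re : ℝ) : ℂ)) (𝓝[Ω] t)
      (𝓝 (∫ ζ in Ω, (0 : ℂ))) := by
    refine tendsto_integral_of_norm_le_div hΩ.measurableSet (volume_ne_top_of_subset_ball hb) hp hf
      (x := id) (t := t) (tendsto_id.mono_left nhdsWithin_le_nhds)
      (mul_nonneg (pow_nonneg (by norm_num : (0 : ℝ) ≤ 4) j) hK.nonneg)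
      (Eventually.of_forall fun x => ?_) ?_ fun ζ hζ h => ?_
    · exact (Complex.continuous_ofReal.comp Complex.continuous_re).comp_aestronglyMeasurable
        (hK.measurable_weighted j x)
    · filter_upwards [self_mem_nhdsWithin] with x hx ζ hζ h
      refine le_trans ?_ (hK.norm_weighted_le hb j hx hζ h)
      rw [Complex.norm_real]
      exact Complex.abs_re_le_norm _
    · have h1 : ∀ z, (twoRe z ζ ^ j * K z ζ).re = (2 * (ζ.re - z.re)) ^ j * (K z ζ).re := by
        intro z
        rw [twoRe_eq, ← Complex.ofReal_pow, Complex.re_ofReal_mul]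
      have h2 : Tendsto (fun z : ℂ => (2 * (ζ.re - z.re)) ^ j) (𝓝[Ω] t)
          (𝓝 ((2 * (ζ.re - t.re)) ^ j)) := by
        refine Tendsto.mono_left (Continuous.tendsto ?_ t) nhdsWithin_le_nhds
        have := Complex.continuous_re
        fun_prop
      have h3 := h2.mul (hK.boundary t ht ζ hζ)
      rw [mul_zero] at h3
      have h4 := (Complex.continuous_ofReal.tendsto 0).comp h3
      simp only [h1]
      exact h4
  rw [integral_zero] at key
  have h2 := (Complex.continuous_re.tendsto 0).comp key
  rw [Complex.zero_re] at h2
  refine h2.congr' ?_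
  filter_upwards [self_mem_nhdsWithin] with z hz
  have hi := hK.integrableOn_weighted hΩ hb hp hf j hz
  simp only [Function.comp_apply, potential]
  have h5 : ∫ ζ in Ω, (((twoRe z ζ ^ j * K z ζ).re : ℝ) : ℂ)
      = ((∫ ζ in Ω, (twoRe z ζ ^ j * K z ζ).re : ℝ) : ℂ) := integral_ofReal
  rw [h5, Complex.ofReal_re]
  exact integral_re hi

/-- The weight vanishes at ζ = z, which compensates one order of the singularity of the derivative
of K; without this factor the bound would be of order |ζ - z|⁻², beyond local integrability. When x
is at least a quarter of |ζ - z| away from z, both values are simply bounded by multiples of |f ζ|;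
otherwise the increments of weight and kernel are estimated separately. -/
lemma exists_lipschitz_weighted (hK : IsCauchyKernel Ω f C K) (hΩ : IsOpen Ω)
    (hb : Ω ⊆ Metric.ball 0 1) (j : ℕ) {z : ℂ} (hz : z ∈ Ω) :
    ∃ ε : ℝ, 0 < ε ∧ Metric.ball z ε ⊆ Ω ∧ ∃ L : ℝ, ∀ ζ ∈ Ω, ζ ≠ z → ∀ x ∈ Metric.ball z ε,
      ‖twoRe x ζ ^ (j + 1) * K x ζ - twoRe z ζ ^ (j + 1) * K z ζ‖
        ≤ L * ‖f ζ / (ζ - z)‖ * ‖x - z‖ := by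
  obtain ⟨ε₀, hε₀, hball⟩ := Metric.isOpen_iff.1 hΩ z hz
  set ε := min ε₀ 1 with hε
  have hεpos : 0 < ε := lt_min hε₀ one_pos
  have hε1 : ε ≤ 1 := min_le_right _ _
  have hsub : Metric.ball z ε ⊆ Ω := (Metric.ball_subset_ball (min_le_left _ _)).trans hball
  have hC := hK.nonneg
  -- The three summands belong to distant x, to the increment of the weight, and to the increment of
  -- the kernel.
  refine ⟨ε, hεpos, hsub, 16 * 4 ^ j * C + 4 * (j + 1) * 4 ^ j * C + 32 * 4 ^ j * C / ε, ?_⟩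
  intro ζ hζ hne x hx
  set d := ‖ζ - z‖ with hd
  have hdpos : 0 < d := norm_pos_iff.2 (sub_ne_zero.2 hne)
  have hd2 : d ≤ 2 := by
    have h1 : ‖z‖ < 1 := by simpa using hb hz
    have h2 : ‖ζ‖ < 1 := by simpa using hb hζ
    linarith [norm_sub_le ζ z]
  set e := ‖x - z‖ with he
  have he0 : 0 ≤ e := norm_nonneg _
  rw [norm_div, ← hd]
  set N := ‖f ζ‖ with hN
  have hN0 : 0 ≤ N := norm_nonneg _
  have hfirst : ∀ y ∈ Ω, ‖twoRe y ζ ^ (j + 1) * K y ζ‖ ≤ 2 * 4 ^ j * C * N := by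
    intro y hy
    rcases eq_or_ne ζ y with rfl | hy'
    · simp only [twoRe_eq, sub_self, mul_zero, Complex.ofReal_zero, ne_eq, Nat.succ_ne_zero,
        not_false_eq_true, zero_pow, zero_mul, norm_zero]
      positivity
    · have h1 := hK.norm_le y hy ζ hζ hy'
      have h2 : 0 < ‖ζ - y‖ := norm_pos_iff.2 (sub_ne_zero.2 hy')
      rw [norm_mul, norm_pow, pow_succ]
      calc ‖twoRe y ζ‖ ^ j * ‖twoRe y ζ‖ * ‖K y ζ‖
          ≤ 4 ^ j * (2 * ‖ζ - y‖) * (C * ‖f ζ / (ζ - y)‖) := by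
            gcongr
            · exact norm_twoRe_le_four hb hy hζ
            · exact norm_twoRe_le y ζ
        _ = 2 * 4 ^ j * C * N := by
            rw [norm_div, hN]
            field_simp
  rcases le_or_gt (d / 4) e with hcase | hcase
  · calc ‖twoRe x ζ ^ (j + 1) * K x ζ - twoRe z ζ ^ (j + 1) * K z ζ‖
        ≤ 2 * 4 ^ j * C * N + 2 * 4 ^ j * C * N :=
          (norm_sub_le _ _).trans (add_le_add (hfirst x (hsub hx)) (hfirst z hz))
      _ = 16 * 4 ^ j * C * (N / d) * (d / 4) := by
          field_simp
          ring
      _ ≤ 16 * 4 ^ j * C * (N / d) * e := by gcongr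
      _ ≤ _ := by
          gcongr
          have : 0 ≤ 4 * (j + 1) * 4 ^ j * C + 32 * 4 ^ j * C / ε := by positivity
          linarith
  -- On a ball of this radius the kernel is bounded and holomorphic: ε ≤ 1 keeps it away from ζ, and
  -- d ≤ 2 keeps it inside Ω.
  · set ρ := ε * d / 4 with hρ
    have hρpos : 0 < ρ := by positivity
    have hρd : ρ ≤ d / 4 := by rw [hρ]; nlinarith
    have hρε : ρ ≤ ε := by rw [hρ]; nlinarith
    have hne' : ∀ y ∈ Metric.ball z (d / 4), 3 / 4 * d ≤ ‖ζ - y‖ := by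
      intro y hy
      rw [Metric.mem_ball, dist_eq_norm] at hy
      have : ζ - z = (ζ - y) + (y - z) := by ring
      have h2 := norm_add_le (ζ - y) (y - z)
      rw [← this] at h2
      linarith
    have hKy : ∀ y ∈ Ω, y ∈ Metric.ball z (d / 4) → ‖K y ζ‖ ≤ 2 * C * (N / d) := by
      intro y hy hy'
      have h1 := hne' y hy'
      have h2 : ζ ≠ y := by
        rintro rfl
        rw [sub_self, norm_zero] at h1
        linarith
      refine (hK.norm_le y hy ζ hζ h2).trans ?_
      rw [norm_div]
      calc C * (‖f ζ‖ / ‖ζ - y‖) ≤ C * (N / (d / 2)) := by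
            gcongr
            linarith
        _ = 2 * C * (N / d) := by
            field_simp
    have hKsub : ‖K x ζ - K z ζ‖ ≤ 16 * C / ε * (N / d) * e / d := by
      rcases le_or_gt ρ e with hc2 | hc2
      · calc ‖K x ζ - K z ζ‖ ≤ 2 * C * (N / d) + 2 * C * (N / d) :=
            (norm_sub_le _ _).trans (add_le_add
              (hKy x (hsub hx) (by rw [Metric.mem_ball, dist_eq_norm]; exact hcase))
              (hKy z hz (Metric.mem_ball_self (by positivity))))
          _ = 16 * C / ε * (N / d) * ρ / d := by
              rw [hρ]
              field_simp
              ring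
          _ ≤ _ := by gcongr
      · have h1 := norm_sub_le_of_bounded_holomorphic (g := fun y => K y ζ) (z₀ := z) (ε := ρ)
          (B := 2 * C * (N / d)) (z := x) (fun y hy => ?_) (fun y hy => ?_) (by
            rw [Metric.mem_ball, dist_eq_norm]; exact hc2)
        · refine h1.trans (le_of_eq ?_)
          rw [hρ]
          field_simp
          ring
        · refine (hK.differentiableAt hΩ (hsub (Metric.ball_subset_ball hρε hy)) hζ ?_
            ).differentiableWithinAt
          rintro rfl
          have := hne' ζ (Metric.ball_subset_ball hρd hy)
          rw [sub_self, norm_zero] at this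
          linarith
        · exact hKy y (hsub (Metric.ball_subset_ball hρε hy)) (Metric.ball_subset_ball hρd hy)
    have hx' : x ∈ Metric.ball z (d / 4) := by
      rw [Metric.mem_ball, dist_eq_norm]
      exact hcase
    have hsplit : twoRe x ζ ^ (j + 1) * K x ζ - twoRe z ζ ^ (j + 1) * K z ζ
        = (twoRe x ζ ^ (j + 1) - twoRe z ζ ^ (j + 1)) * K x ζ
          + twoRe z ζ ^ (j + 1) * (K x ζ - K z ζ) := by ring
    rw [hsplit]
    have h2 : ‖twoRe z ζ ^ (j + 1)‖ ≤ 4 ^ j * (2 * d) := by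
      rw [norm_pow, pow_succ]
      gcongr
      · exact norm_twoRe_le_four hb hz hζ
      · exact norm_twoRe_le z ζ
    calc ‖(twoRe x ζ ^ (j + 1) - twoRe z ζ ^ (j + 1)) * K x ζ
          + twoRe z ζ ^ (j + 1) * (K x ζ - K z ζ)‖
        ≤ 2 * e * ((j + 1) * 4 ^ j) * (2 * C * (N / d))
          + 4 ^ j * (2 * d) * (16 * C / ε * (N / d) * e / d) := by
          refine (norm_add_le _ _).trans ?_
          rw [norm_mul, norm_mul]
          gcongr
          · exact norm_twoRe_pow_sub_le hb (hsub hx) hz hζ j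
          · exact hKy x (hsub hx) hx'
      _ = (4 * (j + 1) * 4 ^ j * C + 32 * 4 ^ j * C / ε) * (N / d) * e := by
          field_simp
          ring
      _ ≤ _ := by
          gcongr
          have : 0 ≤ 16 * 4 ^ j * C := by positivity
          linarith

/-- The kernel is holomorphic in z, so ∂/∂z̄ acts on the weight alone, and `twoRe z ζ` has
z̄-derivative -1. The Lipschitz bound supplies the domination. -/
theorem hasFDerivAt_potential (hK : IsCauchyKernel Ω f C K) (hΩ : IsOpen Ω)
    (hb : Ω ⊆ Metric.ball 0 1) (hp : 2 < p) (hf : MemLp f p (volume.restrict Ω)) (j : ℕ)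
    {z : ℂ} (hz : z ∈ Ω) :
    ∃ L : ℂ →L[ℝ] ℂ, HasFDerivAt (potential Ω K (j + 1)) L z ∧
      (1 / 2 : ℂ) * (L 1 + Complex.I * L Complex.I) = -((j + 1 : ℕ) : ℂ) * potential Ω K j z := by
  obtain ⟨ε, hε, hsub, L, hL⟩ := hK.exists_lipschitz_weighted hΩ hb j hz
  -- The real derivative of the integrand is a complex linear part with factor a, invisible to
  -- ∂/∂z̄, plus a multiple b of the real part.
  set a : ℂ → ℂ := fun ζ => twoRe z ζ ^ (j + 1) * deriv (fun z => K z ζ) z with ha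
  set b : ℂ → ℂ := fun ζ => (-2 * ((j + 1 : ℕ) : ℂ)) * (twoRe z ζ ^ j * K z ζ) with hb'
  set R : ℂ →L[ℝ] ℂ := Complex.ofRealCLM.comp Complex.reCLM with hR
  set F' : ℂ → ℂ →L[ℝ] ℂ := fun ζ => a ζ • ContinuousLinearMap.id ℝ ℂ + b ζ • R with hF'
  have hmem : ∀ᵐ ζ ∂(volume.restrict Ω), ζ ∈ Ω ∧ ζ ≠ z := by
    filter_upwards [ae_restrict_mem hΩ.measurableSet, ae_ne_restrict z] with ζ h1 h2
      using ⟨h1, h2⟩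
  have hmd : AEStronglyMeasurable (fun ζ => deriv (fun z => K z ζ) z) (volume.restrict Ω) := by
    refine aestronglyMeasurable_deriv_param (k := K) hε (fun x _ => hK.measurable x) ?_
    filter_upwards [hmem] with ζ hζ using hK.differentiableAt hΩ hz hζ.1 hζ.2
  have hma : AEStronglyMeasurable a (volume.restrict Ω) :=
    ((continuous_twoRe.comp (Continuous.prodMk_right z)).pow (j + 1)).aestronglyMeasurable.mul hmd
  have hmb : AEStronglyMeasurable b (volume.restrict Ω) :=
    (hK.measurable_weighted j z).const_mul _
  have hderiv : ∀ ζ ∈ Ω, ζ ≠ z →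
      HasFDerivAt (fun z => twoRe z ζ ^ (j + 1) * K z ζ) (F' ζ) z := by
    intro ζ hζ hne
    have h1 := (hasFDerivAt_twoRe z ζ).pow (j + 1)
    have h2 := (hK.differentiableAt hΩ hz hζ hne).hasDerivAt.hasFDerivAt.restrictScalars ℝ
    have h3 := h1.mul h2
    refine h3.congr_fderiv ?_
    ext v
    simp [hF', ha, hb', hR]
    ring
  obtain ⟨hi, hd⟩ := hasFDerivAt_integral_of_dominated_loc_of_lip' (μ := volume.restrict Ω)
    (F := fun z ζ => twoRe z ζ ^ (j + 1) * K z ζ) (F' := F') (x₀ := z)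
    (bound := fun ζ => L * ‖f ζ / (ζ - z)‖) (Metric.ball_mem_nhds z hε)
    (fun x _ => hK.measurable_weighted (j + 1) x)
    (hK.integrableOn_weighted hΩ hb hp hf (j + 1) hz)
    ((hma.smul_const _).add (hmb.smul_const _))
    (by filter_upwards [hmem] with ζ hζ using hL ζ hζ.1 hζ.2)
    ((integrableOn_div_sub hΩ.measurableSet (volume_ne_top_of_subset_ball hb) hp hf z
      ).norm.const_mul L)
    (by filter_upwards [hmem] with ζ hζ using hderiv ζ hζ.1 hζ.2)
  refine ⟨_, hd, ?_⟩
  rw [ContinuousLinearMap.integral_apply hi, ContinuousLinearMap.integral_apply hi,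
    ← integral_const_mul, ← integral_add, ← integral_const_mul, potential, ← integral_const_mul]
  · refine integral_congr_ae (Eventually.of_forall fun ζ => ?_)
    simp only [hF', hb', hR, add_apply, smul_apply,
      ContinuousLinearMap.id_apply, ContinuousLinearMap.comp_apply, Complex.reCLM_apply,
      Complex.ofRealCLM_apply, Complex.one_re, Complex.I_re, smul_eq_mul, Complex.ofReal_zero,
      Complex.ofReal_one]
    linear_combination (1 / 2 * a ζ) * Complex.I_sq
  · exact hi.apply_continuousLinearMap 1
  · exact (hi.apply_continuousLinearMap Complex.I).const_mul _

/-- By Fubini the integration over z comes first. For fixed ζ the kernel has a simple pole with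
residue -f ζ, and the Cauchy–Pompeiu formula gives π f ζ φ ζ. -/
theorem hasWeakDbar_potential (hK : IsCauchyKernel Ω f C K) (hΩ : IsOpen Ω)
    (hb : Ω ⊆ Metric.ball 0 1) (hp : 2 < p) (hf : MemLp f p (volume.restrict Ω)) {φ : ℂ → ℂ}
    (hφ : ContDiff ℝ ∞ φ) (hc : HasCompactSupport φ) (hs : tsupport φ ⊆ Ω) :
    ∫ z in Ω, potential Ω K 0 z * dbar φ z = (Real.pi : ℂ) * ∫ ζ in Ω, f ζ * φ ζ := by
  have hv := volume_ne_top_of_subset_ball hb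
  have : IsFiniteMeasure (volume.restrict Ω) := ⟨by simpa using hv.lt_top⟩
  obtain ⟨M, hM⟩ := (continuous_dbar hφ).bounded_above_of_compact_support
    (hasCompactSupport_dbar hc)
  have hM0 : 0 ≤ M := (norm_nonneg _).trans (hM 0)
  obtain ⟨B, hB, hBle⟩ := exists_lintegral_div_le hΩ.measurableSet hv hp hf
  set G : ℂ × ℂ → ℂ := fun x => K x.1 x.2 * dbar φ x.1 with hG
  have hGm : AEStronglyMeasurable G ((volume.restrict Ω).prod (volume.restrict Ω)) :=
    hK.measurable_prod.mul ((continuous_dbar hφ).comp continuous_fst).aestronglyMeasurable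
  have hKi : ∀ z ∈ Ω, IntegrableOn (K z) Ω := fun z hz => by
    simpa using hK.integrableOn_weighted hΩ hb hp hf 0 hz
  have hGi : Integrable G ((volume.restrict Ω).prod (volume.restrict Ω)) := by
    refine (integrable_prod_iff hGm).2 ⟨?_, ?_⟩
    · filter_upwards [ae_restrict_mem hΩ.measurableSet] with z hz
      exact (hKi z hz).mul_const (dbar φ z)
    · refine Integrable.of_bound hGm.norm.integral_prod_right' (C * B.toReal * M) ?_
      filter_upwards [ae_restrict_mem hΩ.measurableSet] with z hz
      have h1 : ∫ ζ in Ω, ‖K z ζ‖ ≤ C * B.toReal := by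
        calc ∫ ζ in Ω, ‖K z ζ‖ ≤ ∫ ζ in Ω, C * ‖f ζ / (ζ - z)‖ := by
              refine integral_mono_ae (hKi z hz).norm
                ((integrableOn_div_sub hΩ.measurableSet hv hp hf z).norm.const_mul C) ?_
              filter_upwards [ae_restrict_mem hΩ.measurableSet, ae_ne_restrict z] with ζ h1 h2
                using hK.norm_le z hz ζ h1 h2
          _ = C * ∫ ζ in Ω, ‖f ζ / (ζ - z)‖ := integral_const_mul _ _
          _ ≤ C * B.toReal := by
              refine mul_le_mul_of_nonneg_left ?_ hK.nonneg
              rw [integral_norm_eq_lintegral_enorm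
                (integrableOn_div_sub hΩ.measurableSet hv hp hf z).1]
              exact ENNReal.toReal_mono hB (hBle z)
      rw [Real.norm_of_nonneg (integral_nonneg fun _ => norm_nonneg _)]
      simp only [hG, norm_mul]
      rw [integral_mul_const]
      exact mul_le_mul h1 (hM z) (norm_nonneg _) (mul_nonneg hK.nonneg ENNReal.toReal_nonneg)
  calc ∫ z in Ω, potential Ω K 0 z * dbar φ z
      = ∫ z in Ω, ∫ ζ in Ω, G (z, ζ) := by
        refine integral_congr_ae (Eventually.of_forall fun z => ?_)
        simp only [potential, hG, pow_zero, one_mul]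
        rw [integral_mul_const]
    _ = ∫ ζ in Ω, ∫ z in Ω, G (z, ζ) := integral_integral_swap hGi
    _ = ∫ ζ in Ω, (Real.pi : ℂ) * (f ζ * φ ζ) := by
        refine setIntegral_congr_fun hΩ.measurableSet fun ζ hζ => ?_
        simp only [hG]
        rw [setIntegral_mul_dbar_of_simplePole hΩ hζ (hK.differentiableOn ζ hζ) (hK.residue ζ hζ)
          hφ hc hs]
        ring
    _ = _ := integral_const_mul _ _

end IsCauchyKernel

end Potential

end

section

/-! ### Weyl's lemma for the Cauchy–Riemann operator -/

section Weyl

variable {Ω : Set ℂ} {u : ℂ → ℂ} {g : ℂ → ℂ}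

/-- The mollification by a bump function is holomorphic where the test functions fit. -/
lemma differentiableAt_normed_convolution (hg : LocallyIntegrable g) (η : ContDiffBump (0 : ℂ))
    {z : ℂ}
    (h0 : ∀ φ : ℂ → ℂ, ContDiff ℝ ∞ φ → HasCompactSupport φ →
      tsupport φ ⊆ Metric.closedBall z η.rOut → ∫ w, g w * dbar φ w = 0) :
    DifferentiableAt ℂ (convolution (η.normed volume) g (ContinuousLinearMap.lsmul ℝ ℝ) volume)
      z := by
  set ψ : ℂ → ℝ := η.normed volume with hψ
  have hψs : ContDiff ℝ ∞ ψ := η.contDiff_normed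
  have hψc : HasCompactSupport ψ := η.hasCompactSupport_normed
  have hd := hψc.hasFDerivAt_convolution_left (ContinuousLinearMap.lsmul ℝ ℝ)
    (hψs.of_le (by simp)) hg z
  set Lz := convolution (fderiv ℝ ψ) g
    ((ContinuousLinearMap.lsmul ℝ ℝ : ℝ →L[ℝ] ℂ →L[ℝ] ℂ).precompL ℂ) volume z with hLz
  have hex : Integrable fun t => ((ContinuousLinearMap.lsmul ℝ ℝ : ℝ →L[ℝ] ℂ →L[ℝ] ℂ).precompL ℂ)
      (fderiv ℝ ψ t) (g (z - t)) :=
    (hψc.fderiv ℝ).convolutionExists_left _ (hψs.continuous_fderiv (by simp)) hg z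
  have happ : ∀ v, Lz v = ∫ t, (fderiv ℝ ψ t v : ℂ) * g (z - t) := by
    intro v
    rw [hLz, convolution_def, ContinuousLinearMap.integral_apply hex]
    simp
  have hiv : ∀ v, Integrable fun t => (fderiv ℝ ψ t v : ℂ) * g (z - t) := by
    intro v
    simpa using hex.apply_continuousLinearMap v
  -- The reflected and translated bump is itself a test function; testing with it is exactly the
  -- Cauchy–Riemann equation of the mollification at z.
  set φ : ℂ → ℂ := fun w => (ψ (z - w) : ℂ) with hφ
  have hφs : ContDiff ℝ ∞ φ :=
    Complex.ofRealCLM.contDiff.comp (hψs.comp (contDiff_const.sub contDiff_id))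
  have hsupp : Function.support φ ⊆ Metric.ball z η.rOut := by
    intro w hw
    have h1 : z - w ∈ Function.support ψ := by
      intro h
      exact hw (by simp [hφ, h])
    rw [hψ, η.support_normed_eq, mem_ball_zero_iff] at h1
    rwa [Metric.mem_ball, dist_comm, dist_eq_norm]
  have hts : tsupport φ ⊆ Metric.closedBall z η.rOut :=
    closure_minimal (hsupp.trans Metric.ball_subset_closedBall) Metric.isClosed_closedBall
  have hφc : HasCompactSupport φ :=
    (isCompact_closedBall z η.rOut).of_isClosed_subset (isClosed_tsupport φ) hts
  have hz := h0 φ hφs hφc hts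
  have hfd : ∀ w v, fderiv ℝ φ w v = -(fderiv ℝ ψ (z - w) v : ℂ) := by
    intro w v
    have h1 : HasFDerivAt (fun w => z - w) (-ContinuousLinearMap.id ℝ ℂ) w :=
      (hasFDerivAt_id w).const_sub z
    have h2 := Complex.ofRealCLM.hasFDerivAt.comp w
      (((hψs.differentiable (by simp)) (z - w)).hasFDerivAt.comp w h1)
    have h3 : HasFDerivAt φ _ w := h2
    rw [h3.fderiv]
    simp
  have hsum : Lz 1 + Complex.I * Lz Complex.I = 0 := by
    rw [happ, happ, ← integral_const_mul, ← integral_add (hiv 1) ((hiv _).const_mul _),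
      ← integral_sub_left_eq_self _ volume z]
    have e : (fun w => g w * dbar φ w) = fun w => (-1 / 2 : ℂ) *
        ((fderiv ℝ ψ (z - w) 1 : ℂ) * g (z - (z - w))
          + Complex.I * ((fderiv ℝ ψ (z - w) Complex.I : ℂ) * g (z - (z - w)))) := by
      funext w
      rw [dbar, hfd, hfd, sub_sub_cancel]
      ring
    rw [e, integral_const_mul] at hz
    exact (mul_eq_zero.1 hz).resolve_left (by norm_num)
  refine differentiableAt_complex_iff_differentiableAt_real.2 ⟨hd.differentiableAt, ?_⟩
  rw [hd.fderiv, smul_eq_mul]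
  linear_combination (-Complex.I) * hsum + Lz Complex.I * Complex.I_sq

/-- **Weyl's lemma**: a continuous function that is weakly holomorphic is holomorphic. -/
theorem differentiableOn_of_weakDbar_eq_zero (hΩ : IsOpen Ω) (hu : ContinuousOn u Ω)
    (h0 : ∀ φ : ℂ → ℂ, ContDiff ℝ ∞ φ → HasCompactSupport φ → tsupport φ ⊆ Ω →
      ∫ z in Ω, u z * dbar φ z = 0) : DifferentiableOn ℂ u Ω := by
  intro z₀ hz₀
  obtain ⟨ε, hε, hball⟩ := Metric.nhds_basis_closedBall.mem_iff.1 (hΩ.mem_nhds hz₀)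
  set R := ε / 2 with hR
  have hRpos : 0 < R := half_pos hε
  set K := Metric.closedBall z₀ ε with hK
  have hKc : IsCompact K := isCompact_closedBall z₀ ε
  have huK : ContinuousOn u K := hu.mono hball
  set g : ℂ → ℂ := K.indicator u with hg
  have hgi : Integrable g :=
    (integrable_indicator_iff hKc.measurableSet).2 (huK.integrableOn_compact hKc)
  have hgu : ∀ z ∈ K, g z = u z := fun z hz => indicator_of_mem hz u
  -- Radii at most R = ε/2 keep the supports around points of the ball of radius R inside K. Uniform
  -- continuity on K makes the mollifications converge uniformly there, and a uniform limit of
  -- holomorphic functions is holomorphic.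
  set η : ℕ → ContDiffBump (0 : ℂ) := fun n =>
    ⟨R / (n + 2) / 2, R / (n + 2), by positivity, half_lt_self (by positivity)⟩ with hη
  have hrout : ∀ n, (η n).rOut = R / (n + 2) := fun n => rfl
  have hroutR : ∀ n, (η n).rOut ≤ R := fun n => by
    rw [hrout]
    exact div_le_self hRpos.le (by linarith [(Nat.cast_nonneg n : (0 : ℝ) ≤ n)])
  have hsubK : ∀ z ∈ Metric.ball z₀ R, ∀ n, Metric.closedBall z (η n).rOut ⊆ K := by
    intro z hz n
    refine Metric.closedBall_subset_closedBall' ?_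
    rw [Metric.mem_ball] at hz
    linarith [hroutR n]
  have hlim : Tendsto (fun n => (η n).rOut) atTop (𝓝 0) := by
    simp only [hrout]
    refine Tendsto.div_atTop tendsto_const_nhds ?_
    exact tendsto_atTop_add_const_right _ _ tendsto_natCast_atTop_atTop
  have hhol : ∀ n, DifferentiableOn ℂ (convolution ((η n).normed volume) g
      (ContinuousLinearMap.lsmul ℝ ℝ) volume) (Metric.ball z₀ R) := by
    intro n z hz
    refine (differentiableAt_normed_convolution hgi.locallyIntegrable (η n)
      fun φ h1 h2 h3 => ?_).differentiableWithinAt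
    have h4 := h3.trans (hsubK z hz n)
    have h5 := h0 φ h1 h2 (h4.trans hball)
    rw [setIntegral_mul_eq_integral
      ((tsupport_dbar_subset (φ := φ)).trans (h4.trans hball))] at h5
    rw [← h5]
    refine integral_congr_ae (Eventually.of_forall fun w => ?_)
    by_cases hw : w ∈ K
    · simp only [hgu w hw]
    · have : dbar φ w = 0 := image_eq_zero_of_notMem_tsupport fun h =>
        hw (h4 (tsupport_dbar_subset h))
      simp [this]
  have huc : UniformContinuousOn u K := hKc.uniformContinuousOn_of_continuous huK
  have hunif : TendstoUniformlyOn (fun n => convolution ((η n).normed volume) g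
      (ContinuousLinearMap.lsmul ℝ ℝ) volume) u atTop (Metric.ball z₀ R) := by
    rw [Metric.tendstoUniformlyOn_iff]
    intro ε' hε'
    obtain ⟨δ, hδ, hδ'⟩ := Metric.uniformContinuousOn_iff.1 huc (ε' / 2) (half_pos hε')
    filter_upwards [hlim.eventually (gt_mem_nhds hδ)] with n hn z hz
    have hzK : z ∈ K := hsubK z hz n (Metric.mem_closedBall_self (η n).rOut_pos.le)
    rw [dist_comm, ← hgu z hzK]
    refine lt_of_le_of_lt (ContDiffBump.dist_normed_convolution_le hgi.1 fun x hx => ?_)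
      (half_lt_self hε')
    have hxK : x ∈ K := hsubK z hz n (Metric.ball_subset_closedBall hx)
    rw [hgu x hxK, hgu z hzK]
    exact (hδ' x hxK z hzK ((Metric.mem_ball.1 hx).trans hn)).le
  exact ((hunif.tendstoLocallyUniformlyOn.differentiableOn (Eventually.of_forall hhol)
    Metric.isOpen_ball).differentiableAt (Metric.ball_mem_nhds z₀ hRpos)).differentiableWithinAt

end Weyl

end

section

/-! ### The kernel of the Pompeiu operator of the sector ring -/

/-- The kernel of the Pompeiu operator in logarithmic coordinates. -/
def sectorKernel (r α : ℝ) (f : ℂ → ℂ) (z ζ : ℂ) : ℂ :=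
  pairKernel r α (lg z) (lg ζ) (α * f ζ / ζ)

variable {r α : ℝ} {f : ℂ → ℂ}

lemma lg_injOn (hr0 : 0 < r) : InjOn lg (sectorRing r α) := fun z hz ζ hζ h => by
  rw [← exp_lg (ne_zero_of_mem_sectorRing hr0 hz), ← exp_lg (ne_zero_of_mem_sectorRing hr0 hζ), h]

lemma norm_exp_sub_exp_le {u v : ℂ} (hu : u.re ≤ 0) (hv : v.re ≤ 0) :
    ‖Complex.exp u - Complex.exp v‖ ≤ ‖u - v‖ := by
  have hc : Convex ℝ {w : ℂ | w.re ≤ 0} := convex_halfSpace_re_le 0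
  have := hc.norm_image_sub_le_of_norm_hasDerivWithin_le (f := Complex.exp) (f' := Complex.exp)
    (C := 1) (x := v) (y := u) (fun w _ => (Complex.hasDerivAt_exp w).hasDerivWithinAt)
    (fun w hw => by
      rw [Complex.norm_exp]
      exact Real.exp_le_one_iff.2 hw) hv hu
  simpa using this

lemma norm_sub_le_norm_lg_sub (hr0 : 0 < r) {z ζ : ℂ} (hz : z ∈ sectorRing r α)
    (hζ : ζ ∈ sectorRing r α) : ‖z - ζ‖ ≤ ‖lg z - lg ζ‖ := by
  have := norm_exp_sub_exp_le (lg_mem_oRect hr0 hz).1.2.le (lg_mem_oRect hr0 hζ).1.2.le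
  rwa [exp_lg (ne_zero_of_mem_sectorRing hr0 hz), exp_lg (ne_zero_of_mem_sectorRing hr0 hζ)] at this

lemma tendsto_sub_div_lg_sub (hr0 : 0 < r) {ζ : ℂ} (hζ : ζ ∈ sectorRing r α) :
    Tendsto (fun z => (z - ζ) / (lg z - lg ζ)) (𝓝[≠] ζ) (𝓝 ζ) := by
  have h1 := hasDerivAt_iff_tendsto_slope.1 (hasDerivAt_lg ((mem_sectorRing_iff hr0).1 hζ).1)
  have h0 := ne_zero_of_mem_sectorRing hr0 hζ
  have h2 := h1.inv₀ (inv_ne_zero h0)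
  rw [inv_inv] at h2
  refine h2.congr fun z => ?_
  rw [slope_def_field, inv_div]

lemma tendsto_lg_punctured (hr0 : 0 < r) {ζ : ℂ} (hζ : ζ ∈ sectorRing r α) :
    Tendsto lg (𝓝[≠] ζ) (𝓝[≠] (lg ζ)) := by
  refine tendsto_nhdsWithin_iff.2
    ⟨(differentiableAt_lg_of_mem hr0 hζ).continuousAt.tendsto.mono_left nhdsWithin_le_nhds, ?_⟩
  filter_upwards [self_mem_nhdsWithin,
    mem_nhdsWithin_of_mem_nhds ((isOpen_sectorRing hr0).mem_nhds hζ)] with z hz hz'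
  exact fun h => hz (lg_injOn hr0 hz' hζ h)

lemma continuousAt_pairKernel_left (hr0 : 0 < r) (hr1 : r < 1) (hα : 0 < α) {u v : ℂ}
    (hu : u ∈ cRect r α) (hv : v ∈ cRect r α) (h : u ≠ v) (a : ℂ) :
    ContinuousAt (fun u => pairKernel r α u v a) u := by
  obtain ⟨h1, h2⟩ := differentiableAt_logKernel_left hr0 hr1 hα hu hv h
  exact (h1.continuousAt.mul continuousAt_const).sub (h2.continuousAt.mul continuousAt_const)

/-- The bound C / |u - v| carries over because exp is contracting on the left half-plane, and the
coefficient α f/ζ costs the factor α/r. For the residue, -1/α from the kernel, α f/ζ from the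
coefficient and ζ from the limit of (z - ζ) / (lg z - lg ζ) multiply to -f ζ. -/
theorem exists_isCauchyKernel_sectorKernel (hr0 : 0 < r) (hr1 : r < 1) (hα : 1 / 2 ≤ α)
    (hf : AEStronglyMeasurable f (volume.restrict (sectorRing r α))) :
    ∃ C : ℝ, IsCauchyKernel (sectorRing r α) f C (sectorKernel r α f) := by
  have hα0 : 0 < α := by linarith
  have hα' : (α : ℂ) ≠ 0 := by exact_mod_cast hα0.ne'
  obtain ⟨C, hC, hbound⟩ := exists_norm_pairKernel_le hr0 hr1 hα0
  have hcr : ∀ {z}, z ∈ sectorRing r α → lg z ∈ cRect r α := fun hz =>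
    oRect_subset_cRect (lg_mem_oRect hr0 hz)
  have hfa : AEStronglyMeasurable (fun ζ => α * f ζ / ζ) (volume.restrict (sectorRing r α)) := by
    simp only [div_eq_mul_inv]
    exact (hf.const_mul _).mul (Measurable.aestronglyMeasurable (by fun_prop))
  have hconj : ∀ {X : Type} [MeasurableSpace X] {μ : Measure X} {g : X → ℂ},
      AEStronglyMeasurable g μ → AEStronglyMeasurable (fun x => conj (g x)) μ := fun hg =>
    Complex.continuous_conj.comp_aestronglyMeasurable hg
  have hlk := measurable_logKernel hr0 hr1 hα0
  have hlg := measurable_lg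
  have hcm : Measurable fun z : ℂ => (starRingEnd ℂ) z := Complex.continuous_conj.measurable
  refine ⟨C * (α / r), by positivity, ?_, ?_, ?_, ?_, ?_, ?_⟩
  · intro z hz ζ hζ hne
    have h1 : lg z ≠ lg ζ := fun h => hne (lg_injOn hr0 hζ hz h.symm)
    refine (hbound _ (hcr hz) _ (hcr hζ) h1 _).trans ?_
    have h2 := norm_sub_le_norm_lg_sub hr0 hζ hz
    have h3 : 0 < ‖ζ - z‖ := norm_pos_iff.2 (sub_ne_zero.2 hne)
    rw [norm_sub_rev (lg ζ)] at h2
    have h4 : ‖(α : ℂ) * f ζ / ζ‖ ≤ α / r * ‖f ζ‖ := by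
      rw [norm_div, norm_mul, Complex.norm_real, Real.norm_of_nonneg hα0.le, div_mul_eq_mul_div]
      gcongr
      exact hζ.1.le
    rw [norm_div (f ζ)]
    calc C * ‖(α : ℂ) * f ζ / ζ‖ / ‖lg z - lg ζ‖ ≤ C * (α / r * ‖f ζ‖) / ‖ζ - z‖ := by gcongr
      _ = _ := by ring
  · intro z
    unfold sectorKernel pairKernel
    refine AEStronglyMeasurable.sub (AEStronglyMeasurable.mul ?_ hfa)
      (AEStronglyMeasurable.mul ?_ (hconj hfa))
    · exact (hlk.comp (measurable_const.prodMk hlg)).aestronglyMeasurable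
    · exact (hlk.comp (measurable_const.prodMk (hcm.comp hlg))).aestronglyMeasurable
  · unfold sectorKernel pairKernel
    have hfa' : AEStronglyMeasurable (fun x : ℂ × ℂ => α * f x.2 / x.2)
        ((volume.restrict (sectorRing r α)).prod (volume.restrict (sectorRing r α))) :=
      hfa.comp_snd
    refine AEStronglyMeasurable.sub (AEStronglyMeasurable.mul ?_ hfa')
      (AEStronglyMeasurable.mul ?_ (hconj hfa'))
    · exact (hlk.comp ((hlg.comp measurable_fst).prodMk
        (hlg.comp measurable_snd))).aestronglyMeasurable
    · exact (hlk.comp ((hlg.comp measurable_fst).prodMk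
        (hcm.comp (hlg.comp measurable_snd)))).aestronglyMeasurable
  · rintro ζ hζ z ⟨hz, hne⟩
    have h1 : lg z ≠ lg ζ := fun h => hne (lg_injOn hr0 hz hζ h)
    obtain ⟨h2, h3⟩ := differentiableAt_logKernel_left hr0 hr1 hα0 (hcr hz) (hcr hζ) h1
    have h4 := differentiableAt_lg_of_mem hr0 hz
    exact (((h2.comp z h4).mul_const _).sub ((h3.comp z h4).mul_const _)).differentiableWithinAt
  · intro ζ hζ
    have h0 := ne_zero_of_mem_sectorRing hr0 hζ
    obtain ⟨⟨hre1, hre2⟩, -⟩ := mem_oRect.1 (lg_mem_oRect hr0 hζ)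
    have h1 := (tendsto_sub_mul_logKernel_left hr0 hr1 hα0 (v := lg ζ)
      (differentiableAt_villat_exp_of_re hr0 hr1 hα0 (by rw [Complex.add_re]; linarith)
        (by rw [Complex.add_re]; linarith)).continuousAt).comp (tendsto_lg_punctured hr0 hζ)
    have h2 : Tendsto (fun z => logKernel r α (lg z) (conj (lg ζ))) (𝓝[≠] ζ)
        (𝓝 (logKernel r α (lg ζ) (conj (lg ζ)))) := by
      have h3 := (differentiableAt_logKernel_conj hr0 hr1 hα0 (lg_mem_oRect hr0 hζ) (hcr hζ)).2
      exact h3.continuousAt.tendsto.comp ((tendsto_lg_punctured hr0 hζ).mono_right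
        nhdsWithin_le_nhds)
    have h3 : Tendsto (fun z : ℂ => z - ζ) (𝓝[≠] ζ) (𝓝 0) := by
      have : Tendsto (fun z : ℂ => z - ζ) (𝓝 ζ) (𝓝 (ζ - ζ)) := tendsto_id.sub_const ζ
      rw [sub_self] at this
      exact this.mono_left nhdsWithin_le_nhds
    have h4 := (((tendsto_sub_div_lg_sub hr0 hζ).mul h1).mul_const (α * f ζ / ζ)).sub
      ((h3.mul h2).mul_const (conj (α * f ζ / ζ)))
    have e : ζ * -(α : ℂ)⁻¹ * (α * f ζ / ζ)
        - 0 * logKernel r α (lg ζ) (conj (lg ζ)) * conj (α * f ζ / ζ) = -f ζ := by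
      field_simp
      ring
    rw [e] at h4
    refine h4.congr' ?_
    filter_upwards [(tendsto_lg_punctured hr0 hζ).eventually self_mem_nhdsWithin] with z hz
    have h5 : lg z - lg ζ ≠ 0 := sub_ne_zero.2 hz
    simp only [Function.comp_apply, sectorKernel, pairKernel]
    field_simp
  · intro t ht ζ hζ
    rw [tendsto_iff_ultrafilter]
    intro g hg
    obtain ⟨u₀, hu₀, hu₀', -, hlim⟩ := exists_tendsto_lg hr0 hr1 hα ht hg
    have hne : u₀ ≠ lg ζ := fun h => hu₀' (h ▸ lg_mem_oRect hr0 hζ)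
    have h1 := (continuousAt_pairKernel_left hr0 hr1 hα0 hu₀ (hcr hζ) hne
      (α * f ζ / ζ)).tendsto.comp (hlim.mono_right nhdsWithin_le_nhds)
    have h2 := (Complex.continuous_re.tendsto _).comp h1
    rw [pairKernel, re_logKernel_pair hr0 hr1 hα0 hu₀ hu₀' (hcr hζ) hne] at h2
    exact h2

lemma cpowPos_conj_ne (hr0 : 0 < r) (hr1 : r < 1) (hα : 0 < α) {z ζ : ℂ}
    (hz : z ∈ sectorRing r α) (hζ : ζ ∈ sectorRing r α) :
    cpowPos α z * cpowPos α ζ ≠ 1 ∧ cpowPos α z * conj (cpowPos α ζ) ≠ 1 := by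
  have h : ∀ {w}, w ∈ sectorRing r α → ‖cpowPos α w‖ < 1 := fun {w} hw => by
    rw [cpowPos_eq ((mem_sectorRing_iff hr0).1 hw).1, norm_exp_mul, Real.exp_lt_one_iff]
    have := (lg_mem_oRect hr0 hw).1.2
    exact mul_neg_of_pos_of_neg hα this
  have h1 : ‖cpowPos α z‖ * ‖cpowPos α ζ‖ < 1 := by
    have := h hz
    have := h hζ
    nlinarith [norm_nonneg (cpowPos α z), norm_nonneg (cpowPos α ζ)]
  constructor <;> intro h2 <;> replace h2 := congrArg norm h2 <;> rw [norm_mul] at h2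
  · simp at h2
    linarith
  · simp at h2
    linarith

/-- Writing ζ^(α - 1) = ζ^α / ζ completes H₂ to the kernel ζ^α H₂, both at ζ^α and at its conjugate.
-/
lemma pompeiu_integrand_eq (hr0 : 0 < r) (hr1 : r < 1) (hα : 0 < α) {z ζ : ℂ}
    (hz : z ∈ sectorRing r α) (hζ : ζ ∈ sectorRing r α) :
    α * (cpowPos (α - 1) ζ * kernelH2 r α (cpowPos α z) (cpowPos α ζ) * f ζ
        - conj (cpowPos (α - 1) ζ) * kernelH2 r α (cpowPos α z) (conj (cpowPos α ζ))
          * conj (f ζ)) = sectorKernel r α f z ζ := by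
  have h0 := ne_zero_of_mem_sectorRing hr0 hζ
  obtain ⟨hne1, hne2⟩ := cpowPos_conj_ne hr0 hr1 hα hz hζ
  have hz' := ((mem_sectorRing_iff hr0).1 hz).1
  have hζ' := ((mem_sectorRing_iff hr0).1 hζ).1
  have e1 : cpowPos (α - 1) ζ = cpowPos α ζ / ζ := by
    rw [cpowPos_eq hζ', cpowPos_eq hζ', eq_div_iff h0]
    conv_lhs => rw [← exp_lg h0, lg_exp (lg_mem_oRect hr0 hζ).2.1 (by
      rw [lg_im]; linarith [Complex.arg_le_pi (-ζ)])]
    rw [← Complex.exp_add]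
    congr 1
    push_cast
    ring
  have nz : ∀ {w}, w ∈ sectorRing r α → cpowPos α w ≠ 0 := fun {w} hw => by
    rw [cpowPos_eq ((mem_sectorRing_iff hr0).1 hw).1]
    exact Complex.exp_ne_zero _
  have k1 := mul_kernelH2 hr0 hr1 hα (nz hz) (nz hζ) hne1
  have k2 := mul_kernelH2 hr0 hr1 hα (nz hz)
    ((map_ne_zero (starRingEnd ℂ)).2 (nz hζ)) hne2
  have l1 : logKernel r α (lg z) (lg ζ) = cpowPos α ζ * kernelH2 r α (cpowPos α z)
      (cpowPos α ζ) := by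
    rw [k1, logKernel, ringKernel, cpowPos_eq hz', cpowPos_eq hζ']
  have l2 : logKernel r α (lg z) (conj (lg ζ)) = conj (cpowPos α ζ) *
      kernelH2 r α (cpowPos α z) (conj (cpowPos α ζ)) := by
    rw [k2, logKernel, ringKernel, cpowPos_eq hz', cpowPos_eq hζ', conj_exp_mul]
  rw [sectorKernel, pairKernel, l1, l2, e1]
  simp only [map_div₀, map_mul, Complex.conj_ofReal]
  have h0' : conj ζ ≠ 0 := (map_ne_zero (starRingEnd ℂ)).2 h0
  field_simp

theorem polyPompeiu_eq_potential (hr0 : 0 < r) (hr1 : r < 1) (hα : 0 < α) (n : ℕ) {z : ℂ}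
    (hz : z ∈ sectorRing r α) :
    polyPompeiu r α (n + 1) f z = ((-1 : ℂ) ^ (n + 1) / ((Real.pi : ℂ) * (n.factorial : ℂ))) *
      potential (sectorRing r α) (sectorKernel r α f) n z := by
  rw [polyPompeiu, potential, Nat.add_sub_cancel]
  have h1 : (-1 : ℂ) ^ (n + 1) * (α : ℂ) / ((Real.pi : ℂ) * (n.factorial : ℂ))
      = ((-1 : ℂ) ^ (n + 1) / ((Real.pi : ℂ) * (n.factorial : ℂ))) * α := by ring
  rw [h1, mul_assoc, ← integral_const_mul]
  congr 1
  refine setIntegral_congr_fun (isOpen_sectorRing hr0).measurableSet fun ζ hζ => ?_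
  rw [← pompeiu_integrand_eq hr0 hr1 hα hz hζ]
  ring

end

section

/-! ### The Schwarz operator in logarithmic coordinates -/

/-- The `k`-th boundary integral of the Schwarz operator. -/
def schwarzTerm (r α : ℝ) (g : ℂ → ℝ) (k : ℕ) (z : ℂ) : ℂ :=
  (α : ℂ) / (2 * (Real.pi : ℂ) * Complex.I) *
      ((∫ τ in (0 : ℝ)..(Real.pi / α), arcIntegrand r α g k z 1 τ)
        + ∫ τ in (Real.pi / α)..(0 : ℝ), arcIntegrand r α g k z r τ)
    + (α : ℂ) / ((Real.pi : ℂ) * Complex.I) *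
      ((∫ ρ in (1 : ℝ)..r, rayIntegrand r α g k z (Real.pi / α) ρ)
        + ∫ ρ in r..(1 : ℝ), rayIntegrand r α g k z 0 ρ)

lemma integral_comp_log_div {r : ℝ} (hr0 : 0 < r) (hr1 : r < 1) (F : ℝ → ℂ) :
    ∫ ρ in r..(1 : ℝ), F (Real.log ρ) / (ρ : ℂ) = ∫ x in (Real.log r)..(0 : ℝ), F x := by
  have himg : Real.log '' Ioc r 1 = Ioc (Real.log r) 0 := by
    ext x
    constructor
    · rintro ⟨ρ, ⟨h1, h2⟩, rfl⟩
      exact ⟨Real.log_lt_log hr0 h1, Real.log_nonpos (hr0.trans h1).le h2⟩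
    · rintro ⟨h1, h2⟩
      exact ⟨Real.exp x, ⟨(Real.log_lt_iff_lt_exp hr0).1 h1, Real.exp_le_one_iff.2 h2⟩,
        Real.log_exp x⟩
  rw [intervalIntegral.integral_of_le hr1.le,
    intervalIntegral.integral_of_le (Real.log_neg hr0 hr1).le, ← himg,
    integral_image_eq_integral_abs_deriv_smul measurableSet_Ioc (f' := fun ρ => ρ⁻¹)
      (fun ρ hρ => (Real.hasDerivAt_log (hr0.trans hρ.1).ne').hasDerivWithinAt)
      (Real.log_injOn_pos.mono fun ρ hρ => hr0.trans hρ.1)]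
  refine setIntegral_congr_fun measurableSet_Ioc fun ρ hρ => ?_
  have : 0 < ρ := hr0.trans hρ.1
  simp only [abs_of_pos (inv_pos.2 this), Complex.real_smul, Complex.ofReal_inv]
  rw [div_eq_mul_inv, mul_comm]

variable {r α : ℝ} {g : ℂ → ℝ}

/-- The density of the `k`-th boundary integral. -/
def schwarzDensity (g : ℂ → ℝ) (k : ℕ) (z v : ℂ) : ℂ :=
  (g (Complex.exp v) : ℂ) * twoRe z (Complex.exp v) ^ k

lemma arcIntegrand_eq (hr0 : 0 < r) (hr1 : r < 1) (hα : 0 < α) {k : ℕ} {z : ℂ}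
    (hz : z ∈ sectorRing r α) {ρ τ : ℝ} (hρ : ρ = 1 ∨ ρ = r) (hτ : τ ∈ Icc 0 (Real.pi / α)) :
    arcIntegrand r α g k z ρ τ = schwarzDensity g k z (Real.log ρ + τ * Complex.I) *
      (Complex.I * (logKernel r α (lg z) (Real.log ρ + τ * Complex.I)
        - logKernel r α (lg z) (conj (Real.log ρ + τ * Complex.I : ℂ)))) := by
  have hρ0 : 0 < ρ := by rcases hρ with rfl | rfl <;> [exact one_pos; exact hr0]
  have hlog : Real.log ρ = 0 ∨ Real.log ρ = Real.log r := by
    rcases hρ with rfl | rfl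
    · exact Or.inl Real.log_one
    · exact Or.inr rfl
  set v : ℂ := Real.log ρ + τ * Complex.I with hv
  have hre : v.re = Real.log ρ := by simp [hv]
  have him : v.im = τ := by simp [hv]
  have hl := Real.log_neg hr0 hr1
  have hvc : v ∈ cRect r α := by
    rw [mem_cRect, hre, him]
    rcases hlog with h | h <;> rw [h] <;> exact ⟨⟨by linarith, by linarith⟩, hτ.1, hτ.2⟩
  have hvo : v ∉ oRect r α := by
    rw [mem_oRect, hre]
    rcases hlog with h | h <;> rw [h] <;> intro h' <;> linarith [h'.1.1, h'.1.2]
  have hu := lg_mem_oRect hr0 hz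
  have hne : lg z ≠ v := fun h => hvo (h ▸ hu)
  have huc := oRect_subset_cRect hu
  have hz' := ((mem_sectorRing_iff hr0).1 hz).1
  rw [arcIntegrand, polarPow_eq hρ0, polarPt_eq hρ0, ← hv, schwarzDensity, cpowPos_eq hz',
    mul_div_assoc, mul_div_cancel_right₀ _ (Complex.exp_ne_zero v),
    kernelH1_eq_ringKernel hr0 hr1 hα (exp_mem_ann_of_mem hr0 hα huc)
      (exp_mem_ann_of_mem hr0 hα hvc) (exp_mul_ne hr0 hr1 hα huc hvc hne)
      (exp_mul_ne_conj hr0 hr1 hα huc hvc hne), logKernel, logKernel, conj_exp_mul]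
  · ring
  · rw [norm_exp_mul, hre, qpar_eq_exp hr0]
    rcases hlog with h | h <;> rw [h]
    · left; simp
    · right; rfl

lemma rayIntegrand_eq (hr0 : 0 < r) (hr1 : r < 1) (hα : 0 < α) {k : ℕ} {z : ℂ}
    (hz : z ∈ sectorRing r α) {ρ φ : ℝ} (hρ : ρ ∈ Icc r 1) :
    rayIntegrand r α g k z φ ρ = schwarzDensity g k z (Real.log ρ + φ * Complex.I) *
      logKernel r α (lg z) (Real.log ρ + φ * Complex.I) / (ρ : ℂ) := by
  have hρ0 : 0 < ρ := hr0.trans_le hρ.1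
  set v : ℂ := Real.log ρ + φ * Complex.I with hv
  have hre : v.re = Real.log ρ := by simp [hv]
  have hz' := ((mem_sectorRing_iff hr0).1 hz).1
  have hu := lg_mem_oRect hr0 hz
  have hne : Complex.exp (α * lg z) * Complex.exp (α * v) ≠ 1 := by
    intro h
    have h1 := congrArg norm h
    rw [norm_mul, norm_exp_mul, norm_exp_mul, ← Real.exp_add, norm_one, Real.exp_eq_one_iff,
      hre, ← mul_add] at h1
    have h2 := Real.log_nonpos hρ0.le hρ.2
    have h3 := hu.1.2
    rcases mul_eq_zero.1 h1 with h4 | h4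
    · exact hα.ne' h4
    · have : (lg z).re < 0 := h3
      linarith
  have hp : polarPow (α - 1) ρ φ * Complex.exp (Complex.I * φ) = Complex.exp (α * v) / ρ := by
    have h1 : (ρ : ℂ) = Complex.exp (Real.log ρ) := by
      rw [← Complex.ofReal_exp, Real.exp_log hρ0]
    rw [polarPow_eq hρ0, h1, ← Complex.exp_add, ← Complex.exp_sub, hv]
    congr 1
    push_cast
    ring
  have hk := mul_kernelH2 hr0 hr1 hα (Complex.exp_ne_zero (α * lg z))
    (Complex.exp_ne_zero (α * v)) hne
  rw [rayIntegrand, mul_assoc _ (polarPow (α - 1) ρ φ), hp, polarPow_eq hρ0, polarPt_eq hρ0, ← hv,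
    schwarzDensity, cpowPos_eq hz', logKernel, ringKernel, ← hk]
  ring

lemma logKernel_conj_eq_of_exp {u v : ℂ}
    (h : Complex.exp (α * conj v) = Complex.exp (α * v)) :
    logKernel r α u (conj v) = logKernel r α u v := by
  rw [logKernel, logKernel, h]

/-- The rays are the horizontal sides 0 and 2, the arcs the vertical sides 1 and 3. On the rays both
halves of the pair coincide, which accounts for the coefficient α/(πi) in place of α/(2πi). -/
theorem schwarzTerm_eq_sum (hr0 : 0 < r) (hr1 : r < 1) (hα : 0 < α) (k : ℕ) {z : ℂ}
    (hz : z ∈ sectorRing r α) :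
    schwarzTerm r α g k z = ∑ i, ∫ τ in (0 : ℝ)..sideLen r α i,
      schwarzDensity g k z (sidePt r α i τ)
        * pairKernel r α (lg z) (sidePt r α i τ) (sideCoef α i) := by
  set D := schwarzDensity g k z with hD
  set κ := logKernel r α (lg z) with hκ
  have hθ : 0 ≤ Real.pi / α := by positivity
  have hπ : (Real.pi : ℂ) ≠ 0 := by exact_mod_cast Real.pi_ne_zero
  have hα' : (α : ℂ) ≠ 0 := by exact_mod_cast hα.ne'
  have hside : ∀ i τ, D (sidePt r α i τ) * pairKernel r α (lg z) (sidePt r α i τ) (sideCoef α i)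
      = α / (2 * Real.pi * Complex.I) * (D (sidePt r α i τ) *
        (κ (sidePt r α i τ) * sideDir i + κ (conj (sidePt r α i τ)) * conj (sideDir i))) := by
    intro i τ
    rw [integral_side_pairKernel]
    ring
  have harc : ∀ ρ : ℝ, (ρ = 1 ∨ ρ = r) →
      ∫ τ in (0 : ℝ)..(Real.pi / α), arcIntegrand r α g k z ρ τ
        = ∫ τ in (0 : ℝ)..(Real.pi / α), D (Real.log ρ + τ * Complex.I) *
          (Complex.I * (κ (Real.log ρ + τ * Complex.I)
            - κ (conj (Real.log ρ + τ * Complex.I : ℂ)))) := by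
    intro ρ hρ
    refine intervalIntegral.integral_congr fun τ hτ => ?_
    rw [uIcc_of_le hθ] at hτ
    exact arcIntegrand_eq hr0 hr1 hα hz hρ hτ
  have hray : ∀ φ : ℝ, ∫ ρ in r..(1 : ℝ), rayIntegrand r α g k z φ ρ
      = ∫ x in (Real.log r)..(0 : ℝ), D (x + φ * Complex.I) * κ (x + φ * Complex.I) := by
    intro φ
    rw [← integral_comp_log_div hr0 hr1]
    refine intervalIntegral.integral_congr fun ρ hρ => ?_
    rw [uIcc_of_le hr1.le] at hρ
    exact rayIntegrand_eq hr0 hr1 hα hz hρ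
  have h0 : ∫ τ in (0 : ℝ)..sideLen r α 0, D (sidePt r α 0 τ) *
        (κ (sidePt r α 0 τ) * sideDir 0 + κ (conj (sidePt r α 0 τ)) * conj (sideDir 0))
      = 2 * ∫ ρ in r..(1 : ℝ), rayIntegrand r α g k z 0 ρ := by
    rw [hray, ← intervalIntegral.integral_const_mul]
    have := intervalIntegral.integral_comp_add_left (a := 0) (b := -Real.log r)
      (fun x : ℝ => 2 * (D (x + (0 : ℝ) * Complex.I) * κ (x + (0 : ℝ) * Complex.I))) (Real.log r)
    rw [add_zero, add_neg_cancel] at this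
    rw [← this]
    refine intervalIntegral.integral_congr fun τ _ => ?_
    have e : sidePt r α 0 τ = ((Real.log r + τ : ℝ) : ℂ) := by simp [sidePt, sideStart, sideDir]
    simp only [e, Complex.conj_ofReal, sideDir, Matrix.cons_val_zero, Complex.ofReal_zero,
      zero_mul, add_zero, map_one, mul_one]
    ring
  have h1 : ∫ τ in (0 : ℝ)..sideLen r α 1, D (sidePt r α 1 τ) *
        (κ (sidePt r α 1 τ) * sideDir 1 + κ (conj (sidePt r α 1 τ)) * conj (sideDir 1))
      = ∫ τ in (0 : ℝ)..(Real.pi / α), arcIntegrand r α g k z 1 τ := by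
    rw [harc 1 (Or.inl rfl)]
    refine intervalIntegral.integral_congr fun τ _ => ?_
    have e : sidePt r α 1 τ = (Real.log 1 : ℝ) + τ * Complex.I := by
      simp [sidePt, sideStart, sideDir]
    simp only [e, sideDir, Matrix.cons_val_one, Matrix.cons_val_zero, Complex.conj_I]
    ring
  have h2 : ∫ τ in (0 : ℝ)..sideLen r α 2, D (sidePt r α 2 τ) *
        (κ (sidePt r α 2 τ) * sideDir 2 + κ (conj (sidePt r α 2 τ)) * conj (sideDir 2))
      = 2 * ∫ ρ in (1 : ℝ)..r, rayIntegrand r α g k z (Real.pi / α) ρ := by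
    rw [intervalIntegral.integral_symm r, hray, ← intervalIntegral.integral_neg,
      ← intervalIntegral.integral_const_mul]
    have := intervalIntegral.integral_comp_neg (a := 0) (b := -Real.log r)
      (fun x : ℝ => 2 * -(D (x + (Real.pi / α : ℝ) * Complex.I)
        * κ (x + (Real.pi / α : ℝ) * Complex.I)))
    rw [neg_zero, neg_neg] at this
    rw [← this]
    refine intervalIntegral.integral_congr fun τ _ => ?_
    have e : sidePt r α 2 τ = ((-τ : ℝ) : ℂ) + (Real.pi / α : ℝ) * Complex.I := by
      simp [sidePt, sideStart, sideDir]
      ring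
    have hc : κ (conj (((-τ : ℝ) : ℂ) + (Real.pi / α : ℝ) * Complex.I))
        = κ (((-τ : ℝ) : ℂ) + (Real.pi / α : ℝ) * Complex.I) := by
      refine logKernel_conj_eq_of_exp ?_
      have e1 : (α : ℂ) * (((-τ : ℝ) : ℂ) + (Real.pi / α : ℝ) * Complex.I)
          = ((-α * τ : ℝ) : ℂ) + Real.pi * Complex.I := by
        push_cast
        field_simp
      rw [← conj_exp_mul, e1, Complex.exp_add, Complex.exp_pi_mul_I, ← Complex.ofReal_exp,
        map_mul, map_neg, map_one, Complex.conj_ofReal]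
    simp only [e, hc]
    simp only [sideDir, Matrix.cons_val, map_neg, map_one]
    ring
  have h3 : ∫ τ in (0 : ℝ)..sideLen r α 3, D (sidePt r α 3 τ) *
        (κ (sidePt r α 3 τ) * sideDir 3 + κ (conj (sidePt r α 3 τ)) * conj (sideDir 3))
      = ∫ τ in (Real.pi / α)..(0 : ℝ), arcIntegrand r α g k z r τ := by
    rw [intervalIntegral.integral_symm 0, harc r (Or.inr rfl), ← intervalIntegral.integral_neg]
    have := intervalIntegral.integral_comp_sub_left (a := 0) (b := Real.pi / α)
      (fun τ : ℝ => -(D (Real.log r + τ * Complex.I) *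
          (Complex.I * (κ (Real.log r + τ * Complex.I)
            - κ (conj (Real.log r + τ * Complex.I : ℂ)))))) (Real.pi / α)
    rw [sub_zero, sub_self] at this
    rw [← this]
    refine intervalIntegral.integral_congr fun τ _ => ?_
    have e : sidePt r α 3 τ = (Real.log r : ℝ) + ((Real.pi / α - τ : ℝ) : ℂ) * Complex.I := by
      simp [sidePt, sideStart, sideDir]
      ring
    simp only [e]
    simp only [sideDir, Matrix.cons_val, map_neg, Complex.conj_I]
    ring
  simp only [hside, intervalIntegral.integral_const_mul]
  rw [Fin.sum_univ_four, h0, h1, h2, h3, schwarzTerm]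
  field_simp
  ring

end

section

/-! ### Pointwise Wirtinger derivatives -/

/-- `w` is real differentiable at `z` with `∂w/∂z̄ = d`. -/
def HasDbarAt (w : ℂ → ℂ) (d z : ℂ) : Prop :=
  ∃ L : ℂ →L[ℝ] ℂ, HasFDerivAt w L z ∧ (1 / 2 : ℂ) * (L 1 + Complex.I * L Complex.I) = d

namespace HasDbarAt

variable {w w₁ w₂ : ℂ → ℂ} {d d₁ d₂ z : ℂ}

lemma differentiableAt (h : HasDbarAt w d z) : DifferentiableAt ℝ w z :=
  let ⟨_, hL, _⟩ := h
  hL.differentiableAt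

lemma dbar_eq (h : HasDbarAt w d z) : dbar w z = d := by
  obtain ⟨L, hL, e⟩ := h
  rw [dbar, hL.fderiv, e]

lemma add (h₁ : HasDbarAt w₁ d₁ z) (h₂ : HasDbarAt w₂ d₂ z) :
    HasDbarAt (fun z => w₁ z + w₂ z) (d₁ + d₂) z := by
  obtain ⟨L, hL, e⟩ := h₁
  obtain ⟨M, hM, e'⟩ := h₂
  refine ⟨L + M, hL.add hM, ?_⟩
  simp only [add_apply]
  rw [← e, ← e']
  ring

lemma mul (h₁ : HasDbarAt w₁ d₁ z) (h₂ : HasDbarAt w₂ d₂ z) :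
    HasDbarAt (fun z => w₁ z * w₂ z) (d₁ * w₂ z + w₁ z * d₂) z := by
  obtain ⟨L, hL, e⟩ := h₁
  obtain ⟨M, hM, e'⟩ := h₂
  refine ⟨w₁ z • M + w₂ z • L, hL.mul hM, ?_⟩
  simp only [add_apply, smul_apply, smul_eq_mul]
  rw [← e, ← e']
  ring

lemma of_differentiableAt (h : DifferentiableAt ℂ w z) : HasDbarAt w 0 z := by
  refine ⟨_, h.hasDerivAt.hasFDerivAt.restrictScalars ℝ, ?_⟩
  simp only [ContinuousLinearMap.coe_restrictScalars', ContinuousLinearMap.toSpanSingleton_apply,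
    smul_eq_mul, one_mul]
  linear_combination (1 / 2 * deriv w z) * Complex.I_sq

lemma const_mul (h : HasDbarAt w d z) (c : ℂ) : HasDbarAt (fun z => c * w z) (c * d) z := by
  simpa using (of_differentiableAt (differentiableAt_const c)).mul h

lemma sub (h₁ : HasDbarAt w₁ d₁ z) (h₂ : HasDbarAt w₂ d₂ z) :
    HasDbarAt (fun z => w₁ z - w₂ z) (d₁ - d₂) z := by
  simpa [sub_eq_add_neg] using h₁.add (h₂.const_mul (-1))

lemma sum {ι : Type*} {s : Finset ι} {w : ι → ℂ → ℂ} {d : ι → ℂ}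
    (h : ∀ i ∈ s, HasDbarAt (w i) (d i) z) :
    HasDbarAt (fun z => ∑ i ∈ s, w i z) (∑ i ∈ s, d i) z := by
  classical
  induction s using Finset.induction_on with
  | empty => simpa using of_differentiableAt (differentiableAt_const (0 : ℂ))
  | insert a s ha ih =>
    simp only [Finset.sum_insert ha]
    exact (h a (Finset.mem_insert_self _ _)).add
      (ih fun i hi => h i (Finset.mem_insert_of_mem hi))

lemma pow_succ (h : HasDbarAt w d z) (k : ℕ) :
    HasDbarAt (fun z => w z ^ (k + 1)) ((k + 1 : ℕ) * w z ^ k * d) z := by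
  induction k with
  | zero => simpa using h
  | succ k ih =>
    have := ih.mul h
    simp only [← _root_.pow_succ] at this
    convert this using 1
    push_cast
    ring

lemma congr_of_eqOn {Ω : Set ℂ} (h : HasDbarAt w₁ d z) (hΩ : IsOpen Ω) (hz : z ∈ Ω)
    (e : ∀ z ∈ Ω, w z = w₁ z) : HasDbarAt w d z := by
  obtain ⟨L, hL, e'⟩ := h
  refine ⟨L, hL.congr_of_eventuallyEq ?_, e'⟩
  filter_upwards [hΩ.mem_nhds hz] with x hx using e x hx

lemma of_real_differentiableAt (h : DifferentiableAt ℝ w z) : HasDbarAt w (dbar w z) z :=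
  ⟨_, h.hasFDerivAt, rfl⟩

lemma differentiableAt_complex (h : HasDbarAt w 0 z) : DifferentiableAt ℂ w z := by
  refine differentiableAt_complex_iff_differentiableAt_real.2 ⟨h.differentiableAt, ?_⟩
  have := h.dbar_eq
  rw [dbar] at this
  have h2 := (mul_eq_zero.1 this).resolve_left (by norm_num)
  rw [smul_eq_mul]
  linear_combination (-Complex.I) * h2 + fderiv ℝ w z Complex.I * Complex.I_sq

end HasDbarAt

lemma hasDbarAt_add_conj (z : ℂ) : HasDbarAt (fun z => z + conj z) 1 z := by
  refine ⟨ContinuousLinearMap.id ℝ ℂ + (Complex.conjCLE : ℂ →L[ℝ] ℂ),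
    (hasFDerivAt_id z).add (Complex.conjCLE : ℂ →L[ℝ] ℂ).hasFDerivAt, ?_⟩
  norm_num

/-! ### Properties of the boundary integrals -/

variable {r α : ℝ} {g : ℂ → ℝ}

/-- The boundary values `γ(ζ) (ζ + ζ̄) ^ m` in logarithmic coordinates. -/
def momentData (g : ℂ → ℝ) (m : ℕ) (v : ℂ) : ℝ :=
  g (Complex.exp v) * (2 * (Complex.exp v).re) ^ m

lemma continuousOn_momentData (hr0 : 0 < r) (hr1 : r < 1) (hα : 1 / 2 ≤ α)
    (hg : ContinuousOn g (frontier (sectorRing r α))) (m : ℕ) :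
    ContinuousOn (momentData g m) (cRect r α \ oRect r α) := by
  have h1 : ContinuousOn (fun v => g (Complex.exp v)) (cRect r α \ oRect r α) :=
    hg.comp Complex.continuous_exp.continuousOn fun v hv => exp_mem_frontier hr0 hr1 hα hv.1 hv.2
  have h2 : Continuous fun v => (2 * (Complex.exp v).re) ^ m := by
    have := Complex.continuous_re.comp Complex.continuous_exp
    simp only [Function.comp_def] at this
    fun_prop
  exact h1.mul h2.continuousOn

/-- The weight is a power of 2 Re ζ - (z + z̄). Expanding it separates the dependence on z̄ from the
boundary data. -/
lemma schwarzDensity_eq (k : ℕ) (z v : ℂ) :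
    schwarzDensity g k z v = ∑ m ∈ Finset.range (k + 1),
      ((k.choose m : ℂ) * (-(z + conj z)) ^ (k - m)) * (momentData g m v : ℂ) := by
  have h1 : twoRe z (Complex.exp v) = ((2 * (Complex.exp v).re : ℝ) : ℂ) + -(z + conj z) := by
    rw [twoRe_eq, Complex.add_conj]
    push_cast
    ring
  rw [schwarzDensity, h1, add_pow, Finset.mul_sum]
  refine Finset.sum_congr rfl fun m _ => ?_
  rw [momentData]
  push_cast
  ring

theorem schwarzTerm_eq_sum_poisson (hr0 : 0 < r) (hr1 : r < 1) (hα : 1 / 2 ≤ α)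
    (hg : ContinuousOn g (frontier (sectorRing r α))) (k : ℕ) {z : ℂ}
    (hz : z ∈ sectorRing r α) :
    schwarzTerm r α g k z = ∑ m ∈ Finset.range (k + 1),
      ((k.choose m : ℂ) * (-(z + conj z)) ^ (k - m)) * poisson r α (momentData g m) (lg z) := by
  have hα0 : 0 < α := by linarith
  rw [schwarzTerm_eq_sum hr0 hr1 hα0 k hz]
  have hint : ∀ (i : Fin 4) (m : ℕ), IntervalIntegrable
      (fun τ => (momentData g m (sidePt r α i τ) : ℂ) *
        pairKernel r α (lg z) (sidePt r α i τ) (sideCoef α i)) volume 0 (sideLen r α i) := by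
    intro i m
    refine ContinuousOn.intervalIntegrable ?_
    rw [uIcc_of_le (sideLen_pos hr0 hr1 hα0 i).le]
    exact (Complex.continuous_ofReal.comp_continuousOn
      (continuousOn_comp_side hr0 hr1 hα0 (continuousOn_momentData hr0 hr1 hα hg m) i)).mul
      (continuousOn_pairKernel_side hr0 hr1 hα0 (lg_mem_oRect hr0 hz) i _)
  have h1 : ∀ i, ∫ τ in (0 : ℝ)..sideLen r α i, schwarzDensity g k z (sidePt r α i τ)
      * pairKernel r α (lg z) (sidePt r α i τ) (sideCoef α i)
      = ∑ m ∈ Finset.range (k + 1), ((k.choose m : ℂ) * (-(z + conj z)) ^ (k - m)) *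
        ∫ τ in (0 : ℝ)..sideLen r α i, (momentData g m (sidePt r α i τ) : ℂ) *
          pairKernel r α (lg z) (sidePt r α i τ) (sideCoef α i) := by
    intro i
    simp only [← intervalIntegral.integral_const_mul]
    rw [← intervalIntegral.integral_finsetSum fun m _ => (hint i m).const_mul _]
    refine intervalIntegral.integral_congr fun τ _ => ?_
    simp only [schwarzDensity_eq, Finset.sum_mul]
    exact Finset.sum_congr rfl fun m _ => by ring
  simp only [h1, poisson, Finset.mul_sum]
  exact Finset.sum_comm

lemma differentiableAt_poisson_lg (hr0 : 0 < r) (hr1 : r < 1) (hα : 1 / 2 ≤ α)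
    (hg : ContinuousOn g (frontier (sectorRing r α))) (m : ℕ) {z : ℂ}
    (hz : z ∈ sectorRing r α) :
    DifferentiableAt ℂ (fun z => poisson r α (momentData g m) (lg z)) z := by
  have h1 := (differentiableOn_poisson hr0 hr1 (by linarith)
    (continuousOn_momentData hr0 hr1 hα hg m)).differentiableAt
    (isOpen_oRect.mem_nhds (lg_mem_oRect hr0 hz))
  exact h1.comp z (differentiableAt_lg_of_mem hr0 hz)

lemma differentiableOn_schwarzTerm_zero (hr0 : 0 < r) (hr1 : r < 1) (hα : 1 / 2 ≤ α)
    (hg : ContinuousOn g (frontier (sectorRing r α))) :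
    DifferentiableOn ℂ (schwarzTerm r α g 0) (sectorRing r α) := by
  intro z hz
  refine ((differentiableAt_poisson_lg hr0 hr1 hα hg 0 hz).differentiableWithinAt).congr
    (fun x hx => ?_) ?_
  · simp [schwarzTerm_eq_sum_poisson hr0 hr1 hα hg 0 hx]
  · simp [schwarzTerm_eq_sum_poisson hr0 hr1 hα hg 0 hz]

/-- The Poisson integrals are holomorphic, so only the powers of z + z̄ are differentiated, and the
term m = k + 1 drops out. The coefficients match by (k + 1) C(k, m) = (k + 1 - m) C(k + 1, m). -/
theorem hasDbarAt_schwarzTerm_succ (hr0 : 0 < r) (hr1 : r < 1) (hα : 1 / 2 ≤ α)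
    (hg : ContinuousOn g (frontier (sectorRing r α))) (k : ℕ) {z : ℂ}
    (hz : z ∈ sectorRing r α) :
    HasDbarAt (schwarzTerm r α g (k + 1)) (-((k + 1 : ℕ) : ℂ) * schwarzTerm r α g k z) z := by
  set P : ℕ → ℂ → ℂ := fun m z => poisson r α (momentData g m) (lg z) with hP
  have hPd : ∀ m, HasDbarAt (P m) 0 z := fun m =>
    HasDbarAt.of_differentiableAt (differentiableAt_poisson_lg hr0 hr1 hα hg m hz)
  have hs : HasDbarAt (fun z => -(z + conj z)) (-1) z := by
    simpa using (hasDbarAt_add_conj z).const_mul (-1)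
  have hterm : ∀ m ∈ Finset.range (k + 1), HasDbarAt
      (fun z => (((k + 1).choose m : ℂ) * (-(z + conj z)) ^ (k + 1 - m)) * P m z)
      (-((k + 1 : ℕ) : ℂ) * (((k.choose m : ℂ) * (-(z + conj z)) ^ (k - m)) * P m z)) z := by
    intro m hm
    have hm' : m ≤ k := Nat.lt_succ_iff.1 (Finset.mem_range.1 hm)
    have h1 := ((hs.pow_succ (k - m)).const_mul ((k + 1).choose m : ℂ)).mul (hPd m)
    rw [show k - m + 1 = k + 1 - m by omega] at h1
    convert h1 using 1
    have h2 : ((k + 1 : ℕ) : ℂ) * (k.choose m : ℂ)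
        = ((k + 1).choose m : ℂ) * ((k + 1 - m : ℕ) : ℂ) := by
      have h3 := Nat.choose_mul_succ_eq k m
      push_cast [← h3]
      exact_mod_cast (by rw [mul_comm]; exact h3)
    linear_combination (-((-(z + conj z)) ^ (k - m)) * P m z) * h2
  have hlast : HasDbarAt
      (fun z => (((k + 1).choose (k + 1) : ℂ) * (-(z + conj z)) ^ (k + 1 - (k + 1)))
        * P (k + 1) z) 0 z := by
    simpa using hPd (k + 1)
  have h := (HasDbarAt.sum hterm).add hlast
  rw [add_zero, ← Finset.mul_sum, ← schwarzTerm_eq_sum_poisson hr0 hr1 hα hg k hz] at h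
  refine h.congr_of_eqOn (isOpen_sectorRing hr0) hz fun x hx => ?_
  rw [schwarzTerm_eq_sum_poisson hr0 hr1 hα hg (k + 1) hx, Finset.sum_range_succ]

/-- The polynomial coefficients are real, so real parts can be taken termwise. In the limit the
binomial sum is g(t) (2 Re t - 2 Re t)^k, which by 0^0 = 1 survives only for k = 0. -/
theorem tendsto_re_schwarzTerm (hr0 : 0 < r) (hr1 : r < 1) (hα : 1 / 2 ≤ α)
    (hg : ContinuousOn g (frontier (sectorRing r α))) (k : ℕ) {t : ℂ}
    (ht : t ∈ frontier (sectorRing r α)) :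
    Tendsto (fun z => (schwarzTerm r α g k z).re) (𝓝[sectorRing r α] t) (𝓝 (g t * 0 ^ k)) := by
  have hα0 : 0 < α := by linarith
  have hP : ∀ m, Tendsto (fun z => (poisson r α (momentData g m) (lg z)).re)
      (𝓝[sectorRing r α] t) (𝓝 (g t * (2 * t.re) ^ m)) := by
    intro m
    rw [tendsto_iff_ultrafilter]
    intro F hF
    obtain ⟨u₀, hu₀, hu₀', he, hlim⟩ := exists_tendsto_lg hr0 hr1 hα ht hF
    have h1 := (tendsto_re_poisson hr0 hr1 hα0 (continuousOn_momentData hr0 hr1 hα hg m) hu₀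
      hu₀').comp hlim
    rw [momentData, he] at h1
    exact h1
  have hsum : Tendsto (fun z : ℂ => ∑ m ∈ Finset.range (k + 1),
      ((k.choose m : ℝ) * (-(2 * z.re)) ^ (k - m)) *
        (poisson r α (momentData g m) (lg z)).re) (𝓝[sectorRing r α] t)
      (𝓝 (∑ m ∈ Finset.range (k + 1),
        ((k.choose m : ℝ) * (-(2 * t.re)) ^ (k - m)) * (g t * (2 * t.re) ^ m))) := by
    refine tendsto_finsetSum _ fun m _ => Tendsto.mul ?_ (hP m)
    refine Tendsto.mono_left (Continuous.tendsto ?_ t) nhdsWithin_le_nhds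
    have := Complex.continuous_re
    fun_prop
  have e : ∑ m ∈ Finset.range (k + 1),
        ((k.choose m : ℝ) * (-(2 * t.re)) ^ (k - m)) * (g t * (2 * t.re) ^ m) = g t * 0 ^ k := by
    rw [← add_neg_cancel (2 * t.re), add_pow, Finset.mul_sum]
    exact Finset.sum_congr rfl fun m _ => by ring
  rw [e] at hsum
  refine hsum.congr' ?_
  filter_upwards [self_mem_nhdsWithin] with z hz
  rw [schwarzTerm_eq_sum_poisson hr0 hr1 hα hg k hz, Complex.re_sum]
  refine Finset.sum_congr rfl fun m _ => ?_
  rw [Complex.add_conj, ← Complex.ofReal_natCast, ← Complex.ofReal_neg, ← Complex.ofReal_pow,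
    ← Complex.ofReal_mul, Complex.re_ofReal_mul]

end

section

/-! ### The Schwarz problem -/

variable {r α : ℝ} {f : ℂ → ℂ} {p : ENNReal}

lemma hasDbarAt_polyPompeiu (hr0 : 0 < r) (hr1 : r < 1) (hα : 1 / 2 ≤ α) (hp : 2 < p)
    (hf : MemLp f p (volume.restrict (sectorRing r α))) (n : ℕ) {z : ℂ}
    (hz : z ∈ sectorRing r α) :
    HasDbarAt (polyPompeiu r α (n + 2) f) (polyPompeiu r α (n + 1) f z) z := by
  have hα0 : 0 < α := by linarith
  obtain ⟨C, hK⟩ := exists_isCauchyKernel_sectorKernel hr0 hr1 hα hf.1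
  have h1 : HasDbarAt (potential (sectorRing r α) (sectorKernel r α f) (n + 1)) _ z :=
    hK.hasFDerivAt_potential (isOpen_sectorRing hr0) sectorRing_subset_ball hp hf n hz
  have h2 := (h1.const_mul ((-1 : ℂ) ^ (n + 2) / ((Real.pi : ℂ) * ((n + 1).factorial : ℂ)))
    ).congr_of_eqOn (isOpen_sectorRing hr0) hz
    fun x hx => polyPompeiu_eq_potential hr0 hr1 hα0 (n + 1) hx
  convert h2 using 1
  rw [polyPompeiu_eq_potential hr0 hr1 hα0 n hz, Nat.factorial_succ]
  have hπ : (Real.pi : ℂ) ≠ 0 := by exact_mod_cast Real.pi_ne_zero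
  have h3 : (n.factorial : ℂ) ≠ 0 := by exact_mod_cast n.factorial_ne_zero
  have h4 : ((n + 1 : ℕ) : ℂ) ≠ 0 := by exact_mod_cast n.succ_ne_zero
  rw [Nat.cast_mul]
  field_simp
  ring

lemma tendsto_re_polyPompeiu (hr0 : 0 < r) (hr1 : r < 1) (hα : 1 / 2 ≤ α) (hp : 2 < p)
    (hf : MemLp f p (volume.restrict (sectorRing r α))) (n : ℕ) {t : ℂ}
    (ht : t ∈ frontier (sectorRing r α)) :
    Tendsto (fun z => (polyPompeiu r α (n + 1) f z).re) (𝓝[sectorRing r α] t) (𝓝 0) := by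
  obtain ⟨C, hK⟩ := exists_isCauchyKernel_sectorKernel hr0 hr1 hα hf.1
  have h1 := (hK.tendsto_re_potential (isOpen_sectorRing hr0) sectorRing_subset_ball hp hf n
    ht).const_mul ((-1 : ℝ) ^ (n + 1) / (Real.pi * (n.factorial : ℝ)))
  rw [mul_zero] at h1
  refine h1.congr' ?_
  filter_upwards [self_mem_nhdsWithin] with z hz
  rw [polyPompeiu_eq_potential hr0 hr1 (by linarith) n hz, ← Complex.re_ofReal_mul]
  push_cast
  rfl

lemma continuousOn_polyPompeiu_one (hr0 : 0 < r) (hr1 : r < 1) (hα : 1 / 2 ≤ α) (hp : 2 < p)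
    (hf : MemLp f p (volume.restrict (sectorRing r α))) :
    ContinuousOn (polyPompeiu r α 1 f) (sectorRing r α) := by
  obtain ⟨C, hK⟩ := exists_isCauchyKernel_sectorKernel hr0 hr1 hα hf.1
  refine ContinuousOn.congr (continuousOn_const.mul (hK.continuousOn_potential
    (isOpen_sectorRing hr0) sectorRing_subset_ball hp hf 0))
    fun z hz => polyPompeiu_eq_potential hr0 hr1 (by linarith) 0 hz

lemma hasWeakDbar_polyPompeiu_one (hr0 : 0 < r) (hr1 : r < 1) (hα : 1 / 2 ≤ α) (hp : 2 < p)
    (hf : MemLp f p (volume.restrict (sectorRing r α))) :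
    HasWeakDbar (sectorRing r α) (polyPompeiu r α 1 f) f := by
  obtain ⟨C, hK⟩ := exists_isCauchyKernel_sectorKernel hr0 hr1 hα hf.1
  intro φ h1 h2 h3
  have h4 := hK.hasWeakDbar_potential (isOpen_sectorRing hr0) sectorRing_subset_ball hp hf h1 h2 h3
  have h5 : ∫ z in sectorRing r α, polyPompeiu r α 1 f z * dbar φ z
      = ∫ z in sectorRing r α, (-(Real.pi : ℂ)⁻¹) *
        (potential (sectorRing r α) (sectorKernel r α f) 0 z * dbar φ z) := by
    refine setIntegral_congr_fun (isOpen_sectorRing hr0).measurableSet fun z hz => ?_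
    have := polyPompeiu_eq_potential (f := f) hr0 hr1 (by linarith : 0 < α) 0 hz
    rw [zero_add] at this
    simp only [this, Nat.factorial_zero, Nat.cast_one, mul_one, pow_one, neg_div, one_div]
    ring
  have hπ : (Real.pi : ℂ) ≠ 0 := by exact_mod_cast Real.pi_ne_zero
  rw [h5, integral_const_mul, h4]
  field_simp

lemma polySchwarz_succ (n : ℕ) (γ : Fin (n + 1) → ℂ → ℝ) (z : ℂ) :
    polySchwarz r α (n + 1) γ z = schwarzTerm r α (γ 0) 0 z
      + ∑ k : Fin n, ((-1 : ℂ) ^ ((k : ℕ) + 1) / (((k : ℕ) + 1).factorial : ℂ)) *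
        schwarzTerm r α (γ k.succ) (k + 1) z := by
  change ∑ k : Fin (n + 1), ((-1 : ℂ) ^ (k : ℕ) / ((k : ℕ).factorial : ℂ)) *
    schwarzTerm r α (γ k) k z = _
  rw [Fin.sum_univ_succ]
  simp

lemma hasDbarAt_polySchwarz (hr0 : 0 < r) (hr1 : r < 1) (hα : 1 / 2 ≤ α) {n : ℕ}
    {γ : Fin (n + 1) → ℂ → ℝ} (hγ : ∀ k, ContinuousOn (γ k) (frontier (sectorRing r α)))
    {z : ℂ} (hz : z ∈ sectorRing r α) :
    HasDbarAt (polySchwarz r α (n + 1) γ) (polySchwarz r α n (fun k => γ k.succ) z) z := by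
  have h0 : HasDbarAt (schwarzTerm r α (γ 0) 0) 0 z :=
    HasDbarAt.of_differentiableAt ((differentiableOn_schwarzTerm_zero hr0 hr1 hα
      (hγ 0)).differentiableAt ((isOpen_sectorRing hr0).mem_nhds hz))
  have h1 := h0.add (HasDbarAt.sum (s := Finset.univ) fun (k : Fin n) _ =>
    (hasDbarAt_schwarzTerm_succ hr0 hr1 hα (hγ k.succ) k hz).const_mul
      ((-1 : ℂ) ^ ((k : ℕ) + 1) / (((k : ℕ) + 1).factorial : ℂ)))
  have h2 := h1.congr_of_eqOn (isOpen_sectorRing hr0) hz fun x _ => polySchwarz_succ n γ x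
  convert h2 using 1
  rw [zero_add]
  change ∑ k : Fin n, ((-1 : ℂ) ^ (k : ℕ) / ((k : ℕ).factorial : ℂ)) *
    schwarzTerm r α (γ k.succ) k z = _
  refine Finset.sum_congr rfl fun k _ => ?_
  have h3 : ((k : ℕ).factorial : ℂ) ≠ 0 := by exact_mod_cast (k : ℕ).factorial_ne_zero
  have h4 : (((k : ℕ) + 1 : ℕ) : ℂ) ≠ 0 := by exact_mod_cast (k : ℕ).succ_ne_zero
  rw [Nat.factorial_succ, Nat.cast_mul]
  field_simp
  ring

lemma tendsto_re_polySchwarz (hr0 : 0 < r) (hr1 : r < 1) (hα : 1 / 2 ≤ α) {n : ℕ}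
    {γ : Fin (n + 1) → ℂ → ℝ} (hγ : ∀ k, ContinuousOn (γ k) (frontier (sectorRing r α)))
    {t : ℂ} (ht : t ∈ frontier (sectorRing r α)) :
    Tendsto (fun z => (polySchwarz r α (n + 1) γ z).re) (𝓝[sectorRing r α] t) (𝓝 (γ 0 t)) := by
  have h0 := tendsto_re_schwarzTerm hr0 hr1 hα (hγ 0) 0 ht
  rw [pow_zero, mul_one] at h0
  have h1 : ∀ k : Fin n, Tendsto (fun z => ((-1 : ℝ) ^ ((k : ℕ) + 1) /
      (((k : ℕ) + 1).factorial : ℝ)) * (schwarzTerm r α (γ k.succ) (k + 1) z).re)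
      (𝓝[sectorRing r α] t) (𝓝 0) := by
    intro k
    have := (tendsto_re_schwarzTerm hr0 hr1 hα (hγ k.succ) (k + 1) ht).const_mul
      ((-1 : ℝ) ^ ((k : ℕ) + 1) / (((k : ℕ) + 1).factorial : ℝ))
    simpa using this
  have h2 := h0.add (tendsto_finsetSum Finset.univ fun k _ => h1 k)
  rw [Finset.sum_const_zero, add_zero] at h2
  refine h2.congr fun z => ?_
  rw [polySchwarz_succ, Complex.add_re, Complex.re_sum]
  congr 1
  refine Finset.sum_congr rfl fun k _ => ?_
  rw [← Complex.re_ofReal_mul]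
  push_cast
  rfl

/-- The general solution of the Schwarz problem. -/
def schwarzSolution (r α : ℝ) (n : ℕ) (f : ℂ → ℂ) (γ : Fin n → ℂ → ℝ) (c : Fin n → ℝ) (z : ℂ) :
    ℂ :=
  polySchwarz r α n γ z + polyPompeiu r α n f z
    + Complex.I * ∑ k : Fin n, (z + conj z) ^ (k : ℕ) * (c k : ℂ)

/-- Each of the three parts of the formula reproduces itself one order lower; in the polynomial part
(z + z̄)^(k+1) becomes (k + 1)(z + z̄)^k, hence the rescaled constants. -/
lemma hasDbarAt_schwarzSolution (hr0 : 0 < r) (hr1 : r < 1) (hα : 1 / 2 ≤ α) (hp : 2 < p)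
    (hf : MemLp f p (volume.restrict (sectorRing r α))) {n : ℕ}
    {γ : Fin (n + 2) → ℂ → ℝ} (hγ : ∀ k, ContinuousOn (γ k) (frontier (sectorRing r α)))
    (c : Fin (n + 2) → ℝ) {z : ℂ} (hz : z ∈ sectorRing r α) :
    HasDbarAt (schwarzSolution r α (n + 2) f γ c)
      (schwarzSolution r α (n + 1) f (fun k => γ k.succ)
        (fun k => ((k : ℕ) + 1) * c k.succ) z) z := by
  have h1 : HasDbarAt (fun z => ∑ k : Fin (n + 2), (z + conj z) ^ (k : ℕ) * (c k : ℂ))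
      (∑ k : Fin (n + 1), (z + conj z) ^ (k : ℕ) * ((((k : ℕ) + 1) * c k.succ : ℝ) : ℂ)) z := by
    have h2 : HasDbarAt (fun _ => (c 0 : ℂ)) 0 z :=
      HasDbarAt.of_differentiableAt (differentiableAt_const _)
    have h3 := h2.add (HasDbarAt.sum (s := Finset.univ) fun (k : Fin (n + 1)) _ =>
      ((hasDbarAt_add_conj z).pow_succ k).const_mul (c k.succ : ℂ))
    convert h3 using 1
    · funext x
      rw [Fin.sum_univ_succ]
      simp only [Fin.val_zero, pow_zero, one_mul, Fin.val_succ]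
      congr 1
      exact Finset.sum_congr rfl fun k _ => mul_comm _ _
    · rw [zero_add]
      refine Finset.sum_congr rfl fun k _ => ?_
      push_cast
      ring
  exact ((hasDbarAt_polySchwarz hr0 hr1 hα hγ hz).add
    (hasDbarAt_polyPompeiu hr0 hr1 hα hp hf n hz)).add (h1.const_mul Complex.I)

lemma tendsto_re_schwarzSolution (hr0 : 0 < r) (hr1 : r < 1) (hα : 1 / 2 ≤ α) (hp : 2 < p)
    (hf : MemLp f p (volume.restrict (sectorRing r α))) {n : ℕ}
    {γ : Fin (n + 1) → ℂ → ℝ} (hγ : ∀ k, ContinuousOn (γ k) (frontier (sectorRing r α)))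
    (c : Fin (n + 1) → ℝ) {t : ℂ} (ht : t ∈ frontier (sectorRing r α)) :
    Tendsto (fun z => (schwarzSolution r α (n + 1) f γ c z).re) (𝓝[sectorRing r α] t)
      (𝓝 (γ 0 t)) := by
  have h1 := (tendsto_re_polySchwarz hr0 hr1 hα hγ ht).add
    (tendsto_re_polyPompeiu hr0 hr1 hα hp hf n ht)
  rw [add_zero] at h1
  refine h1.congr fun z => ?_
  have h2 : ∑ k : Fin (n + 1), (z + conj z) ^ (k : ℕ) * (c k : ℂ)
      = ((∑ k : Fin (n + 1), (2 * z.re) ^ (k : ℕ) * c k : ℝ) : ℂ) := by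
    rw [Complex.add_conj]
    push_cast
    rfl
  rw [schwarzSolution, h2, Complex.add_re, Complex.add_re, Complex.I_mul_re, Complex.ofReal_im,
    neg_zero, add_zero]

/-- Iterating `dbar` k + 1 times on w is iterating it k times on `dbar w`, so a problem of order n +
2 is one boundary condition for w and a problem of order n + 1 for its derivative. -/
lemma isSchwarzSolution_succ_iff {Ω : Set ℂ} {n : ℕ} {γ : Fin (n + 2) → ℂ → ℝ} {w : ℂ → ℂ} :
    IsSchwarzSolution Ω (n + 2) f γ w ↔ DifferentiableOn ℝ w Ω ∧
      (∀ t ∈ frontier Ω, Tendsto (fun z => (w z).re) (𝓝[Ω] t) (𝓝 (γ 0 t))) ∧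
      IsSchwarzSolution Ω (n + 1) f (fun k => γ k.succ) (dbar w) := by
  constructor
  · intro h
    refine ⟨h.differentiableOn 0 (by omega), fun t ht => h.boundary 0 t ht, ?_, ?_, ?_, ?_⟩
    · intro k hk
      exact h.differentiableOn (k + 1) (by omega)
    · exact h.continuousOn
    · exact h.equation
    · intro k t ht
      exact h.boundary k.succ t ht
  · rintro ⟨h1, h2, h3⟩
    refine ⟨?_, h3.continuousOn, h3.equation, ?_⟩
    · intro k hk
      cases k with
      | zero => exact h1
      | succ k => exact h3.differentiableOn k (by omega)
    · intro k t ht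
      refine Fin.cases ?_ (fun j => ?_) k
      · exact h2 t ht
      · exact h3.boundary j t ht

lemma isSchwarzSolution_one_iff {Ω : Set ℂ} {γ : Fin 1 → ℂ → ℝ} {w : ℂ → ℂ} :
    IsSchwarzSolution Ω 1 f γ w ↔ ContinuousOn w Ω ∧ HasWeakDbar Ω w f ∧
      ∀ t ∈ frontier Ω, Tendsto (fun z => (w z).re) (𝓝[Ω] t) (𝓝 (γ 0 t)) := by
  constructor
  · exact fun h => ⟨h.continuousOn, h.equation, h.boundary 0⟩
  · rintro ⟨h1, h2, h3⟩
    refine ⟨fun k hk => absurd hk (by omega), h1, h2, fun k => ?_⟩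
    rw [Fin.fin_one_eq_zero k]
    exact h3

lemma HasWeakDbar.add_holomorphic {Ω : Set ℂ} {u v h : ℂ → ℂ} (hΩ : IsOpen Ω)
    (hv : HasWeakDbar Ω v f) (hvc : ContinuousOn v Ω) (hh : DifferentiableOn ℂ h Ω)
    (e : ∀ z ∈ Ω, u z = v z + h z) : HasWeakDbar Ω u f := by
  intro φ h1 h2 h3
  have h3' := (tsupport_dbar_subset (φ := φ)).trans h3
  have hd := continuous_dbar h1
  have hdc := hasCompactSupport_dbar h2
  rw [← hv φ h1 h2 h3, ← add_zero (∫ z in Ω, v z * dbar φ z),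
    ← integral_mul_dbar_of_differentiableOn hΩ hh h1 h2 h3,
    ← setIntegral_mul_eq_integral (h := h) h3',
    ← integral_add (integrable_mul_of_tsupport_subset hvc hd hdc h3').integrableOn
      (integrable_mul_of_tsupport_subset hh.continuousOn hd hdc h3').integrableOn]
  refine setIntegral_congr_fun hΩ.measurableSet fun z hz => ?_
  simp only [e z hz]
  ring

lemma HasWeakDbar.differentiableOn_sub {Ω : Set ℂ} {u v : ℂ → ℂ} (hΩ : IsOpen Ω)
    (hu : HasWeakDbar Ω u f) (hv : HasWeakDbar Ω v f) (huc : ContinuousOn u Ω)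
    (hvc : ContinuousOn v Ω) : DifferentiableOn ℂ (fun z => u z - v z) Ω := by
  refine differentiableOn_of_weakDbar_eq_zero hΩ (huc.sub hvc) fun φ h1 h2 h3 => ?_
  have h3' := (tsupport_dbar_subset (φ := φ)).trans h3
  have hd := continuous_dbar h1
  have hdc := hasCompactSupport_dbar h2
  simp only [sub_mul]
  rw [integral_sub (integrable_mul_of_tsupport_subset huc hd hdc h3').integrableOn
      (integrable_mul_of_tsupport_subset hvc hd hdc h3').integrableOn, hu φ h1 h2 h3,
    hv φ h1 h2 h3, sub_self]

/-- Two functions with holomorphic difference and the same real boundary values differ by an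
imaginary constant. -/
lemma exists_eq_add_imaginary_const (hr0 : 0 < r) (hα : 1 / 2 ≤ α) {w v : ℂ → ℂ} {g : ℂ → ℝ}
    (hd : DifferentiableOn ℂ (fun z => w z - v z) (sectorRing r α))
    (hw : ∀ t ∈ frontier (sectorRing r α),
      Tendsto (fun z => (w z).re) (𝓝[sectorRing r α] t) (𝓝 (g t)))
    (hv : ∀ t ∈ frontier (sectorRing r α),
      Tendsto (fun z => (v z).re) (𝓝[sectorRing r α] t) (𝓝 (g t))) :
    ∃ c : ℝ, ∀ z ∈ sectorRing r α, w z = v z + Complex.I * c := by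
  obtain ⟨c, hc⟩ := eq_imaginary_const_of_tendsto_re (isOpen_sectorRing hr0)
    (Metric.isBounded_ball.subset sectorRing_subset_ball) (isPreconnected_sectorRing hr0 hα) hd
    fun t ht => by
      have := (hw t ht).sub (hv t ht)
      rw [sub_self] at this
      exact this
  exact ⟨c, fun z hz => by rw [← hc z hz]; ring⟩

theorem isSchwarzSolution_iff (hr0 : 0 < r) (hr1 : r < 1) (hα : 1 / 2 ≤ α) (hp : 2 < p)
    (hf : MemLp f p (volume.restrict (sectorRing r α))) (n : ℕ) :
    ∀ (γ : Fin (n + 1) → ℂ → ℝ), (∀ k, ContinuousOn (γ k) (frontier (sectorRing r α))) →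
      ∀ w : ℂ → ℂ, IsSchwarzSolution (sectorRing r α) (n + 1) f γ w ↔
        ∃ c : Fin (n + 1) → ℝ, ∀ z ∈ sectorRing r α,
          w z = schwarzSolution r α (n + 1) f γ c z := by
  have hΩ : IsOpen (sectorRing r α) := isOpen_sectorRing hr0
  induction n with
  | zero =>
    intro γ hγ w
    have hS : ∀ z, polySchwarz r α 1 γ z = schwarzTerm r α (γ 0) 0 z := fun z => by
      rw [polySchwarz_succ]
      simp
    have hform : ∀ c z, schwarzSolution r α 1 f γ c z
        = polyPompeiu r α 1 f z + (schwarzTerm r α (γ 0) 0 z + Complex.I * (c 0 : ℝ)) := by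
      intro c z
      rw [schwarzSolution, hS]
      simp
      ring
    have hhol : ∀ a : ℂ, DifferentiableOn ℂ (fun z => schwarzTerm r α (γ 0) 0 z + a)
        (sectorRing r α) := fun a =>
      (differentiableOn_schwarzTerm_zero hr0 hr1 hα (hγ 0)).add_const a
    have hTc := continuousOn_polyPompeiu_one hr0 hr1 hα hp hf
    have hTw := hasWeakDbar_polyPompeiu_one hr0 hr1 hα hp hf
    have hFc : ∀ c, ContinuousOn (schwarzSolution r α 1 f γ c) (sectorRing r α) := fun c =>
      (hTc.add (hhol (Complex.I * (c 0 : ℝ))).continuousOn).congr fun z _ => hform c z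
    have hFw : ∀ c, HasWeakDbar (sectorRing r α) (schwarzSolution r α 1 f γ c) f := fun c =>
      hTw.add_holomorphic hΩ hTc (hhol (Complex.I * (c 0 : ℝ))) fun z _ => hform c z
    refine isSchwarzSolution_one_iff.trans ?_
    constructor
    · rintro ⟨h1, h2, h3⟩
      -- The comparison solution has constant zero; Weyl's lemma makes the difference holomorphic.
      obtain ⟨c, hc⟩ := exists_eq_add_imaginary_const hr0 hα
        (h2.differentiableOn_sub hΩ (hFw 0) h1 (hFc 0)) h3
        (fun t ht => tendsto_re_schwarzSolution hr0 hr1 hα hp hf hγ 0 ht)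
      refine ⟨fun _ => c, fun z hz => ?_⟩
      rw [hc z hz, hform, hform]
      simp
      ring
    · rintro ⟨c, hc⟩
      refine ⟨(hFc c).congr hc, ?_, fun t ht => ?_⟩
      -- Adding the zero function transfers the weak equation to w, which agrees with the formula
      -- only inside the domain.
      · exact (hFw c).add_holomorphic hΩ (hFc c) (differentiableOn_const 0)
          fun z hz => by rw [hc z hz, add_zero]
      · refine (tendsto_re_schwarzSolution hr0 hr1 hα hp hf hγ c ht).congr' ?_
        filter_upwards [self_mem_nhdsWithin] with z hz
        rw [hc z hz]
  | succ n ih =>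
    intro γ hγ w
    rw [isSchwarzSolution_succ_iff, ih (fun k => γ k.succ) (fun k => hγ k.succ)]
    constructor
    · rintro ⟨h1, h2, c', hc'⟩
      -- Division by k + 1 undoes the differentiation of the polynomial part. The lowest constant is
      -- invisible to ∂/∂z̄; it is set to zero here and supplied afterwards by the boundary
      -- comparison.
      set c : Fin (n + 2) → ℝ := Fin.cons 0 fun k => c' k / ((k : ℕ) + 1) with hcdef
      have hcc : (fun k : Fin (n + 1) => ((k : ℕ) + 1) * c k.succ) = c' := by
        funext k
        have : ((k : ℕ) + 1 : ℝ) ≠ 0 := by positivity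
        simp only [hcdef, Fin.cons_succ]
        field_simp
      have hd : DifferentiableOn ℂ (fun z => w z - schwarzSolution r α (n + 2) f γ c z)
          (sectorRing r α) := by
        intro z hz
        have h3 := HasDbarAt.of_real_differentiableAt (h1.differentiableAt (hΩ.mem_nhds hz))
        have h4 := hasDbarAt_schwarzSolution hr0 hr1 hα hp hf hγ c hz
        rw [hcc, ← hc' z hz] at h4
        have h5 := h3.sub h4
        rw [sub_self] at h5
        exact h5.differentiableAt_complex.differentiableWithinAt
      obtain ⟨c₀, hc₀⟩ := exists_eq_add_imaginary_const hr0 hα hd h2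
        (fun t ht => tendsto_re_schwarzSolution hr0 hr1 hα hp hf hγ c ht)
      refine ⟨Fin.cons c₀ fun k => c' k / ((k : ℕ) + 1), fun z hz => ?_⟩
      rw [hc₀ z hz, schwarzSolution, schwarzSolution, Fin.sum_univ_succ, Fin.sum_univ_succ (n := n + 1)]
      simp only [hcdef, Fin.cons_zero, Fin.cons_succ, Fin.val_zero, pow_zero, Complex.ofReal_zero]
      ring
    · rintro ⟨c, hc⟩
      have hder : ∀ z ∈ sectorRing r α, HasDbarAt w _ z := fun z hz =>
        (hasDbarAt_schwarzSolution hr0 hr1 hα hp hf hγ c hz).congr_of_eqOn hΩ hz hc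
      refine ⟨fun z hz => (hder z hz).differentiableAt.differentiableWithinAt, fun t ht => ?_,
        fun k => ((k : ℕ) + 1) * c k.succ, fun z hz => (hder z hz).dbar_eq⟩
      refine (tendsto_re_schwarzSolution hr0 hr1 hα hp hf hγ c ht).congr' ?_
      filter_upwards [self_mem_nhdsWithin] with z hz
      rw [hc z hz]

end

end SectorRing

end

theorem theorem3p1 (r α : ℝ) (hr0 : 0 < r) (hr1 : r < 1) (hα : 1 / 2 ≤ α)
    (n : ℕ) (hn : 1 ≤ n) (p : ENNReal) (hp : 2 < p)
    (f : ℂ → ℂ)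
    (hf : MeasureTheory.MemLp f p (MeasureTheory.volume.restrict (SectorRing.sectorRing r α)))
    (γ : Fin n → ℂ → ℝ)
    (hγ : ∀ k, ContinuousOn (γ k) (frontier (SectorRing.sectorRing r α)))
    (w : ℂ → ℂ) :
    SectorRing.IsSchwarzSolution (SectorRing.sectorRing r α) n f γ w ↔
      ∃ c : Fin n → ℝ, ∀ z ∈ SectorRing.sectorRing r α,
        w z = SectorRing.polySchwarz r α n γ z + SectorRing.polyPompeiu r α n f z
          + Complex.I * ∑ k : Fin n, (z + (starRingEnd ℂ) z) ^ (k : ℕ) * (c k : ℂ) := by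
  obtain ⟨m, rfl⟩ : ∃ m, n = m + 1 := ⟨n - 1, by omega⟩
  exact SectorRing.isSchwarzSolution_iff hr0 hr1 hα hp hf m γ hγ w
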